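/- **Setting.** Let $R>0$, $\alpha\in\,]0,1[$, $B,\beta>0$, and let $v\in C^2([0,R];[0,+\infty[)$ satisfy $v'<0$ on $]0,R[$ and be such that $f(\rho)=\rho\,v(\rho)$ satisfies $f(R)=0$ and $-B\le f''\le-\beta$ on $[0,R]$. Put $V=\max_{[0,R]}v$. For $u\in[0,V]$ let $F_\alpha(u)=\max_{\rho\in[0,\alpha R]}\left(\alpha f(\rho/\alpha)-u\rho\right)$, $\varphi_u(\rho)=F_\alpha(u)+u\rho$, and let $\check\rho_u\le\hat\rho_u$ be the smallest and the largest $\rho\in[0,R]$ with $f(\rho)=\varphi_u(\rho)$. Let $\rho_0\in L^1(\mathbb R;[0,R])$ and $u\in L^1(\mathbb R^+;[0,V])$ have finite (essential) total variation, and let $y_0\in\mathbb R$. **Grids.** Let $u^\nu_0=0$ and let $u^\nu_{j+1}$ be given by $\hat\rho_{u^\nu_{j+1}}=\check\rho_{u^\nu_j}$; let $J_\nu$ be the first index $J$ with $V-u^\nu_{J+1}<2^{-\nu}$. For $0\le k<2^\nu$ let $u^\nu_{k,0}=k\,u^\nu_1 2^{-\nu}$ and let $u^\nu_{k,i+1}$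 be given by $\hat\rho_{u^\nu_{k,i+1}}=\check\rho_{u^\nu_{k,i}}$. Put $$\mathcal U_\nu=\{u^\nu_{k,i}: 0\le k<2^\nu,\ 0\le i\le J_\nu\}\cup\{V\},$$ $$\mathcal M_\nu=\{\check\rho_w,\hat\rho_w: w\in\mathcal U_\nu\}\cup\{\hat\rho_0+\ell(R-\hat\rho_0)2^{-\nu}: 0\le\ell\le 2^\nu\},$$ and let $f_\nu$ be the piecewise linear interpolation of $f$ at the nodes $\mathcal M_\nu$. Let $\rho_{0,\nu}:\mathbb R\to\mathcal M_\nu$ and $u_\nu:\mathbb R^+\to\mathcal U_\nu$ be integrable, piecewise constant with finitely many discontinuities, with $\rho_{0,\nu}\to\rho_0$ and $u_\nu\to u$ in $L^1$, $\mathrm{TV}(\rho_{0,\nu})\le\mathrm{TV}(\rho_0)$ and $\mathrm{TV}(u_\nu)\le\mathrm{TV}(u)$. They are normalized so that $\rho_{0,\nu}$ is right continuous and $u_\nu$ is left continuous on $]0,+\infty[$ and right continuous at $0$. **Riemann solvers.** Let $\mathcal R(\rho_l,\rho_r)(x/t)$ be the right-continuous self-similar entropy solution of the Riemann problem for $\partial_t\rho+\partial_xf_\nu(\rho)=0$.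 The constrained solver for the speed $w$ is as follows. Put $m=\mathcal R(\rho_l,\rho_r)(w)$. If $f_\nu(m)>F_\alpha(w)+wm$, the density is $\mathcal R(\rho_l,\hat\rho_w)(x/t)$ for $x<wt$ and $\mathcal R(\check\rho_w,\rho_r)(x/t)$ for $x\ge wt$, and the vehicle has speed $w$. Otherwise the density is $\mathcal R(\rho_l,\rho_r)(x/t)$ and the vehicle has speed $\min\{w,v(\rho_r)\}$. **Wave-front tracking.** For $\nu\ge1$, a pair $(\rho_\nu,y_\nu)$ is constructed by wave-front tracking on $[0,T[$ ($0<T\le+\infty$) as follows. It starts from $(\rho_{0,\nu},y_0)$; $\rho_\nu(t,\cdot)$ is right continuous and piecewise constant with values in $\mathcal M_\nu$ and finitely many jumps, $t\mapsto\rho_\nu(t,\cdot)$ is continuous for the $L^1$ distance, and $y_\nu$ is continuous. From every time $t$ it evolves, for a short time, by solving the constrained Riemann problem with $w=u_\nu(t_+)$ at $y_\nu(t)$ and the classical Riemann problem at every other jump of $\rho_\nu(t,\cdot)$. (At a time without wave interaction and without jump of $u_\nu$ this just continues the existing fronts.) **Functional.** Let $$\Upsilon(t)=\mathrm{TV}(\rho_\nu(t,\cdot))+2R+\gamma(t)+\frac6\beta\,\mathrm{TV}(u_\nu;[t,+\infty[),$$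 where $\gamma(t)=-2(\hat\rho_{u_\nu(t)}-\check\rho_{u_\nu(t)})$ if $\rho_\nu(t,y_\nu(t)_-)=\hat\rho_{u_\nu(t)}$ and $\rho_\nu(t,y_\nu(t)_+)=\check\rho_{u_\nu(t)}$, and $\gamma(t)=0$ otherwise. **Claim.** For every $\nu\ge1$: 1. Wave-front tracking can be carried out on $[0,+\infty[$, and every pair constructed on some $[0,T[$, $0<T<+\infty$, extends to one constructed on $[0,+\infty[$. 2. Every pair $(\rho_\nu,y_\nu)$ constructed on $[0,+\infty[$ has finitely many fronts: for all $t\ge0$ the discontinuities of $\rho_\nu(t,\cdot)$ and the trajectory $y_\nu$ lie on finitely many straight lines of the $(t,x)$-plane. 3. For every such pair and every $t>0$, $\mathrm{TV}(\rho_\nu(t,\cdot))$ is finite and $$\mathrm{TV}(\rho_\nu(t,\cdot))\le\Upsilon(t)\le\Upsilon(0)\le\mathrm{TV}(\rho_0)+2R+\frac6\beta\,\mathrm{TV}(u).$$ -/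

import Mathlib

open Set Filter Topology MeasureTheory
open scoped ENNReal

noncomputable section

/-- Essential variation of (the a.e. class of) `g` on `s`: the least pointwise variation of a
representative. -/
def essVariation (g : ℝ → ℝ) (s : Set ℝ) : ℝ≥0∞ :=
  ⨅ h : {h : ℝ → ℝ // h =ᵐ[volume.restrict s] g}, eVariationOn h.1 s

/-- `g` is piecewise constant on `s`, with finitely many discontinuities: it is constant on every
interval with end points in `s` that avoids a suitable finite set. -/
def IsPiecewiseConstOn (g : ℝ → ℝ) (s : Set ℝ) : Prop :=
  ∃ D : Finset ℝ, ∀ a ∈ s, ∀ b ∈ s, a ≤ b → (∀ d ∈ D, d ∉ Icc a b) → g a = g b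

/-- The data of the LWR model with a moving bottleneck: maximal density `R`, speed law `v`, capacity
ratio `α`, and the standing assumptions on the flux `f ρ = ρ v(ρ)`. -/
structure LWRModel where
  R : ℝ
  v : ℝ → ℝ
  α : ℝ
  β : ℝ
  B : ℝ
  R_pos : 0 < R
  α_mem : α ∈ Ioo (0 : ℝ) 1
  β_pos : 0 < β
  B_pos : 0 < B
  v_contDiff : ContDiffOn ℝ 2 v (Icc 0 R)
  v_nonneg : ∀ ρ ∈ Icc 0 R, 0 ≤ v ρ
  v_deriv_neg : ∀ ρ ∈ Ioo 0 R, deriv v ρ < 0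
  flux_R : R * v R = 0
  flux_concave : ∀ ρ ∈ Icc 0 R,
    iteratedDerivWithin 2 (fun r => r * v r) (Icc 0 R) ρ ∈ Icc (-B) (-β)

namespace LWRModel

variable (P : LWRModel)

/-- The flux `f`. -/
def flux (ρ : ℝ) : ℝ := ρ * P.v ρ

/-- The maximal speed `V`. -/
def V : ℝ := sSup (P.v '' Icc 0 P.R)

/-- `F_α(u) = max_ρ (α f(ρ/α) - u ρ)`, over the domain `[0, α R]` of the reduced flux. -/
def capacity (u : ℝ) : ℝ :=
  sSup ((fun ρ => P.α * P.flux (ρ / P.α) - u * ρ) '' Icc 0 (P.α * P.R))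

/-- The line `φ_u`, of slope `u` and tangent to the reduced flux. -/
def phi (u ρ : ℝ) : ℝ := P.capacity u + u * ρ

/-- The set `𝓘_u` where the flux meets the line `φ_u`. -/
def meets (u : ℝ) : Set ℝ := {ρ | ρ ∈ Icc 0 P.R ∧ P.flux ρ = P.phi u ρ}

/-- `ρ̌_u = min 𝓘_u`. -/
def check (u : ℝ) : ℝ := sInf (P.meets u)

/-- `ρ̂_u = max 𝓘_u`. -/
def hat (u : ℝ) : ℝ := sSup (P.meets u)

/-- The (unique) `u ∈ [0, V]` with `ρ̂_u = r`. -/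
def hatInv (r : ℝ) : ℝ := sInf {u | u ∈ Icc 0 P.V ∧ P.hat u = r}

/-! ### The grids -/

/-- `u_0 = 0`, and `u_{j+1}` is given by `ρ̂(u_{j+1}) = ρ̌(u_j)`. -/
def coarse : ℕ → ℝ
  | 0 => 0
  | j + 1 => P.hatInv (P.check (coarse j))

/-- The index at which the coarse sequence is stopped: the first `J` with `V - u_{J+1} < 2^{-ν}`. -/
def lastIndex (ν : ℕ) : ℕ := sInf {J : ℕ | P.V - P.coarse (J + 1) < 1 / 2 ^ ν}

/-- `u_{k,0} = k u_1 2^{-ν}`, and `u_{k,i+1}` is given by `ρ̂(u_{k,i+1}) = ρ̌(u_{k,i})`. -/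
def fine (ν k : ℕ) : ℕ → ℝ
  | 0 => k * P.coarse 1 / 2 ^ ν
  | i + 1 => P.hatInv (P.check (fine ν k i))

/-- The grid `𝓤_ν` of speeds. For `k = 0` the sequence `fine ν k` is `coarse`. -/
def speedGrid (ν : ℕ) : Set ℝ :=
  {u | ∃ k : ℕ, k < 2 ^ ν ∧ ∃ i : ℕ, i ≤ P.lastIndex ν ∧ u = P.fine ν k i} ∪ {P.V}

/-- The grid `𝓜_ν` of densities: all `ρ̌_u` and `ρ̂_u` with `u ∈ 𝓤_ν` (for `u = V` this is `0`),
and `2^ν` equal steps from `ρ̂_0` to `R`. -/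
def densityGrid (ν : ℕ) : Set ℝ :=
  P.check '' P.speedGrid ν ∪ P.hat '' P.speedGrid ν ∪
    {ρ | ∃ l : ℕ, l ≤ 2 ^ ν ∧ ρ = P.hat 0 + l * (P.R - P.hat 0) / 2 ^ ν}

/-- The flux `f_ν`: the piecewise linear interpolation of `f` at the nodes `𝓜_ν`. -/
def fluxApprox (ν : ℕ) (ρ : ℝ) : ℝ :=
  let a := sSup (P.densityGrid ν ∩ Iic ρ)
  let b := sInf (P.densityGrid ν ∩ Ici ρ)
  P.flux a + (P.flux b - P.flux a) / (b - a) * (ρ - a)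

/-! ### Riemann solvers -/

/-- The classical Riemann solver `ξ = x/t ↦ 𝓡(ρl, ρr)(ξ)` for the concave flux `f_ν`, in its right
continuous version: a single shock when `ρl < ρr`; when `ρr ≤ ρl`, the rarefaction, whose value at
`ξ` is the (least) maximizer of `q ↦ f_ν(q) - ξ q` on `[ρr, ρl]`. As `f_ν` is piecewise linear, the
latter is a fan of jumps between the consecutive nodes from `ρl` down to `ρr`, each travelling with
its Rankine-Hugoniot speed. -/
def riemann (ν : ℕ) (ρl ρr ξ : ℝ) : ℝ :=
  open Classical in
  if ρl < ρr then
    if ξ < (P.fluxApprox ν ρl - P.fluxApprox ν ρr) / (ρl - ρr) then ρl else ρr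
  else sInf {p | p ∈ Icc ρr ρl ∧
    IsMaxOn (fun q => P.fluxApprox ν q - ξ * q) (Icc ρr ρl) p}

/-- The classical solution violates the constraint at a vehicle of desired speed `u`. -/
def Violates (ν : ℕ) (u ρl ρr : ℝ) : Prop :=
  P.capacity u + u * P.riemann ν ρl ρr u < P.fluxApprox ν (P.riemann ν ρl ρr u)

/-- The constrained Riemann solver `𝓡^u`, density. -/
def constrainedRiemann (ν : ℕ) (u ρl ρr ξ : ℝ) : ℝ :=
  open Classical in
  if P.Violates ν u ρl ρr then
    if ξ < u then P.riemann ν ρl (P.hat u) ξ else P.riemann ν (P.check u) ρr ξ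
  else P.riemann ν ρl ρr ξ

/-- The constrained Riemann solver `𝓡^u`, speed of the vehicle: `u` if the constraint is enforced,
and `ω(ρr; u) = min {u, v(ρr)}` otherwise. -/
def vehicleSpeed (ν : ℕ) (u ρl ρr : ℝ) : ℝ :=
  open Classical in
  if P.Violates ν u ρl ρr then u else min u (P.v ρr)

/-! ### Wave-front tracking -/

/-- Right after time `t`, `(ρ, y)` is obtained by solving all the Riemann problems of the profile
`ρ t`: the constrained one (desired speed `u`) at the position `y t` of the vehicle and the classical
one at every other discontinuity. Away from these points the profile does not change. -/
def FollowsRiemann (ν : ℕ) (u : ℝ) (ρ : ℝ → ℝ → ℝ) (y : ℝ → ℝ) (t : ℝ) : Prop :=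
  ∃ r > 0, ∀ᶠ s in 𝓝[>] t,
    y s = y t + P.vehicleSpeed ν u (Function.leftLim (ρ t) (y t)) (Function.rightLim (ρ t) (y t))
      * (s - t) ∧
    ∀ x,
      (|x - y t| < r → ρ s x = P.constrainedRiemann ν u (Function.leftLim (ρ t) (y t))
        (Function.rightLim (ρ t) (y t)) ((x - y t) / (s - t))) ∧
      (∀ z, z ≠ y t → ¬ ContinuousAt (ρ t) z → |x - z| < r →
        ρ s x = P.riemann ν (Function.leftLim (ρ t) z) (Function.rightLim (ρ t) z)
          ((x - z) / (s - t))) ∧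
      (r ≤ |x - y t| → (∀ z, ¬ ContinuousAt (ρ t) z → r ≤ |x - z|) → ρ s x = ρ t x)

/-- `(ρ, y)` is the result of the wave-front tracking procedure at level `ν` on the time interval `I`
(which is `[0, T)` or `[0, ∞)`), for the initial density `p`, the initial position `y₀` and the
piecewise constant control `w`. Starting the Riemann solvers afresh at a time without an interaction
or a jump of `w` does not change anything, so the Riemann problems are required to be solved at
every time; at the end of an interval between two such restarts the state is the limit in `L¹`. -/
structure IsFrontTracking (ν : ℕ) (p : ℝ → ℝ) (y₀ : ℝ) (w : ℝ → ℝ) (I : Set ℝ)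
    (ρ : ℝ → ℝ → ℝ) (y : ℝ → ℝ) : Prop where
  initial_density : ρ 0 = p
  initial_position : y 0 = y₀
  mem_grid : ∀ t ∈ I, ∀ x, ρ t x ∈ P.densityGrid ν
  piecewiseConst : ∀ t ∈ I, IsPiecewiseConstOn (ρ t) univ
  right_continuous : ∀ t ∈ I, ∀ x, ContinuousWithinAt (ρ t) (Ici x) x
  density_continuous : ∀ t ∈ I,
    Tendsto (fun s => ∫⁻ x, ‖ρ s x - ρ t x‖ₑ) (𝓝[I] t) (𝓝 0)
  position_continuous : ContinuousOn y I
  followsRiemann : ∀ t ∈ I, P.FollowsRiemann ν (Function.rightLim w t) ρ y t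

/-- The assumptions on the initial density `ρ₀ ∈ L¹(ℝ; [0, R])`, the control `u ∈ L¹(ℝ⁺; [0, V])`
and on the piecewise constant approximations `p ν` and `w ν`. The representatives of the latter are
normalized: `p ν` is right continuous; `w ν` is left continuous, and right continuous at time `0`. -/
structure IsApproximation (ρ₀ u : ℝ → ℝ) (p w : ℕ → ℝ → ℝ) : Prop where
  density_integrable : Integrable ρ₀
  density_mem : ∀ᵐ x, ρ₀ x ∈ Icc 0 P.R
  density_variation : essVariation ρ₀ univ ≠ ⊤
  control_integrable : IntegrableOn u (Ici 0)
  control_mem : ∀ᵐ t ∂(volume.restrict (Ici 0)), u t ∈ Icc 0 P.V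
  control_variation : essVariation u (Ici 0) ≠ ⊤
  p_mem : ∀ ν x, p ν x ∈ P.densityGrid ν
  p_integrable : ∀ ν, Integrable (p ν)
  p_piecewiseConst : ∀ ν, IsPiecewiseConstOn (p ν) univ
  p_right_continuous : ∀ ν x, ContinuousWithinAt (p ν) (Ici x) x
  p_tendsto : Tendsto (fun ν => ∫⁻ x, ‖p ν x - ρ₀ x‖ₑ) atTop (𝓝 0)
  p_variation : ∀ ν, eVariationOn (p ν) univ ≤ essVariation ρ₀ univ
  w_mem : ∀ ν, ∀ t ≥ 0, w ν t ∈ P.speedGrid ν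
  w_integrable : ∀ ν, IntegrableOn (w ν) (Ici 0)
  w_piecewiseConst : ∀ ν, IsPiecewiseConstOn (w ν) (Ici 0)
  w_left_continuous : ∀ ν, ∀ t > 0, ContinuousWithinAt (w ν) (Iic t) t
  w_right_continuous_zero : ∀ ν, ContinuousWithinAt (w ν) (Ici 0) 0
  w_tendsto : Tendsto (fun ν => ∫⁻ t in Ici 0, ‖w ν t - u t‖ₑ) atTop (𝓝 0)
  w_variation : ∀ ν, eVariationOn (w ν) (Ici 0) ≤ essVariation u (Ici 0)

/-- The term `γ` of the functional, for a profile `q`, the vehicle at `z` and the desired speed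
`u`. -/
def gamma (u : ℝ) (q : ℝ → ℝ) (z : ℝ) : ℝ :=
  open Classical in
  if Function.leftLim q z = P.hat u ∧ Function.rightLim q z = P.check u then
    -2 * (P.hat u - P.check u)
  else 0

/-- The Glimm type functional `Υ(t)`. -/
def upsilon (w : ℝ → ℝ) (ρ : ℝ → ℝ → ℝ) (y : ℝ → ℝ) (t : ℝ) : ℝ :=
  (eVariationOn (ρ t) univ).toReal + 2 * P.R + P.gamma (w t) (ρ t) (y t) +
    6 / P.β * (eVariationOn w (Ici t)).toReal

end LWRModel

/-- The discontinuities of `ρ` and the trajectory `y` lie, for all times `t ≥ 0`, on finitely many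
straight lines of the `(t, x)`-plane. -/
def HasFinitelyManyFronts (ρ : ℝ → ℝ → ℝ) (y : ℝ → ℝ) : Prop :=
  ∃ L : Finset (ℝ × ℝ), ∀ t ≥ 0, (∃ q ∈ L, y t = q.1 * t + q.2) ∧
    ∀ x, ¬ ContinuousAt (ρ t) x → ∃ q ∈ L, x = q.1 * t + q.2

end

noncomputable section

namespace LWRModel

variable (P : LWRModel)

/-! ### The flux -/

/-! Front tracking has a unique outcome (`IsFrontTracking.unique`): the times at which two solutions
agree form a closed set, by `L¹` continuity and right continuity of the profiles, and agreement
extends to the right because the Riemann solvers determine the solution for a short time. Hence it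
suffices to build one global solution out of finitely many straight fronts and to prove the
estimates for it. Existence, extension and the statements about arbitrary solutions all follow.

The grids make the construction consistent. For a grid speed `u` both `ρ̌_u` and `ρ̂_u` are nodes,
so the constrained solver stays in the grid. Since the sequences of speeds are interlaced, some node
lies strictly between them when they differ (`exists_grid_between`). Therefore the jump from `ρ̂_u`
down to `ρ̌_u`, read as Riemann data, violates the constraint again and is reproduced
(`violates_active`): solving afresh between interactions changes nothing (`GoodAt.resolved`).

The functional does not increase for the following reasons. Away from the vehicle, merging fronts
cannot raise the variation. Enforcing the constraint raises it by at most `2(ρ̂_u - ρ̌_u)`, which is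
exactly what `γ` compensates. Conversely, fronts that destroy the jump at the vehicle lower the
variation by at least this amount (`Meeting.of_active`): a chain of fronts hitting the vehicle from
behind must start at or below `ρ̌_u`, and a chain hit by it must end at or above `ρ̂_u`
(`Chain.le_check`, `Chain.hat_le`). A jump of the control costs at most `6/β` times its size,
because `ρ̂` and `ρ̌` are monotone and Lipschitz with constant `2/β` (`hat_sub_le`, `check_sub_le`).
The control term of the functional pays for it.

Finiteness comes from a measure which decreases at every event. Let `δ` be the least distance of two
nodes. At an interaction without a control jump, either the functional drops by `2δ`, because the
vehicle starts to enforce the constraint (`Meeting.drop`), or an integer weight of the fronts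
decreases (`energy_or_weight`). Indeed, two or more classical fronts can only meet with left state
at most the right state (`Chain.le`), so at most one shock leaves. A front which merely crosses the
vehicle survives, but weighs three while it approaches the vehicle and two afterwards. The number of
pending control jumps, the integer part of the functional in units of `2δ`, and the weight thus
decrease lexicographically, and the recursion in `LWRModel.exists_frontSolution` stops. -/

theorem flux_contDiffOn : ContDiffOn ℝ 2 P.flux (Icc 0 P.R) :=
  contDiffOn_id.mul P.v_contDiff

theorem flux_continuousOn : ContinuousOn P.flux (Icc 0 P.R) :=
  P.flux_contDiffOn.continuousOn

@[simp] theorem flux_zero : P.flux 0 = 0 := by simp [flux]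

theorem flux_end : P.flux P.R = 0 := P.flux_R

theorem zero_mem : (0 : ℝ) ∈ Icc 0 P.R := ⟨le_rfl, P.R_pos.le⟩

theorem end_mem : P.R ∈ Icc 0 P.R := ⟨P.R_pos.le, le_rfl⟩

/-- In the interior the second derivative is at most `-β + β = 0`. This derivative-free form of
strong concavity can be used at the end points as well, where peaks may lie. -/
theorem flux_add_sq_concaveOn :
    ConcaveOn ℝ (Icc 0 P.R) fun ρ => P.flux ρ + P.β / 2 * ρ ^ 2 := by
  have hU : UniqueDiffOn ℝ (Icc (0 : ℝ) P.R) := uniqueDiffOn_Icc P.R_pos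
  have hat : ∀ x ∈ Ioo 0 P.R, ContDiffAt ℝ 2 P.flux x := fun x hx =>
    P.flux_contDiffOn.contDiffAt (Icc_mem_nhds hx.1 hx.2)
  have hd : ∀ x ∈ Ioo 0 P.R, DifferentiableAt ℝ P.flux x := fun x hx =>
    (hat x hx).differentiableAt (by norm_num)
  have hd2 : ∀ x ∈ Ioo 0 P.R, DifferentiableAt ℝ (deriv P.flux) x := fun x hx =>
    (((P.flux_contDiffOn.mono Ioo_subset_Icc_self).deriv_of_isOpen isOpen_Ioo
      (m := 1) (by norm_num)).contDiffAt (Ioo_mem_nhds hx.1 hx.2)).differentiableAt (by norm_num)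
  have hk : ∀ x ∈ Ioo 0 P.R,
      deriv (fun ρ => P.flux ρ + P.β / 2 * ρ ^ 2) x = deriv P.flux x + P.β * x := by
    intro x hx
    have h1 : HasDerivAt (fun ρ : ℝ => P.β / 2 * ρ ^ 2) (P.β / 2 * (2 * x)) x := by
      simpa using (hasDerivAt_pow 2 x).const_mul (P.β / 2)
    have := ((hd x hx).hasDerivAt.add h1).deriv
    rw [show P.β * x = P.β / 2 * (2 * x) by ring]
    exact this
  have hev : ∀ x ∈ Ioo 0 P.R, deriv (fun ρ => P.flux ρ + P.β / 2 * ρ ^ 2) =ᶠ[𝓝 x]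
      fun y => deriv P.flux y + P.β * y := by
    intro x hx
    filter_upwards [Ioo_mem_nhds hx.1 hx.2] with y hy using hk y hy
  have hlin : ∀ x : ℝ, HasDerivAt (fun y => P.β * y) P.β x := fun x => by
    simpa using (hasDerivAt_id x).const_mul P.β
  refine concaveOn_of_deriv2_nonpos (convex_Icc _ _) ?_ ?_ ?_ ?_
  · exact P.flux_continuousOn.add (by fun_prop)
  · rw [interior_Icc]
    exact fun x hx => ((hd x hx).add (by fun_prop)).differentiableWithinAt
  · rw [interior_Icc]
    intro x hx
    exact (((hd2 x hx).add (hlin x).differentiableAt).congr_of_eventuallyEq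
      (hev x hx)).differentiableWithinAt
  · rw [interior_Icc]
    intro x hx
    have hx' : x ∈ Icc 0 P.R := Ioo_subset_Icc_self hx
    have h2 := (P.flux_concave x hx').2
    change iteratedDerivWithin 2 P.flux (Icc 0 P.R) x ≤ -P.β at h2
    rw [iteratedDerivWithin_eq_iteratedDeriv hU (hat x hx) hx', iteratedDeriv_succ,
      iteratedDeriv_one] at h2
    change deriv (deriv fun ρ => P.flux ρ + P.β / 2 * ρ ^ 2) x ≤ 0
    rw [(hev x hx).deriv_eq]
    have := ((hd2 x hx).hasDerivAt.add (hlin x)).deriv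
    have h3 : deriv (fun y => deriv P.flux y + P.β * y) x = deriv (deriv P.flux) x + P.β := this
    rw [h3]; linarith

/-- Strong concavity of the flux, for three ordered points. -/
theorem flux_three {x y z : ℝ} (hx : 0 ≤ x) (hxy : x < y) (hyz : y < z) (hz : z ≤ P.R) :
    (P.flux z - P.flux y) * (y - x) + P.β / 2 * ((z - x) * (z - y) * (y - x)) ≤
      (P.flux y - P.flux x) * (z - y) := by
  have h := P.flux_add_sq_concaveOn.slope_anti_adjacent (x := x) (y := y) (z := z)
    ⟨hx, by linarith⟩ ⟨by linarith, hz⟩ hxy hyz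
  rw [div_le_div_iff₀ (by linarith) (by linarith)] at h
  nlinarith [h]

theorem flux_three_lt {x y z : ℝ} (hx : 0 ≤ x) (hxy : x < y) (hyz : y < z) (hz : z ≤ P.R) :
    (P.flux z - P.flux y) * (y - x) < (P.flux y - P.flux x) * (z - y) := by
  have h := P.flux_three hx hxy hyz hz
  have : 0 < P.β / 2 * ((z - x) * (z - y) * (y - x)) := by
    have := P.β_pos
    have := sub_pos.2 hxy
    have := sub_pos.2 hyz
    have : 0 < z - x := by linarith
    positivity
  linarith

theorem v_strictAntiOn : StrictAntiOn P.v (Icc 0 P.R) :=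
  strictAntiOn_of_deriv_neg (convex_Icc _ _) P.v_contDiff.continuousOn (by
    rw [interior_Icc]; exact P.v_deriv_neg)

theorem V_eq : P.V = P.v 0 := by
  refine IsGreatest.csSup_eq ⟨⟨0, P.zero_mem, rfl⟩, ?_⟩
  rintro _ ⟨ρ, hρ, rfl⟩
  exact P.v_strictAntiOn.antitoneOn P.zero_mem hρ hρ.1

theorem v_le_V {ρ : ℝ} (hρ : ρ ∈ Icc 0 P.R) : P.v ρ ≤ P.V := by
  rw [V_eq]; exact P.v_strictAntiOn.antitoneOn P.zero_mem hρ hρ.1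

theorem V_nonneg : 0 ≤ P.V := by rw [V_eq]; exact P.v_nonneg _ P.zero_mem

theorem V_pos : 0 < P.V := by
  have := P.v_strictAntiOn P.zero_mem P.end_mem P.R_pos
  have := P.v_nonneg _ P.end_mem
  rw [V_eq]; linarith

/-- The slope of the flux between two densities is at most the speed at the larger one. -/
theorem flux_sub_le {a b : ℝ} (ha : 0 ≤ a) (hab : a < b) (hb : b ≤ P.R) :
    P.flux b - P.flux a ≤ P.v b * (b - a) := by
  have := P.v_strictAntiOn ⟨ha, by linarith⟩ ⟨by linarith, hb⟩ hab
  simp only [flux]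
  nlinarith

/-! ### The tangent lines -/

/-- Substituting `ρ = α q` turns the reduced flux minus `u ρ` into `α (f(q) - u q)`, so the capacity
is `α` times the maximum of `f - u·id` on `[0, R]`. The maximizer `σ` organizes all estimates on
`ρ̌` and `ρ̂`. -/
theorem exists_peak (u : ℝ) : ∃ σ ∈ Icc 0 P.R,
    (∀ ρ ∈ Icc 0 P.R, P.flux ρ - u * ρ ≤ P.flux σ - u * σ) ∧
      P.capacity u = P.α * (P.flux σ - u * σ) := by
  obtain ⟨σ, hσ, hmax⟩ := isCompact_Icc.exists_isMaxOn (nonempty_Icc.2 P.R_pos.le)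
    (P.flux_continuousOn.sub (continuousOn_const.mul continuousOn_id) :
      ContinuousOn (fun ρ => P.flux ρ - u * ρ) (Icc 0 P.R))
  have hα := P.α_mem.1
  refine ⟨σ, hσ, fun ρ hρ => hmax hρ, ?_⟩
  refine IsGreatest.csSup_eq ⟨⟨P.α * σ, ⟨by have := hσ.1; positivity,
    mul_le_mul_of_nonneg_left hσ.2 hα.le⟩, ?_⟩, ?_⟩
  · simp only [mul_div_cancel_left₀ _ hα.ne']; ring
  · rintro _ ⟨ρ, hρ, rfl⟩
    have h := hmax (show ρ / P.α ∈ Icc 0 P.R from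
      ⟨div_nonneg hρ.1 hα.le, (div_le_iff₀ hα).2 (by linarith [hρ.2])⟩)
    change P.flux (ρ / P.α) - u * (ρ / P.α) ≤ P.flux σ - u * σ at h
    have h2 := mul_le_mul_of_nonneg_left h hα.le
    have : P.α * (u * (ρ / P.α)) = u * ρ := by field_simp
    simp only; nlinarith

/-- Compare the maximum with the value at the point a fraction `t` of the way from `σ` to `x`,
divide by `t` and let `t` tend to `0`. No derivative at `σ` is needed, so `σ` may be an end point.
-/
theorem peak_strong {u σ x : ℝ} (hσ : σ ∈ Icc 0 P.R)
    (hmax : ∀ ρ ∈ Icc 0 P.R, P.flux ρ - u * ρ ≤ P.flux σ - u * σ) (hx : x ∈ Icc 0 P.R) :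
    P.flux x - u * x + P.β / 2 * (x - σ) ^ 2 ≤ P.flux σ - u * σ := by
  have key : ∀ t ∈ Ioo (0 : ℝ) 1, P.flux x - u * x + P.β / 2 * ((1 - t) * (x - σ) ^ 2) ≤
      P.flux σ - u * σ := by
    intro t ht
    have h := P.flux_add_sq_concaveOn.2 hσ hx (sub_nonneg.2 ht.2.le) ht.1.le (by ring)
    simp only [smul_eq_mul] at h
    have hm := hmax _ (P.flux_add_sq_concaveOn.1 hσ hx (sub_nonneg.2 ht.2.le) ht.1.le (by ring))
    simp only [smul_eq_mul] at hm
    have : t * (P.flux x - u * x + P.β / 2 * ((1 - t) * (x - σ) ^ 2)) ≤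
      t * (P.flux σ - u * σ) := by nlinarith
    exact le_of_mul_le_mul_left this ht.1
  have hlim : Tendsto (fun t : ℝ => P.flux x - u * x + P.β / 2 * ((1 - t) * (x - σ) ^ 2))
      (𝓝[>] 0) (𝓝 (P.flux x - u * x + P.β / 2 * ((1 - 0) * (x - σ) ^ 2))) := by
    refine Tendsto.mono_left ?_ nhdsWithin_le_nhds
    exact Continuous.tendsto (by fun_prop) 0
  have := le_of_tendsto hlim (by
    filter_upwards [Ioo_mem_nhdsGT (zero_lt_one (α := ℝ))] with t ht using key t ht)
  simpa using this

theorem peak_nonneg {u σ : ℝ}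
    (hmax : ∀ ρ ∈ Icc 0 P.R, P.flux ρ - u * ρ ≤ P.flux σ - u * σ) :
    0 ≤ P.flux σ - u * σ := by
  simpa using hmax 0 P.zero_mem

theorem capacity_nonneg (u : ℝ) : 0 ≤ P.capacity u := by
  obtain ⟨σ, -, hmax, h⟩ := P.exists_peak u
  rw [h]; exact mul_nonneg P.α_mem.1.le (P.peak_nonneg hmax)

/-- Close to zero density `v` exceeds `u`, and `f(ρ) - u ρ = ρ (v(ρ) - u)`. -/
theorem peak_pos {u σ : ℝ} (hu : u < P.V)
    (hmax : ∀ ρ ∈ Icc 0 P.R, P.flux ρ - u * ρ ≤ P.flux σ - u * σ) :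
    0 < P.flux σ - u * σ := by
  have hc : ContinuousWithinAt P.v (Icc 0 P.R) 0 := P.v_contDiff.continuousOn 0 P.zero_mem
  have h1 : ∀ᶠ ρ in 𝓝[Icc 0 P.R] 0, u < P.v ρ := hc.eventually_const_lt (by rwa [← V_eq])
  have h2 : ∀ᶠ ρ in 𝓝[>] (0 : ℝ), u < P.v ρ ∧ ρ ∈ Ioc 0 P.R := by
    have hsub : 𝓝[>] (0 : ℝ) ≤ 𝓝[Icc 0 P.R] 0 := by
      rw [← nhdsWithin_Ioc_eq_nhdsGT P.R_pos]
      exact nhdsWithin_mono _ Ioc_subset_Icc_self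
    have h1' : ∀ᶠ ρ in 𝓝[>] (0 : ℝ), u < P.v ρ := h1.filter_mono hsub
    exact h1'.and (Ioc_mem_nhdsGT P.R_pos)
  obtain ⟨ρ, hρ, hρ'⟩ := h2.exists
  have := hmax ρ (Ioc_subset_Icc_self hρ')
  have h3 : 0 < P.flux ρ - u * ρ := by
    simp only [flux]; nlinarith [hρ'.1]
  linarith

theorem flux_le_V_mul {ρ : ℝ} (hρ : ρ ∈ Icc 0 P.R) : P.flux ρ ≤ P.V * ρ := by
  have := P.v_le_V hρ
  simp only [flux]; nlinarith [hρ.1]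

theorem capacity_V : P.capacity P.V = 0 := by
  obtain ⟨σ, hσ, hmax, h⟩ := P.exists_peak P.V
  have := P.flux_le_V_mul hσ
  have := P.peak_nonneg hmax
  rw [h, show P.flux σ - P.V * σ = 0 by linarith, mul_zero]

theorem phi_continuous (u : ℝ) : Continuous (P.phi u) := by
  unfold phi; fun_prop

/-- Intermediate value theorem on `[0, ρ]`: at `0` the flux vanishes while the line has height
`F_α(u) ≥ 0`. -/
theorem exists_meet_le {u ρ : ℝ} (hρ : ρ ∈ Icc 0 P.R) (h : P.phi u ρ ≤ P.flux ρ) :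
    ∃ x ∈ P.meets u, x ≤ ρ := by
  have hc : ContinuousOn (fun x => P.flux x - P.phi u x) (Icc 0 ρ) :=
    (P.flux_continuousOn.mono (Icc_subset_Icc_right hρ.2)).sub (P.phi_continuous u).continuousOn
  have := intermediate_value_Icc hρ.1 hc (show (0 : ℝ) ∈ _ from
    ⟨by simpa [phi] using P.capacity_nonneg u, by linarith⟩)
  obtain ⟨x, hx, hx0⟩ := this
  exact ⟨x, ⟨⟨hx.1, hx.2.trans hρ.2⟩, by simpa [sub_eq_zero] using hx0⟩, hx.2⟩

/-- The mirror argument on `[ρ, R]`. The flux vanishes at `R`, and `u ≥ 0` keeps the line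
nonnegative there. -/
theorem exists_meet_ge {u ρ : ℝ} (hu : 0 ≤ u) (hρ : ρ ∈ Icc 0 P.R)
    (h : P.phi u ρ ≤ P.flux ρ) : ∃ x ∈ P.meets u, ρ ≤ x := by
  have hc : ContinuousOn (fun x => P.flux x - P.phi u x) (Icc ρ P.R) :=
    (P.flux_continuousOn.mono (Icc_subset_Icc_left hρ.1)).sub (P.phi_continuous u).continuousOn
  have := intermediate_value_Icc' hρ.2 hc (show (0 : ℝ) ∈ _ from
    ⟨by have := P.capacity_nonneg u
        have := mul_nonneg hu P.R_pos.le
        simp only [phi, flux_end]; linarith, by linarith⟩)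
  obtain ⟨x, hx, hx0⟩ := this
  exact ⟨x, ⟨⟨hρ.1.trans hx.1, hx.2⟩, by simpa [sub_eq_zero] using hx0⟩, hx.1⟩

theorem meets_isCompact (u : ℝ) : IsCompact (P.meets u) := by
  have : P.meets u = Icc 0 P.R ∩ (fun x => P.flux x - P.phi u x) ⁻¹' {0} := by
    ext x; simp [meets, sub_eq_zero]
  rw [this]
  refine isCompact_Icc.of_isClosed_subset ?_ inter_subset_left
  exact ContinuousOn.preimage_isClosed_of_isClosed
    (P.flux_continuousOn.sub (P.phi_continuous u).continuousOn) isClosed_Icc isClosed_singleton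

theorem phi_le_flux_peak {u σ : ℝ}
    (hmax : ∀ ρ ∈ Icc 0 P.R, P.flux ρ - u * ρ ≤ P.flux σ - u * σ)
    (hcap : P.capacity u = P.α * (P.flux σ - u * σ)) : P.phi u σ ≤ P.flux σ := by
  have := P.peak_nonneg hmax
  have := P.α_mem.2
  simp only [phi]; nlinarith

theorem meets_nonempty (u : ℝ) : (P.meets u).Nonempty := by
  obtain ⟨σ, hσ, hmax, hcap⟩ := P.exists_peak u
  obtain ⟨x, hx, -⟩ := P.exists_meet_le hσ (P.phi_le_flux_peak hmax hcap)
  exact ⟨x, hx⟩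

theorem check_mem_meets (u : ℝ) : P.check u ∈ P.meets u :=
  (P.meets_isCompact u).sInf_mem (P.meets_nonempty u)

theorem hat_mem_meets (u : ℝ) : P.hat u ∈ P.meets u :=
  (P.meets_isCompact u).sSup_mem (P.meets_nonempty u)

theorem check_mem (u : ℝ) : P.check u ∈ Icc 0 P.R := (P.check_mem_meets u).1

theorem hat_mem (u : ℝ) : P.hat u ∈ Icc 0 P.R := (P.hat_mem_meets u).1

theorem flux_check (u : ℝ) : P.flux (P.check u) = P.capacity u + u * P.check u :=
  (P.check_mem_meets u).2

theorem flux_hat (u : ℝ) : P.flux (P.hat u) = P.capacity u + u * P.hat u :=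
  (P.hat_mem_meets u).2

theorem check_le {u x : ℝ} (hx : x ∈ P.meets u) : P.check u ≤ x :=
  csInf_le (P.meets_isCompact u).bddBelow hx

theorem le_hat {u x : ℝ} (hx : x ∈ P.meets u) : x ≤ P.hat u :=
  le_csSup (P.meets_isCompact u).bddAbove hx

theorem check_le_hat (u : ℝ) : P.check u ≤ P.hat u := P.check_le (P.hat_mem_meets u)

/-- The flux exceeds the line `φ_u` exactly between `ρ̌_u` and `ρ̂_u`. -/
theorem lt_flux_iff {u ρ : ℝ} (hu : 0 ≤ u) (hρ : ρ ∈ Icc 0 P.R) :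
    P.capacity u + u * ρ < P.flux ρ ↔ P.check u < ρ ∧ ρ < P.hat u := by
  constructor
  · intro h
    constructor
    · obtain ⟨x, hx, hxρ⟩ := P.exists_meet_le hρ h.le
      refine lt_of_le_of_ne ((P.check_le hx).trans hxρ) fun he => ?_
      have := P.flux_check u
      rw [he] at this; linarith
    · obtain ⟨x, hx, hxρ⟩ := P.exists_meet_ge hu hρ h.le
      refine lt_of_le_of_ne (hxρ.trans (P.le_hat hx)) fun he => ?_
      have := P.flux_hat u
      rw [← he] at this; linarith
  · rintro ⟨h1, h2⟩
    have h := P.flux_three_lt (P.check_mem u).1 h1 h2 (P.hat_mem u).2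
    rw [flux_check, flux_hat] at h
    have h3 : 0 < P.hat u - P.check u := by linarith
    by_contra hcon
    push Not at hcon
    nlinarith

theorem le_flux_iff {u ρ : ℝ} (hu : 0 ≤ u) (hρ : ρ ∈ Icc 0 P.R) :
    P.capacity u + u * ρ ≤ P.flux ρ ↔ P.check u ≤ ρ ∧ ρ ≤ P.hat u := by
  constructor
  · intro h
    obtain ⟨x, hx, hxρ⟩ := P.exists_meet_le hρ h
    obtain ⟨y, hy, hyρ⟩ := P.exists_meet_ge hu hρ h
    exact ⟨(P.check_le hx).trans hxρ, hyρ.trans (P.le_hat hy)⟩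
  · rintro ⟨h1, h2⟩
    rcases h1.eq_or_lt with h | h1
    · rw [← h, flux_check]
    rcases h2.eq_or_lt with h | h2
    · rw [h, flux_hat]
    exact ((P.lt_flux_iff hu hρ).2 ⟨h1, h2⟩).le

theorem check_V : P.check P.V = 0 :=
  le_antisymm (P.check_le ⟨P.zero_mem, by simp [phi, capacity_V]⟩) (P.check_mem _).1

theorem hat_V : P.hat P.V = 0 := by
  have h1 := P.hat_mem P.V
  have h2 := P.flux_hat P.V
  rw [capacity_V, zero_add] at h2
  by_contra hne
  have hpos : 0 < P.hat P.V := lt_of_le_of_ne h1.1 (Ne.symm hne)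
  have h3 := P.v_strictAntiOn P.zero_mem h1 hpos
  rw [← V_eq] at h3
  simp only [flux] at h2
  nlinarith

/-- At `α σ` strict concavity gives `f(α σ) > α f(σ)`, and at `σ` the flux exceeds the line by `(1 -
α)(f(σ) - u σ) > 0`. Both points therefore lie strictly between `ρ̌_u` and `ρ̂_u`. -/
theorem peak_mem_Ioo {u σ : ℝ} (hu : u ∈ Ico 0 P.V) (hσ : σ ∈ Icc 0 P.R)
    (hmax : ∀ ρ ∈ Icc 0 P.R, P.flux ρ - u * ρ ≤ P.flux σ - u * σ)
    (hcap : P.capacity u = P.α * (P.flux σ - u * σ)) :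
    0 < σ ∧ P.check u < P.α * σ ∧ P.α * σ < σ ∧ σ < P.hat u := by
  have hF := P.peak_pos hu.2 hmax
  have hα := P.α_mem
  have hσ0 : 0 < σ := by
    rcases hσ.1.eq_or_lt with h | h
    · rw [← h] at hF; simp at hF
    · exact h
  have h1 : P.α * σ < σ := by nlinarith [hα.2]
  have h0 : 0 < P.α * σ := mul_pos hα.1 hσ0
  have h2 := P.flux_three_lt le_rfl h0 h1 hσ.2
  rw [flux_zero] at h2
  have h3 : P.capacity u + u * (P.α * σ) < P.flux (P.α * σ) := by
    rw [hcap]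
    have h4 : σ * (P.α * (P.flux σ)) < σ * P.flux (P.α * σ) := by nlinarith
    have := lt_of_mul_lt_mul_left h4 hσ0.le
    nlinarith
  have h4 := (P.lt_flux_iff hu.1 ⟨h0.le, h1.le.trans hσ.2⟩).1 h3
  have h5 : P.capacity u + u * σ < P.flux σ := by
    rw [hcap]; nlinarith [hα.2]
  have h6 := (P.lt_flux_iff hu.1 hσ).1 h5
  exact ⟨hσ0, h4.1, h1, h6.2⟩

theorem check_lt_hat {u : ℝ} (hu : u ∈ Ico 0 P.V) : P.check u < P.hat u := by
  obtain ⟨σ, hσ, hmax, hcap⟩ := P.exists_peak u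
  obtain ⟨-, h1, h2, h3⟩ := P.peak_mem_Ioo hu hσ hmax hcap
  linarith

theorem capacity_pos {u : ℝ} (hu : u ∈ Ico 0 P.V) : 0 < P.capacity u := by
  obtain ⟨σ, hσ, hmax, hcap⟩ := P.exists_peak u
  rw [hcap]; exact mul_pos P.α_mem.1 (P.peak_pos hu.2 hmax)

theorem check_pos {u : ℝ} (hu : u ∈ Ico 0 P.V) : 0 < P.check u := by
  have h1 := P.flux_check u
  have h2 := P.capacity_pos hu
  refine lt_of_le_of_ne (P.check_mem u).1 fun h => ?_
  rw [← h] at h1; simp at h1; linarith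

theorem peak_antitone {u₁ u₂ σ₁ σ₂ : ℝ} (hu : u₁ < u₂)
    (hσ₁ : σ₁ ∈ Icc 0 P.R) (hσ₂ : σ₂ ∈ Icc 0 P.R)
    (h₁ : ∀ ρ ∈ Icc 0 P.R, P.flux ρ - u₁ * ρ ≤ P.flux σ₁ - u₁ * σ₁)
    (h₂ : ∀ ρ ∈ Icc 0 P.R, P.flux ρ - u₂ * ρ ≤ P.flux σ₂ - u₂ * σ₂) : σ₂ ≤ σ₁ := by
  have a := h₁ _ hσ₂
  have b := h₂ _ hσ₁
  by_contra! hc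
  nlinarith

/-- Testing the maximum for `u₂` at the peak `σ₁` gives `F_α(u₁) - F_α(u₂) ≤ (u₂ - u₁) α σ₁`. If
`ρ̂` did not decrease, `ρ̂_{u₁}` would lie on or above the line for `u₂`, which forces the
difference to be at least `(u₂ - u₁) ρ̂_{u₁}`; but `ρ̂_{u₁} > α σ₁`. -/
theorem hat_strictAnti {u₁ u₂ : ℝ} (h₁ : 0 ≤ u₁) (hu : u₁ < u₂) (h₂ : u₂ ≤ P.V) :
    P.hat u₂ < P.hat u₁ := by
  obtain ⟨σ₁, hσ₁, hmax₁, hcap₁⟩ := P.exists_peak u₁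
  obtain ⟨σ₂, hσ₂, hmax₂, hcap₂⟩ := P.exists_peak u₂
  obtain ⟨hp, a1, a2, a3⟩ := P.peak_mem_Ioo ⟨h₁, hu.trans_le h₂⟩ hσ₁ hmax₁ hcap₁
  have hs := P.peak_antitone hu hσ₁ hσ₂ hmax₁ hmax₂
  have hck : P.check u₂ ≤ σ₂ :=
    ((P.le_flux_iff (h₁.trans hu.le) hσ₂).1 (P.phi_le_flux_peak hmax₂ hcap₂)).1
  by_contra! hc
  have h := (P.le_flux_iff (h₁.trans hu.le) (P.hat_mem u₁)).2 ⟨by linarith, hc⟩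
  rw [flux_hat, hcap₁, hcap₂] at h
  have hα := P.α_mem
  have h4 := mul_le_mul_of_nonneg_left (hmax₂ σ₁ hσ₁) hα.1.le
  nlinarith

/-- Dual to `hat_strictAnti`: here the maximum for `u₁` is tested at `σ₂`, and `ρ̌_{u₂} < α σ₂`
gives the contradiction. -/
theorem check_strictAnti {u₁ u₂ : ℝ} (h₁ : 0 ≤ u₁) (hu : u₁ < u₂) (h₂ : u₂ ≤ P.V) :
    P.check u₂ < P.check u₁ := by
  rcases h₂.eq_or_lt with rfl | h₂
  · rw [check_V]; exact P.check_pos ⟨h₁, hu⟩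
  obtain ⟨σ₁, hσ₁, hmax₁, hcap₁⟩ := P.exists_peak u₁
  obtain ⟨σ₂, hσ₂, hmax₂, hcap₂⟩ := P.exists_peak u₂
  obtain ⟨hp, a1, a2, a3⟩ := P.peak_mem_Ioo ⟨h₁, hu.trans h₂⟩ hσ₁ hmax₁ hcap₁
  obtain ⟨hp', b1, b2, b3⟩ := P.peak_mem_Ioo ⟨h₁.trans hu.le, h₂⟩ hσ₂ hmax₂ hcap₂
  have hs := P.peak_antitone hu hσ₁ hσ₂ hmax₁ hmax₂
  by_contra! hc
  have h := (P.le_flux_iff h₁ (P.check_mem u₂)).2 ⟨hc, by linarith⟩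
  rw [flux_check, hcap₁, hcap₂] at h
  have h4 := mul_le_mul_of_nonneg_left (hmax₁ σ₂ hσ₂) P.α_mem.1.le
  nlinarith

/-- The Lipschitz estimate for `ρ̂`. -/
theorem hat_sub_le {u₁ u₂ : ℝ} (h₁ : 0 ≤ u₁) (hu : u₁ < u₂) (h₂ : u₂ ≤ P.V) :
    P.hat u₁ - P.hat u₂ ≤ 2 / P.β * (u₂ - u₁) := by
  obtain ⟨σ₁, hσ₁, hmax₁, hcap₁⟩ := P.exists_peak u₁
  obtain ⟨σ, hσ, hmax₂, hcap₂⟩ := P.exists_peak u₂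
  have hanti := P.hat_strictAnti h₁ hu h₂
  have hβ := P.β_pos
  have hα := P.α_mem
  have hy := P.hat_mem u₁
  have hh := P.hat_mem u₂
  set y := P.hat u₁ with hydef
  set h := P.hat u₂ with hhdef
  have hσh : σ ≤ h :=
    ((P.le_flux_iff (h₁.trans hu.le) hσ).1 (P.phi_le_flux_peak hmax₂ hcap₂)).2
  have fy : P.flux y = P.capacity u₁ + u₁ * y := P.flux_hat u₁
  have fh : P.flux h = P.capacity u₂ + u₂ * h := P.flux_hat u₂
  -- the upper bound
  have up : (P.flux h - u₂ * h) - (P.flux y - u₂ * y) ≤ (u₂ - u₁) * (y - P.α * σ) := by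
    rw [fy, fh, hcap₁, hcap₂]
    have := mul_le_mul_of_nonneg_left (hmax₁ σ hσ) hα.1.le
    nlinarith
  -- the lower bound
  have low : P.β / 2 * (y - P.α * σ) * (y - h) ≤
      (P.flux h - u₂ * h) - (P.flux y - u₂ * y) := by
    have sy := P.peak_strong hσ hmax₂ hy
    have sh := P.peak_strong hσ hmax₂ hh
    -- If the peak coincides with `ρ̂_{u₂}`, its height equals `α` times itself and vanishes. Strong
    -- concavity against the point `0` then forces `σ = 0`.
    rcases hσh.eq_or_lt with he | hlt
    · have hF0 := P.peak_strong hσ hmax₂ P.zero_mem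
      rw [flux_zero] at hF0
      have hF : P.flux σ - u₂ * σ = P.α * (P.flux σ - u₂ * σ) := by
        rw [← hcap₂]; rw [← he] at fh; linarith
      have hF' : P.flux σ - u₂ * σ = 0 := by
        have : (1 - P.α) * (P.flux σ - u₂ * σ) = 0 := by linarith
        rcases mul_eq_zero.1 this with h | h
        · linarith [hα.2]
        · exact h
      have hσ0 : σ = 0 := by
        have : σ ^ 2 ≤ 0 := by
          have : P.β * σ ^ 2 ≤ 0 := by nlinarith
          nlinarith
        exact pow_eq_zero_iff (two_ne_zero) |>.1 (le_antisymm this (sq_nonneg _))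
      rw [hF', hσ0] at sy
      rw [← he, hF', hσ0]
      linarith
    · have h3 := P.flux_three hσ.1 hlt hanti hy.2
      have hF0 := P.peak_strong hσ hmax₂ P.zero_mem
      rw [flux_zero] at hF0
      have hd : 0 < h - σ := by linarith
      have hD : 0 < y - h := by linarith
      have hc : P.flux h - u₂ * h = P.α * (P.flux σ - u₂ * σ) := by rw [fh, hcap₂]; ring
      -- slope from the peak to `h`
      have hA : ((P.flux y - u₂ * y) - (P.flux h - u₂ * h)) * (h - σ) +
          P.β / 2 * ((y - σ) * (y - h) * (h - σ)) ≤
          ((P.flux h - u₂ * h) - (P.flux σ - u₂ * σ)) * (y - h) := by linarith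
      -- The fall of at least `β/2 (h - σ)²` from the peak to `h` bounds the slope there, and strong
      -- concavity makes the slope from `h` to `y` steeper by `β/2 (y - σ)`.
      have key1 : P.β / 2 * ((y - h) + 2 * (h - σ)) * (y - h) ≤
          (P.flux h - u₂ * h) - (P.flux y - u₂ * y) := by
        have : (h - σ) * (P.β / 2 * ((y - h) + 2 * (h - σ)) * (y - h)) ≤
          (h - σ) * ((P.flux h - u₂ * h) - (P.flux y - u₂ * y)) := by
          have := mul_le_mul_of_nonneg_right sh hD.le
          linarith
        exact le_of_mul_le_mul_left this hd
      have hασ : 0 ≤ (1 - P.α) * σ := mul_nonneg (by linarith [hα.2]) hσ.1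
      -- When `h - σ` is large, `key1` already suffices. Otherwise the fall from the peak to `h` is
      -- exactly the fraction `1 - α` of the peak height, which is at least `β/2 σ²`; since now `h -
      -- σ ≤ σ`, the slope from `σ` to `h` is at most `-β/2 (1 - α) σ`.
      rcases le_total ((1 - P.α) * σ) (h - σ) with hcase | hcase
      · refine le_trans ?_ key1
        have h5 : y - P.α * σ ≤ (y - h) + 2 * (h - σ) := by linarith
        have h6 := mul_le_mul_of_nonneg_right h5 (mul_nonneg (half_pos hβ).le hD.le)
        linarith
      · have key2 : (h - σ) * (P.β / 2 * (y - P.α * σ) * (y - h)) ≤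
          (h - σ) * ((P.flux h - u₂ * h) - (P.flux y - u₂ * y)) := by
          have e0 : P.β / 2 * σ ^ 2 ≤ P.flux σ - u₂ * σ := by linarith
          have e1 : (1 - P.α) * (P.β / 2 * σ ^ 2) ≤ (1 - P.α) * (P.flux σ - u₂ * σ) :=
            mul_le_mul_of_nonneg_left e0 (by linarith [hα.2])
          have e2 : h - σ ≤ σ := by
            have := mul_nonneg hα.1.le hσ.1
            linarith
          have e3 : (1 - P.α) * σ * (h - σ) ≤ (1 - P.α) * σ * σ :=
            mul_le_mul_of_nonneg_left e2 hασ
          have e4 : P.flux h - u₂ * h - (P.flux σ - u₂ * σ) ≤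
            -(P.β / 2 * ((1 - P.α) * σ * (h - σ))) := by
            have := mul_le_mul_of_nonneg_left e3 (half_pos hβ).le
            linarith
          have e5 := mul_le_mul_of_nonneg_right e4 hD.le
          linarith
        exact le_of_mul_le_mul_left key2 hd
  -- The factor `y - α σ` occurs in both bounds and cancels. This is why the Lipschitz constant does
  -- not depend on `α`.
  have hpos : 0 < y - P.α * σ := by
    have := mul_nonneg (sub_nonneg.2 hα.2.le) hσ.1
    linarith
  have h7 : (y - P.α * σ) * (P.β / 2 * (y - h)) ≤ (y - P.α * σ) * (u₂ - u₁) := by linarith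
  have := le_of_mul_le_mul_left h7 hpos
  rw [div_mul_eq_mul_div, le_div_iff₀ hβ]
  linarith

/-- The Lipschitz estimate for `ρ̌`. -/
theorem check_sub_le {u₁ u₂ : ℝ} (h₁ : 0 ≤ u₁) (hu : u₁ < u₂) (h₂ : u₂ ≤ P.V) :
    P.check u₁ - P.check u₂ ≤ 2 / P.β * (u₂ - u₁) := by
  obtain ⟨σ, hσ, hmax₁, hcap₁⟩ := P.exists_peak u₁
  obtain ⟨σ₂, hσ₂, hmax₂, hcap₂⟩ := P.exists_peak u₂
  obtain ⟨hp, a1, a2, a3⟩ := P.peak_mem_Ioo ⟨h₁, hu.trans_le h₂⟩ hσ hmax₁ hcap₁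
  have hanti := P.check_strictAnti h₁ hu h₂
  have hβ := P.β_pos
  have hα := P.α_mem
  have fc := P.flux_check u₁
  have fd := P.flux_check u₂
  have hc := P.check_mem u₁
  have hd := P.check_mem u₂
  set c := P.check u₁
  set d := P.check u₂
  have hcσ : c < σ := by linarith
  have up : (P.flux c - u₁ * c) - (P.flux d - u₁ * d) ≤ (u₂ - u₁) * (σ - d) := by
    rw [fc, fd, hcap₁, hcap₂]
    have := mul_le_mul_of_nonneg_left (hmax₂ σ hσ) hα.1.le
    nlinarith
  have sc := P.peak_strong hσ hmax₁ hc
  have h3 := P.flux_three hd.1 hanti hcσ hσ.2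
  have hD : 0 < c - d := by linarith
  have hE : 0 < σ - c := by linarith
  -- Here the rise from `d` to `c` lies left of the peak: its slope exceeds that from `c` to `σ` by
  -- `β/2 (σ - d)`, and the latter is nonnegative. The common factor that cancels is `σ - d`.
  have low : (σ - c) * (P.β / 2 * (σ - d) * (c - d)) ≤
      (σ - c) * ((P.flux c - u₁ * c) - (P.flux d - u₁ * d)) := by
    have h5 := mul_le_mul_of_nonneg_right sc hD.le
    have h6 : 0 ≤ P.β / 2 * ((σ - c) * (σ - c) * (c - d)) := by positivity
    nlinarith
  have low := le_of_mul_le_mul_left low hE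
  have hpos : 0 < σ - d := by linarith
  have : (σ - d) * (P.β / 2 * (c - d)) ≤ (σ - d) * (u₂ - u₁) := by nlinarith
  have := le_of_mul_le_mul_left this hpos
  rw [div_mul_eq_mul_div, le_div_iff₀ hβ]
  linarith

end LWRModel

namespace LWRModel

variable (P : LWRModel)

/-! ### The grids -/

theorem hat_antitone {u₁ u₂ : ℝ} (h₁ : 0 ≤ u₁) (hu : u₁ ≤ u₂) (h₂ : u₂ ≤ P.V) :
    P.hat u₂ ≤ P.hat u₁ := by
  rcases hu.eq_or_lt with rfl | h
  · exact le_rfl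
  · exact (P.hat_strictAnti h₁ h h₂).le

theorem check_antitone {u₁ u₂ : ℝ} (h₁ : 0 ≤ u₁) (hu : u₁ ≤ u₂) (h₂ : u₂ ≤ P.V) :
    P.check u₂ ≤ P.check u₁ := by
  rcases hu.eq_or_lt with rfl | h
  · exact le_rfl
  · exact (P.check_strictAnti h₁ h h₂).le

theorem lt_of_hat_lt {u₁ u₂ : ℝ} (h₁ : u₁ ∈ Icc 0 P.V) (h₂ : u₂ ∈ Icc 0 P.V)
    (h : P.hat u₂ < P.hat u₁) : u₁ < u₂ := by
  by_contra! hc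
  exact absurd h (P.hat_antitone h₂.1 hc h₁.2).not_gt

theorem abs_hat_sub_le {u₁ u₂ : ℝ} (h₁ : u₁ ∈ Icc 0 P.V) (h₂ : u₂ ∈ Icc 0 P.V) :
    |P.hat u₁ - P.hat u₂| ≤ 2 / P.β * |u₁ - u₂| := by
  rcases lt_trichotomy u₁ u₂ with h | rfl | h
  · rw [abs_of_pos (sub_pos.2 (P.hat_strictAnti h₁.1 h h₂.2)), abs_of_neg (sub_neg.2 h), neg_sub]
    exact P.hat_sub_le h₁.1 h h₂.2
  · simp
  · rw [abs_of_neg (sub_neg.2 (P.hat_strictAnti h₂.1 h h₁.2)), abs_of_pos (sub_pos.2 h), neg_sub]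
    exact P.hat_sub_le h₂.1 h h₁.2

theorem hat_continuousOn : ContinuousOn P.hat (Icc 0 P.V) := by
  have : LipschitzOnWith (Real.toNNReal (2 / P.β)) P.hat (Icc 0 P.V) := by
    refine LipschitzOnWith.of_dist_le_mul fun x hx y hy => ?_
    rw [Real.coe_toNNReal _ (by have := P.β_pos; positivity), Real.dist_eq, Real.dist_eq]
    exact P.abs_hat_sub_le hx hy
  exact this.continuousOn

theorem V_mem_speeds : P.V ∈ Icc 0 P.V := ⟨P.V_nonneg, le_rfl⟩

/-- Continuity and strict monotonicity of `ρ̂` make the set in the definition a singleton, so that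
its infimum is the inverse value. -/
theorem hatInv_spec {r : ℝ} (h0 : 0 ≤ r) (hr : r ≤ P.hat 0) :
    P.hatInv r ∈ Icc 0 P.V ∧ P.hat (P.hatInv r) = r := by
  obtain ⟨u, hu, hur⟩ := intermediate_value_Icc' P.V_nonneg P.hat_continuousOn
    (show r ∈ Icc (P.hat P.V) (P.hat 0) from ⟨by rwa [hat_V], hr⟩)
  have : {u | u ∈ Icc 0 P.V ∧ P.hat u = r} = {u} := by
    ext w
    refine ⟨fun ⟨hw, h⟩ => ?_, fun h => by rw [mem_singleton_iff.1 h]; exact ⟨hu, hur⟩⟩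
    rcases lt_trichotomy w u with hlt | rfl | hlt
    · have := P.hat_strictAnti hw.1 hlt hu.2; linarith
    · rfl
    · have := P.hat_strictAnti hu.1 hlt hw.2; linarith
  rw [hatInv, this, csInf_singleton]
  exact ⟨hu, hur⟩

/-- The recursion of the grids never leaves `[0, V[`: `ρ̌_u` is in the range of `ρ̂`, and being
positive it differs from `ρ̂_V = 0`. -/
theorem hatInv_check {u : ℝ} (hu : u ∈ Ico 0 P.V) :
    P.hatInv (P.check u) ∈ Ico 0 P.V ∧ P.hat (P.hatInv (P.check u)) = P.check u := by
  have h := P.hatInv_spec (P.check_mem u).1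
    ((P.check_le_hat u).trans (P.hat_antitone le_rfl hu.1 hu.2.le))
  refine ⟨⟨h.1.1, lt_of_le_of_ne h.1.2 fun he => ?_⟩, h.2⟩
  have h2 := h.2
  rw [he, hat_V] at h2
  exact (P.check_pos hu).ne h2

theorem coarse_one : P.coarse 1 ∈ Ioo 0 P.V ∧ P.hat (P.coarse 1) = P.check 0 := by
  have h := P.hatInv_check ⟨le_rfl, P.V_pos⟩
  refine ⟨⟨lt_of_le_of_ne h.1.1 fun he => ?_, h.1.2⟩, h.2⟩
  have h2 : P.hat (P.coarse 1) = P.check 0 := h.2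
  rw [← he] at h2
  exact (P.check_lt_hat ⟨le_rfl, P.V_pos⟩).ne' h2

theorem fine_mem {ν k : ℕ} (hk : k < 2 ^ ν) (i : ℕ) : P.fine ν k i ∈ Ico 0 P.V := by
  induction i with
  | zero =>
    have h := P.coarse_one.1
    have hk' : (k : ℝ) < 2 ^ ν := by exact_mod_cast hk
    refine ⟨?_, lt_of_le_of_lt ?_ h.2⟩
    · simp only [fine]; have := h.1; positivity
    · simp only [fine]
      rw [div_le_iff₀ (by positivity)]
      nlinarith [h.1]
  | succ i ih => exact (P.hatInv_check ih).1

theorem hat_fine_succ {ν k : ℕ} (hk : k < 2 ^ ν) (i : ℕ) :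
    P.hat (P.fine ν k (i + 1)) = P.check (P.fine ν k i) :=
  (P.hatInv_check (P.fine_mem hk i)).2

/-- The sequences `u_{0,i}` and `u_{k,i}` are interlaced. -/
theorem fine_interlaced {ν k : ℕ} (hk : k < 2 ^ ν) (hk0 : 0 < k) (i : ℕ) :
    P.check (P.fine ν 0 i) < P.hat (P.fine ν k i) ∧
      P.hat (P.fine ν k i) < P.hat (P.fine ν 0 i) := by
  have h0 : 0 < 2 ^ ν := by positivity
  induction i with
  | zero =>
    have h := P.coarse_one
    have hk' : (k : ℝ) < 2 ^ ν := by exact_mod_cast hk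
    have hk0' : (0 : ℝ) < k := by exact_mod_cast hk0
    have e0 : P.fine ν 0 0 = 0 := by simp [fine]
    have e1 : 0 < P.fine ν k 0 := by simp only [fine]; have := h.1.1; positivity
    have e2 : P.fine ν k 0 < P.coarse 1 := by
      simp only [fine]
      rw [div_lt_iff₀ (by positivity)]
      nlinarith [h.1.1]
    rw [e0, ← h.2]
    exact ⟨P.hat_strictAnti e1.le e2 h.1.2.le, P.hat_strictAnti le_rfl e1 (e2.trans h.1.2).le⟩
  | succ i ih =>
    have ha := P.fine_mem h0 i
    have hb := P.fine_mem hk i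
    have ha' := P.fine_mem h0 (i + 1)
    have hab := P.lt_of_hat_lt (Ico_subset_Icc_self ha) (Ico_subset_Icc_self hb) ih.2
    have hba : P.fine ν k i < P.fine ν 0 (i + 1) :=
      P.lt_of_hat_lt (Ico_subset_Icc_self hb) (Ico_subset_Icc_self ha')
        (by rw [P.hat_fine_succ h0]; exact ih.1)
    rw [P.hat_fine_succ hk, P.hat_fine_succ h0]
    exact ⟨P.check_strictAnti hb.1 hba ha'.2.le, P.check_strictAnti ha.1 hab hb.2.le⟩

theorem speedGrid_subset (ν : ℕ) : P.speedGrid ν ⊆ Icc 0 P.V := by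
  rintro u (⟨k, hk, i, -, rfl⟩ | h)
  · exact Ico_subset_Icc_self (P.fine_mem hk i)
  · rw [mem_singleton_iff.1 h]; exact P.V_mem_speeds

theorem speedGrid_finite (ν : ℕ) : (P.speedGrid ν).Finite := by
  have : P.speedGrid ν ⊆ ((fun q : ℕ × ℕ => P.fine ν q.1 q.2) ''
      (Iio (2 ^ ν) ×ˢ Iic (P.lastIndex ν))) ∪ {P.V} := by
    rintro u (⟨k, hk, i, hi, rfl⟩ | h)
    · exact Or.inl ⟨(k, i), ⟨hk, hi⟩, rfl⟩
    · exact Or.inr h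
  exact ((((finite_Iio _).prod (finite_Iic _)).image _).union (finite_singleton _)).subset this

theorem densityGrid_finite (ν : ℕ) : (P.densityGrid ν).Finite := by
  refine (((P.speedGrid_finite ν).image _).union ((P.speedGrid_finite ν).image _)).union ?_
  have : {ρ | ∃ l : ℕ, l ≤ 2 ^ ν ∧ ρ = P.hat 0 + l * (P.R - P.hat 0) / 2 ^ ν} ⊆
      (fun l : ℕ => P.hat 0 + l * (P.R - P.hat 0) / 2 ^ ν) '' Iic (2 ^ ν) := by
    rintro ρ ⟨l, hl, rfl⟩
    exact ⟨l, hl, rfl⟩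
  exact ((finite_Iic _).image _).subset this

theorem check_mem_grid {ν : ℕ} {u : ℝ} (hu : u ∈ P.speedGrid ν) : P.check u ∈ P.densityGrid ν :=
  Or.inl (Or.inl ⟨u, hu, rfl⟩)

theorem hat_mem_grid {ν : ℕ} {u : ℝ} (hu : u ∈ P.speedGrid ν) : P.hat u ∈ P.densityGrid ν :=
  Or.inl (Or.inr ⟨u, hu, rfl⟩)

theorem V_mem_speedGrid (ν : ℕ) : P.V ∈ P.speedGrid ν := Or.inr rfl

theorem zero_mem_grid (ν : ℕ) : (0 : ℝ) ∈ P.densityGrid ν := by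
  have := P.check_mem_grid (P.V_mem_speedGrid ν)
  rwa [check_V] at this

theorem grid_subset (ν : ℕ) : P.densityGrid ν ⊆ Icc 0 P.R := by
  rintro ρ ((⟨u, -, rfl⟩ | ⟨u, -, rfl⟩) | ⟨l, hl, rfl⟩)
  · exact P.check_mem u
  · exact P.hat_mem u
  · have h := P.hat_mem 0
    have hl' : (l : ℝ) ≤ 2 ^ ν := by exact_mod_cast hl
    have hd : 0 ≤ P.R - P.hat 0 := sub_nonneg.2 h.2
    have h2 : l * (P.R - P.hat 0) / 2 ^ ν ≤ P.R - P.hat 0 := by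
      rw [div_le_iff₀ (by positivity)]
      nlinarith
    have h3 : 0 ≤ l * (P.R - P.hat 0) / 2 ^ ν := by positivity
    exact ⟨by linarith [h.1], by linarith⟩

/-- Interlacing supplies the node at the same index `i`, so the cut-off of the sequences does no
harm: `ρ̂` of the sequence `k = 1` when `k = 0`, and `ρ̌` of the sequence `0` when `k > 0`. The
hypothesis `1 ≤ ν` provides the second sequence. -/
theorem exists_grid_between {ν : ℕ} (hν : 1 ≤ ν) {u : ℝ} (hu : u ∈ P.speedGrid ν)
    (h : P.check u < P.hat u) : ∃ m ∈ P.densityGrid ν, P.check u < m ∧ m < P.hat u := by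
  rcases hu with ⟨k, hk, i, hi, rfl⟩ | hV
  · have h1 : 1 < 2 ^ ν := Nat.one_lt_two_pow (by omega)
    have h0 : 0 < 2 ^ ν := by positivity
    rcases Nat.eq_zero_or_pos k with rfl | hk0
    · exact ⟨_, P.hat_mem_grid (Or.inl ⟨1, h1, i, hi, rfl⟩), P.fine_interlaced h1 one_pos i⟩
    · have ha := P.fine_interlaced hk hk0 i
      have hab := P.lt_of_hat_lt (Ico_subset_Icc_self (P.fine_mem h0 i))
        (Ico_subset_Icc_self (P.fine_mem hk i)) ha.2
      exact ⟨_, P.check_mem_grid (Or.inl ⟨0, h0, i, hi, rfl⟩),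
        P.check_strictAnti (P.fine_mem h0 i).1 hab (P.fine_mem hk i).2.le, ha.1⟩
  · rw [mem_singleton_iff.1 hV, check_V, hat_V] at h
    exact absurd h (lt_irrefl _)

/-- The distance `δ` is the quantum of variation on which the finiteness proof rests. -/
theorem exists_gap (ν : ℕ) : ∃ δ > 0, ∀ a ∈ P.densityGrid ν, ∀ b ∈ P.densityGrid ν, a < b →
    a + δ ≤ b := by
  classical
  set G := (P.densityGrid_finite ν).toFinset with hG
  set S := ((G ×ˢ G).filter fun q => q.1 < q.2).image fun q => q.2 - q.1 with hS
  rcases S.eq_empty_or_nonempty with h | h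
  · refine ⟨1, one_pos, fun a ha b hb hab => ?_⟩
    have : b - a ∈ S := Finset.mem_image.2 ⟨(a, b), by simp [hG, ha, hb, hab], rfl⟩
    simp [h] at this
  · refine ⟨S.min' h, ?_, fun a ha b hb hab => ?_⟩
    · obtain ⟨q, hq, hq'⟩ := Finset.mem_image.1 (S.min'_mem h)
      rw [← hq']
      exact sub_pos.2 (Finset.mem_filter.1 hq).2
    · have := S.min'_le (b - a) (Finset.mem_image.2 ⟨(a, b), by simp [hG, ha, hb, hab], rfl⟩)
      linarith

/-! ### The interpolated flux -/

theorem fluxApprox_node {ν : ℕ} {a : ℝ} (ha : a ∈ P.densityGrid ν) :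
    P.fluxApprox ν a = P.flux a := by
  have h1 : sSup (P.densityGrid ν ∩ Iic a) = a :=
    IsGreatest.csSup_eq ⟨⟨ha, self_mem_Iic⟩, fun _ hx => hx.2⟩
  simp [fluxApprox, h1]

theorem exists_adjacent {ν : ℕ} {a l q : ℝ} (ha : a ∈ P.densityGrid ν) (hl : l ∈ P.densityGrid ν)
    (haq : a ≤ q) (hql : q < l) : ∃ b ∈ P.densityGrid ν, ∃ c ∈ P.densityGrid ν,
      a ≤ b ∧ b ≤ q ∧ q < c ∧ c ≤ l ∧ ∀ z ∈ P.densityGrid ν, ¬ (b < z ∧ z < c) := by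
  classical
  obtain ⟨b, hb, hbmax⟩ := ((P.densityGrid_finite ν).inter_of_left (Iic q)).exists_maximalFor id _
    ⟨a, ha, haq⟩
  obtain ⟨c, hc, hcmin⟩ := ((P.densityGrid_finite ν).inter_of_left (Ioi q)).exists_minimalFor id _
    ⟨l, hl, hql⟩
  have hb' : ∀ z ∈ P.densityGrid ν, z ≤ q → z ≤ b := fun z hz hzq => by
    rcases le_total z b with h | h
    · exact h
    · exact hbmax ⟨hz, hzq⟩ h
  have hc' : ∀ z ∈ P.densityGrid ν, q < z → c ≤ z := fun z hz hzq => by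
    rcases le_total c z with h | h
    · exact h
    · exact hcmin ⟨hz, hzq⟩ h
  refine ⟨b, hb.1, c, hc.1, hb' a ha haq, hb.2, hc.2, hc' l hl hql, fun z hz ⟨h1, h2⟩ => ?_⟩
  rcases le_or_gt z q with h | h
  · exact (hb' z hz h).not_gt h1
  · exact (hc' z hz h).not_gt h2

theorem fluxApprox_between {ν : ℕ} {a b q : ℝ} (ha : a ∈ P.densityGrid ν)
    (hb : b ∈ P.densityGrid ν) (hadj : ∀ z ∈ P.densityGrid ν, ¬ (a < z ∧ z < b))
    (haq : a ≤ q) (hqb : q ≤ b) :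
    P.fluxApprox ν q = P.flux a + (P.flux b - P.flux a) / (b - a) * (q - a) := by
  rcases haq.eq_or_lt with rfl | haq
  · simp [P.fluxApprox_node ha]
  rcases hqb.eq_or_lt with rfl | hqb
  · have : q - a ≠ 0 := by linarith
    rw [P.fluxApprox_node hb]; field_simp; ring
  have h1 : sSup (P.densityGrid ν ∩ Iic q) = a := by
    refine IsGreatest.csSup_eq ⟨⟨ha, haq.le⟩, fun z hz => ?_⟩
    by_contra! h
    exact hadj z hz.1 ⟨h, lt_of_le_of_lt hz.2 hqb⟩
  have h2 : sInf (P.densityGrid ν ∩ Ici q) = b := by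
    refine IsLeast.csInf_eq ⟨⟨hb, hqb.le⟩, fun z hz => ?_⟩
    by_contra! h
    exact hadj z hz.1 ⟨lt_of_lt_of_le haq hz.2, h⟩
  simp [fluxApprox, h1, h2]

end LWRModel

/-! ### Step functions -/

section Step

variable {ι : Type*}

/-- The right continuous step function with jumps `d i` at the points `x i`, `i ∈ L`. -/
def stepLe (L : Finset ι) (x d : ι → ℝ) (y : ℝ) : ℝ := ∑ i ∈ L with x i ≤ y, d i

/-- The left continuous version of `stepLe`. -/
def stepLt (L : Finset ι) (x d : ι → ℝ) (y : ℝ) : ℝ := ∑ i ∈ L with x i < y, d i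

variable {L : Finset ι} {x d : ι → ℝ}

theorem stepLe_eq_add (y : ℝ) :
    stepLe L x d y = stepLt L x d y + ∑ i ∈ L with x i = y, d i := by
  classical
  rw [stepLe, stepLt, ← Finset.sum_union]
  · congr 1
    ext i
    simp only [Finset.mem_filter, Finset.mem_union, le_iff_lt_or_eq]
    tauto
  · rw [Finset.disjoint_filter]
    exact fun i _ h h' => h.ne h'

theorem stepLe_congr {x' d' : ι → ℝ} {y y' : ℝ} (hx : ∀ i ∈ L, (x i ≤ y ↔ x' i ≤ y'))
    (hd : ∀ i ∈ L, d i = d' i) : stepLe L x d y = stepLe L x' d' y' := by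
  unfold stepLe
  rw [Finset.filter_congr hx]
  exact Finset.sum_congr rfl fun i hi => hd i (Finset.mem_filter.1 hi).1

theorem stepLt_congr {x' d' : ι → ℝ} {y y' : ℝ} (hx : ∀ i ∈ L, (x i < y ↔ x' i < y'))
    (hd : ∀ i ∈ L, d i = d' i) : stepLt L x d y = stepLt L x' d' y' := by
  unfold stepLt
  rw [Finset.filter_congr hx]
  exact Finset.sum_congr rfl fun i hi => hd i (Finset.mem_filter.1 hi).1

@[simp] theorem stepLe_empty (y : ℝ) : stepLe (∅ : Finset ι) x d y = 0 := by simp [stepLe]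

theorem stepLe_insert [DecidableEq ι] {i : ι} (hi : i ∉ L) (y : ℝ) :
    stepLe (insert i L) x d y = stepLe L x d y + if x i ≤ y then d i else 0 := by
  unfold stepLe
  rw [Finset.filter_insert]
  split_ifs with h
  · rw [Finset.sum_insert (by simp [hi]), add_comm]
  · rw [add_zero]

theorem stepLt_insert [DecidableEq ι] {i : ι} (hi : i ∉ L) (y : ℝ) :
    stepLt (insert i L) x d y = stepLt L x d y + if x i < y then d i else 0 := by
  unfold stepLt
  rw [Finset.filter_insert]
  split_ifs with h
  · rw [Finset.sum_insert (by simp [hi]), add_comm]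
  · rw [add_zero]

theorem stepLe_of_forall_le {y : ℝ} (h : ∀ i ∈ L, x i ≤ y) : stepLe L x d y = ∑ i ∈ L, d i := by
  rw [stepLe, Finset.filter_true_of_mem h]

theorem stepLe_of_forall_gt {y : ℝ} (h : ∀ i ∈ L, y < x i) : stepLe L x d y = 0 := by
  rw [stepLe, Finset.filter_false_of_mem fun i hi => not_le.2 (h i hi), Finset.sum_empty]

theorem stepLt_of_forall_lt {y : ℝ} (h : ∀ i ∈ L, x i < y) : stepLt L x d y = ∑ i ∈ L, d i := by
  rw [stepLt, Finset.filter_true_of_mem h]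

theorem stepLt_of_forall_ge {y : ℝ} (h : ∀ i ∈ L, y ≤ x i) : stepLt L x d y = 0 := by
  rw [stepLt, Finset.filter_false_of_mem fun i hi => not_lt.2 (h i hi), Finset.sum_empty]

theorem stepLe_eq_stepLt_of_forall_ne {y : ℝ} (h : ∀ i ∈ L, x i ≠ y) :
    stepLe L x d y = stepLt L x d y := by
  rw [stepLe_eq_add, Finset.filter_false_of_mem h, Finset.sum_empty, add_zero]

theorem stepLe_union [DecidableEq ι] {L' : Finset ι} (h : Disjoint L L') (y : ℝ) :
    stepLe (L ∪ L') x d y = stepLe L x d y + stepLe L' x d y := by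
  unfold stepLe
  rw [Finset.filter_union, Finset.sum_union (Finset.disjoint_filter_filter h)]

theorem stepLt_union [DecidableEq ι] {L' : Finset ι} (h : Disjoint L L') (y : ℝ) :
    stepLt (L ∪ L') x d y = stepLt L x d y + stepLt L' x d y := by
  unfold stepLt
  rw [Finset.filter_union, Finset.sum_union (Finset.disjoint_filter_filter h)]

theorem exists_stepLe_eq_stepLt (L : Finset ι) (x d : ι → ℝ) (y : ℝ) :
    ∃ y' < y, ∀ z, y' ≤ z → z < y → stepLe L x d z = stepLt L x d y := by
  classical
  obtain ⟨y', hy', h⟩ : ∃ y' < y, ∀ i ∈ L, x i < y → x i ≤ y' := by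
    rcases (L.filter (x · < y)).eq_empty_or_nonempty with he | hne
    · refine ⟨y - 1, by linarith, fun i hi hlt => ?_⟩
      have : i ∈ L.filter (x · < y) := Finset.mem_filter.2 ⟨hi, hlt⟩
      simp [he] at this
    · obtain ⟨j, hj, hmax⟩ := Finset.exists_max_image _ x hne
      exact ⟨x j, (Finset.mem_filter.1 hj).2,
        fun i hi hlt => hmax i (Finset.mem_filter.2 ⟨hi, hlt⟩)⟩
  refine ⟨y', hy', fun z hz hzy => ?_⟩
  unfold stepLe stepLt
  refine Finset.sum_congr (Finset.filter_congr fun i hi => ?_) fun _ _ => rfl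
  exact ⟨fun hle => hle.trans_lt hzy, fun hlt => (h i hi hlt).trans hz⟩

theorem exists_stepLe_eq (L : Finset ι) (x d : ι → ℝ) (y : ℝ) :
    ∃ y' > y, ∀ z, y ≤ z → z < y' → stepLe L x d z = stepLe L x d y := by
  classical
  obtain ⟨y', hy', h⟩ : ∃ y' > y, ∀ i ∈ L, y < x i → y' ≤ x i := by
    rcases (L.filter (y < x ·)).eq_empty_or_nonempty with he | hne
    · refine ⟨y + 1, by linarith, fun i hi hlt => ?_⟩
      have : i ∈ L.filter (y < x ·) := Finset.mem_filter.2 ⟨hi, hlt⟩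
      simp [he] at this
    · obtain ⟨j, hj, hmin⟩ := Finset.exists_min_image _ x hne
      exact ⟨x j, (Finset.mem_filter.1 hj).2,
        fun i hi hlt => hmin i (Finset.mem_filter.2 ⟨hi, hlt⟩)⟩
  refine ⟨y', hy', fun z hz hzy => ?_⟩
  unfold stepLe
  refine Finset.sum_congr (Finset.filter_congr fun i hi => ?_) fun _ _ => rfl
  refine ⟨fun hle => ?_, fun hle => hle.trans hz⟩
  by_contra! hc
  exact absurd (h i hi hc) (not_le.2 (hle.trans_lt hzy))

end Step

namespace LWRModel

variable (P : LWRModel)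

/-! ### Fronts -/

/-- The Rankine-Hugoniot speed. -/
def chord (a b : ℝ) : ℝ := (P.flux a - P.flux b) / (a - b)

theorem chord_comm (a b : ℝ) : P.chord a b = P.chord b a := by
  rw [chord, chord, ← neg_sub (P.flux b), ← neg_sub b, neg_div_neg_eq]

theorem chord_mul {a b : ℝ} (h : a ≠ b) : P.chord a b * (b - a) = P.flux b - P.flux a := by
  rw [chord_comm]; exact div_mul_cancel₀ _ (sub_ne_zero.2 h.symm)

/-- Secant slopes of a strictly concave function decrease to the right. The comparisons of front
speeds below rest on this. -/
theorem chord_lt {a b c : ℝ} (ha : 0 ≤ a) (hab : a < b) (hbc : b < c) (hc : c ≤ P.R) :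
    P.chord b c < P.chord a c ∧ P.chord a c < P.chord a b := by
  have h := P.flux_three_lt ha hab hbc hc
  have h1 := P.chord_mul hab.ne
  have h2 := P.chord_mul hbc.ne
  have h3 := P.chord_mul (hab.trans hbc).ne
  rw [← h1, ← h2] at h
  have p1 : 0 < b - a := sub_pos.2 hab
  have p2 : 0 < c - b := sub_pos.2 hbc
  have h4 : P.chord b c < P.chord a b := by
    have := mul_pos p1 p2
    by_contra! hcon
    nlinarith
  constructor <;> by_contra! hcon <;> nlinarith

theorem chord_lt_left {a b c : ℝ} (ha : 0 ≤ a) (hab : a < b) (hbc : b < c) (hc : c ≤ P.R) :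
    P.chord b c < P.chord a b :=
  (P.chord_lt ha hab hbc hc).1.trans (P.chord_lt ha hab hbc hc).2

theorem chord_lt_chord {a b c e : ℝ} (ha : 0 ≤ a) (hab : a < b) (hbc : b ≤ c) (hce : c < e)
    (he : e ≤ P.R) : P.chord c e < P.chord a b := by
  rcases hbc.eq_or_lt with rfl | hbc
  · exact P.chord_lt_left ha hab hce he
  · exact (P.chord_lt_left (ha.trans hab.le) hbc hce he).trans
      (P.chord_lt_left ha hab hbc (hce.le.trans he))

theorem chord_le_v {a b : ℝ} (ha : 0 ≤ a) (hab : a < b) (hb : b ≤ P.R) : P.chord a b ≤ P.v b := by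
  rw [chord_comm, chord, div_le_iff₀ (sub_pos.2 hab)]
  exact P.flux_sub_le ha hab hb

variable {P} in
theorem flux_sub_mul {a b s : ℝ} (h : a ≠ b) (hs : s = P.chord a b) (u : ℝ) :
    (P.flux b - u * b) - (P.flux a - u * a) = (s - u) * (b - a) := by
  have := P.chord_mul h
  rw [hs]; linarith

/-- An admissible classical front of the level-`ν` approximation: a shock, or a jump down to the
adjacent node. -/
structure Front (ν : ℕ) (a b s : ℝ) : Prop where
  left_mem : a ∈ P.densityGrid ν
  right_mem : b ∈ P.densityGrid ν
  ne : a ≠ b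
  speed : s = P.chord a b
  adjacent : b < a → ∀ z ∈ P.densityGrid ν, ¬ (b < z ∧ z < a)

/-- `p` is the least maximizer of `q ↦ f_ν(q) - ξ q` on `[r, l]`. -/
def LeastMax (ν : ℕ) (r l ξ p : ℝ) : Prop :=
  p ∈ Icc r l ∧ (∀ q ∈ Icc r l, P.fluxApprox ν q - ξ * q ≤ P.fluxApprox ν p - ξ * p) ∧
    ∀ q ∈ Icc r l, q < p → P.fluxApprox ν q - ξ * q < P.fluxApprox ν p - ξ * p

variable {P} {ν : ℕ}

theorem LeastMax.riemann_eq {r l ξ p : ℝ} (h : P.LeastMax ν r l ξ p) : P.riemann ν l r ξ = p := by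
  rw [riemann, if_neg (not_lt.2 (h.1.1.trans h.1.2))]
  refine IsLeast.csInf_eq ⟨⟨h.1, fun q hq => h.2.1 q hq⟩, fun q hq => ?_⟩
  by_contra! hlt
  exact absurd (hq.2 h.1) (not_le.2 (h.2.2 q hq.1 hlt))

/-- A concave polygon lies below the extension of an earlier chord. At nodes this is the decrease of
chords from `r`; inside a cell the affine piece starts below the extended chord and has a smaller
slope. -/
theorem fluxApprox_le_of_adjacent {r b l q : ℝ} (hr : r ∈ P.densityGrid ν)
    (hb : b ∈ P.densityGrid ν) (hl : l ∈ P.densityGrid ν) (hrb : r < b) (hbq : b ≤ q)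
    (hql : q ≤ l) : P.fluxApprox ν q ≤ P.flux r + P.chord r b * (q - r) := by
  have hr' := P.grid_subset ν hr
  have hl' := P.grid_subset ν hl
  have key : ∀ z ∈ P.densityGrid ν, b ≤ z → P.flux z ≤ P.flux r + P.chord r b * (z - r) := by
    intro z hz hbz
    have hz' := P.grid_subset ν hz
    have h1 := P.chord_mul (hrb.trans_le hbz).ne
    have h2 : P.chord r z ≤ P.chord r b := by
      rcases hbz.eq_or_lt with rfl | h
      · exact le_rfl
      · exact (P.chord_lt hr'.1 hrb h hz'.2).2.le
    nlinarith
  rcases hql.eq_or_lt with rfl | hql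
  · rw [P.fluxApprox_node hl]; exact key _ hl hbq
  obtain ⟨x, hx, y, hy, hbx, hxq, hqy, hyl, hadj⟩ := P.exists_adjacent hb hl hbq hql
  have hy' := P.grid_subset ν hy
  rw [P.fluxApprox_between hx hy hadj hxq hqy.le]
  have h1 := key x hx hbx
  have h2 := P.chord_lt_chord hr'.1 hrb hbx (hxq.trans_lt hqy) hy'.2
  rw [chord_comm, chord] at h2
  nlinarith

/-- If `ξ` is at least the slope over the lowest cell, then `f_ν - ξ·id` never exceeds its value at
`r`. -/
theorem LeastMax.left {r b l ξ : ℝ} (hr : r ∈ P.densityGrid ν)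
    (hb : b ∈ P.densityGrid ν) (hl : l ∈ P.densityGrid ν) (hrb : r < b) (hbl : b ≤ l)
    (hadj : ∀ z ∈ P.densityGrid ν, ¬ (r < z ∧ z < b)) (hξ : P.chord r b ≤ ξ) :
    P.LeastMax ν r l ξ r := by
  refine ⟨⟨le_rfl, hrb.le.trans hbl⟩, fun q hq => ?_, fun q hq h => absurd hq.1 (not_le.2 h)⟩
  rw [P.fluxApprox_node hr]
  have : P.fluxApprox ν q ≤ P.flux r + P.chord r b * (q - r) := by
    rcases le_total q b with h | h
    · rw [P.fluxApprox_between hr hb hadj hq.1 h, chord_comm, chord]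
    · exact fluxApprox_le_of_adjacent hr hb hl hrb h hq.2
  nlinarith [hq.1]

/-- If `ξ` is below the slope over the lowest cell, then `f_ν - ξ·id` increases strictly there, and
the maximizer above that cell is unaffected. -/
theorem LeastMax.extend {r b l ξ p : ℝ} (hr : r ∈ P.densityGrid ν)
    (hb : b ∈ P.densityGrid ν) (hrb : r < b)
    (hadj : ∀ z ∈ P.densityGrid ν, ¬ (r < z ∧ z < b)) (hξ : ξ < P.chord r b)
    (h : P.LeastMax ν b l ξ p) : P.LeastMax ν r l ξ p := by
  have key : ∀ q ∈ Icc r l, q < b → P.fluxApprox ν q - ξ * q < P.fluxApprox ν p - ξ * p := by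
    intro q hq hqb
    refine lt_of_lt_of_le ?_ (h.2.1 b ⟨le_rfl, h.1.1.trans h.1.2⟩)
    rw [P.fluxApprox_between hr hb hadj hq.1 hqb.le, P.fluxApprox_node hb]
    have h1 := P.chord_mul hrb.ne
    have h2 : (P.flux b - P.flux r) / (b - r) = P.chord r b := by rw [chord_comm]; rfl
    rw [h2]
    nlinarith
  refine ⟨⟨hrb.le.trans h.1.1, h.1.2⟩, fun q hq => ?_, fun q hq hqp => ?_⟩
  · rcases lt_or_ge q b with hqb | hqb
    · exact (key q hq hqb).le
    · exact h.2.1 q ⟨hqb, hq.2⟩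
  · rcases lt_or_ge q b with hqb | hqb
    · exact key q hq hqb
    · exact h.2.2 q ⟨hqb, hq.2⟩ hqp

/-- `S` and `D` are the speeds and the jumps of the waves which solve a Riemann problem, for left
state `l`. All waves are classical fronts. -/
def ClassicalFan (P : LWRModel) (ν : ℕ) (l : ℝ) (S : Finset ℝ) (D : ℝ → ℝ) : Prop :=
  ∀ s ∈ S, P.Front ν (l + stepLt S id D s) (l + stepLe S id D s) s

/-- Peel off the lowest cell `[r, b]`. Its chord is the steepest, so its wave is the fastest and is
appended to the fan from `l` to `b`; the two preceding lemmas say what this does to the maximizer.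
-/
theorem exists_rarefaction {l : ℝ} (hl : l ∈ P.densityGrid ν) (n : ℕ) :
    ∀ r ∈ P.densityGrid ν, r ≤ l → (P.densityGrid ν ∩ Ico r l).ncard = n →
    ∃ (S : Finset ℝ) (D : ℝ → ℝ),
      (∀ ξ, P.LeastMax ν r l ξ (l + stepLe S id D ξ)) ∧
      (∀ ξ, l + stepLe S id D ξ ∈ P.densityGrid ν) ∧
      P.ClassicalFan ν l S D ∧ l + ∑ s ∈ S, D s = r ∧ (∀ s ∈ S, D s < 0) ∧
      (l = r → S = ∅) ∧
      (r < l → (∀ z ∈ P.densityGrid ν, ¬ (r < z ∧ z < l)) → S = {P.chord r l}) := by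
  classical
  induction n using Nat.strong_induction_on with
  | _ n ih =>
  intro r hr hrl hn
  rcases hrl.eq_or_lt with rfl | hrl
  · refine ⟨∅, 0, fun ξ => ?_, by simpa using hr, fun s hs => by simp at hs, by simp, by simp,
      by simp, fun h => absurd h (lt_irrefl _)⟩
    simp only [stepLe_empty, add_zero]
    refine ⟨⟨le_rfl, le_rfl⟩, fun q hq => ?_, fun q hq h => absurd hq.1 (not_le.2 h)⟩
    rw [le_antisymm hq.2 hq.1]
  obtain ⟨r', hr', b, hb, h1, h2, hrb, hbl, hadj⟩ := P.exists_adjacent hr hl le_rfl hrl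
  obtain rfl : r' = r := le_antisymm h2 h1
  have hlt : (P.densityGrid ν ∩ Ico b l).ncard < n := by
    rw [← hn]
    refine ncard_lt_ncard ⟨fun z hz => ⟨hz.1, hrb.le.trans hz.2.1, hz.2.2⟩, fun hsub => ?_⟩
      ((P.densityGrid_finite ν).inter_of_left _)
    exact absurd (hsub ⟨hr, le_rfl, hrl⟩).2.1 (not_le.2 hrb)
  obtain ⟨S, D, hmax, hgrid, hfan, htot, hneg, hemp, -⟩ := ih _ hlt b hb hbl rfl
  set m := P.chord r' b with hm
  -- All older waves connect nodes in `[b, l]`, where chords are flatter than over `[r, b]`.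
  have hSm : ∀ s ∈ S, s < m := by
    intro s hs
    have hf := hfan s hs
    have hge := (hmax s).1.1
    have hlt' : l + stepLe S id D s < l + stepLt S id D s := by
      rw [stepLe_eq_add]
      have : ∑ i ∈ S with id i = s, D i = D s := by
        rw [Finset.sum_filter]; simp [hs]
      rw [this]; linarith [hneg s hs]
    rw [hf.speed, chord_comm]
    exact P.chord_lt_chord (P.grid_subset ν hr).1 hrb hge hlt' (P.grid_subset ν hf.left_mem).2
  have hmS : m ∉ S := fun h => lt_irrefl _ (hSm m h)
  set D' := Function.update D m (r' - b) with hD'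
  have hDD : ∀ s ∈ S, D' s = D s := fun s hs => by
    rw [hD', Function.update_of_ne (ne_of_mem_of_not_mem hs hmS)]
  have hD'm : D' m = r' - b := by simp [hD']
  have hle : ∀ ξ, l + stepLe (insert m S) id D' ξ =
      if m ≤ ξ then r' else l + stepLe S id D ξ := by
    intro ξ
    rw [stepLe_insert hmS, stepLe_congr (fun _ _ => Iff.rfl) hDD]
    simp only [id]
    split_ifs with h
    · rw [stepLe_of_forall_le (x := id) fun s hs => (hSm s hs).le.trans h, hD'm]; linarith
    · rw [add_zero]
  have hlt2 : ∀ s, s ≤ m → stepLt (insert m S) id D' s = stepLt S id D s := by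
    intro s hs
    rw [stepLt_insert hmS, stepLt_congr (fun _ _ => Iff.rfl) hDD]
    simp [not_lt.2 hs]
  refine ⟨insert m S, D', fun ξ => ?_, fun ξ => ?_, fun s hs => ?_, ?_, fun s hs => ?_,
    fun h => absurd h hrl.ne', fun _ had => ?_⟩
  · rw [hle]
    split_ifs with h
    · exact LeastMax.left hr hb hl hrb hbl hadj h
    · exact LeastMax.extend hr hb hrb hadj (not_le.1 h) (hmax ξ)
  · rw [hle]; split_ifs
    exacts [hr, hgrid ξ]
  · rw [hle]
    rcases Finset.mem_insert.1 hs with rfl | hs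
    · rw [if_pos le_rfl, hlt2 _ le_rfl, stepLt_of_forall_lt (x := id) (fun s hs => hSm s hs), htot]
      exact ⟨hb, hr, hrb.ne', P.chord_comm _ _, fun _ => hadj⟩
    · rw [if_neg (not_le.2 (hSm s hs)), hlt2 _ (hSm s hs).le]
      exact hfan s hs
  · rw [Finset.sum_insert hmS, hD'm, Finset.sum_congr rfl hDD]; linarith
  · rcases Finset.mem_insert.1 hs with rfl | hs
    · rw [hD'm]; linarith
    · rw [hDD s hs]; exact hneg s hs
  · rcases hbl.eq_or_lt with h | h
    · rw [hemp h.symm, hm, h]; rfl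
    · exact absurd ⟨hrb, h⟩ (had b hb)

end LWRModel

/-! ### Wave fans of the classical and of the constrained Riemann problem -/

namespace LWRModel

variable {P : LWRModel} {ν : ℕ}

/-- The waves which solve the classical Riemann problem. -/
structure RiemannFan (P : LWRModel) (ν : ℕ) (l r : ℝ) (S : Finset ℝ) (D : ℝ → ℝ) : Prop where
  eq : ∀ ξ, P.riemann ν l r ξ = l + stepLe S id D ξ
  fan : P.ClassicalFan ν l S D
  total : l + ∑ s ∈ S, D s = r
  variation : ∑ s ∈ S, |D s| = |l - r|
  card_le : l ≤ r → S.card ≤ 1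
  empty : l = r → S = ∅
  single : ∀ s, P.Front ν l r s → S = {s}
  shock : l < r → S = {P.chord l r}
  le_v : ∀ s ∈ S, s ≤ P.v r

theorem riemann_shock {l r : ℝ} (hl : l ∈ P.densityGrid ν) (hr : r ∈ P.densityGrid ν)
    (h : l < r) (ξ : ℝ) : P.riemann ν l r ξ = if ξ < P.chord l r then l else r := by
  rw [riemann, if_pos h, P.fluxApprox_node hl, P.fluxApprox_node hr]; rfl

theorem riemann_rarefaction {l r : ℝ} (hl : l ∈ P.densityGrid ν) (hr : r ∈ P.densityGrid ν)
    (h : r ≤ l) (ξ : ℝ) : P.riemann ν l r ξ ∈ P.densityGrid ν ∧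
      P.LeastMax ν r l ξ (P.riemann ν l r ξ) := by
  obtain ⟨S, D, hmax, hgrid, -⟩ := exists_rarefaction hl _ r hr h rfl
  rw [(hmax ξ).riemann_eq]
  exact ⟨hgrid ξ, hmax ξ⟩

theorem riemann_self {l : ℝ} (hl : l ∈ P.densityGrid ν) (ξ : ℝ) : P.riemann ν l l ξ = l := by
  have := (riemann_rarefaction hl hl le_rfl ξ).2.1
  exact le_antisymm this.2 this.1

theorem riemann_mem {l r : ℝ} (hl : l ∈ P.densityGrid ν) (hr : r ∈ P.densityGrid ν) (ξ : ℝ) :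
    P.riemann ν l r ξ ∈ P.densityGrid ν := by
  rcases lt_or_ge l r with h | h
  · rw [riemann_shock hl hr h]; split_ifs
    exacts [hl, hr]
  · exact (riemann_rarefaction hl hr h ξ).1

theorem riemann_max {l r q : ℝ} (hl : l ∈ P.densityGrid ν) (hr : r ∈ P.densityGrid ν)
    (hq : q ∈ P.densityGrid ν) (hrq : r ≤ q) (hql : q ≤ l) (ξ : ℝ) :
    P.flux q - ξ * q ≤ P.flux (P.riemann ν l r ξ) - ξ * P.riemann ν l r ξ := by
  have h := riemann_rarefaction hl hr (hrq.trans hql) ξ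
  have := h.2.2.1 q ⟨hrq, hql⟩
  rwa [P.fluxApprox_node hq, P.fluxApprox_node h.1] at this

theorem sum_filter_id_eq {S : Finset ℝ} {D : ℝ → ℝ} {s : ℝ} (hs : s ∈ S) :
    ∑ i ∈ S with id i = s, D i = D s := by
  rw [Finset.sum_filter]; simp [hs]

theorem exists_riemannFan {l r : ℝ} (hl : l ∈ P.densityGrid ν) (hr : r ∈ P.densityGrid ν) :
    ∃ S D, P.RiemannFan ν l r S D := by
  have hl' := P.grid_subset ν hl
  have hr' := P.grid_subset ν hr
  rcases lt_or_ge l r with h | h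
  · have hfr : P.Front ν l r (P.chord l r) :=
      ⟨hl, hr, h.ne, rfl, fun h' => absurd h' (not_lt.2 h.le)⟩
    refine ⟨{P.chord l r}, fun _ => r - l, fun ξ => ?_, fun s hs => ?_, by simp,
      by simp [abs_sub_comm], fun _ => by simp, fun h' => absurd h' h.ne,
      fun s hs => by rw [hs.speed], fun _ => rfl, fun s hs => ?_⟩
    · rw [riemann_shock hl hr h, stepLe, Finset.filter_singleton]
      simp only [id, ← not_lt]
      split_ifs <;> simp
    · rw [Finset.mem_singleton.1 hs]
      simpa [stepLe, stepLt, Finset.filter_singleton] using hfr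
    · rw [Finset.mem_singleton.1 hs]
      exact P.chord_le_v hl'.1 h hr'.2
  · obtain ⟨S, D, hmax, hgrid, hfan, htot, hneg, hemp, hsing⟩ := exists_rarefaction hl _ r hr h rfl
    refine ⟨S, D, fun ξ => (hmax ξ).riemann_eq, hfan, htot, ?_, fun h' => ?_, hemp, fun s hs => ?_,
      fun h' => absurd h' (not_lt.2 h), fun s hs => ?_⟩
    · rw [abs_of_nonneg (sub_nonneg.2 h), Finset.sum_congr rfl fun s hs => abs_of_neg (hneg s hs),
        Finset.sum_neg_distrib]
      linarith
    · simp [hemp (le_antisymm h' h)]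
    · have hlt : r < l := lt_of_le_of_ne h hs.ne.symm
      rw [hsing hlt (hs.adjacent hlt), hs.speed, chord_comm]
    -- A rarefaction jump moves at most at the traffic speed of its larger state, which is at most
    -- `v(r)` because `v` decreases.
    · have hf := hfan s hs
      have hb := (hmax s).1.1
      have hlt : l + stepLe S id D s < l + stepLt S id D s := by
        rw [stepLe_eq_add, sum_filter_id_eq hs]; linarith [hneg s hs]
      have ha := P.grid_subset ν hf.left_mem
      rw [hf.speed, chord_comm]
      exact (P.chord_le_v (hr'.1.trans hb) hlt ha.2).trans
        (P.v_strictAntiOn.antitoneOn hr' ha (hb.trans hlt.le))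

/-! ### The constrained Riemann problem -/

theorem violates_iff {u l r : ℝ} (hu : u ∈ P.speedGrid ν) (hl : l ∈ P.densityGrid ν)
    (hr : r ∈ P.densityGrid ν) : P.Violates ν u l r ↔
      P.check u < P.riemann ν l r u ∧ P.riemann ν l r u < P.hat u := by
  have hm := riemann_mem hl hr u
  rw [Violates, P.fluxApprox_node hm]
  exact P.lt_flux_iff (P.speedGrid_subset ν hu).1 (P.grid_subset ν hm)

/-- For a shock, the state at speed `u` is the one of the two with the smaller value of `f - u·id`,
since this quantity jumps by `(s - u)(r - l)`. If it violates the constraint, so does the other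
state. In a rarefaction the state at speed `u` lies between `r` and `l`. -/
theorem Violates.bounds {u l r : ℝ} (hu : u ∈ P.speedGrid ν) (hl : l ∈ P.densityGrid ν)
    (hr : r ∈ P.densityGrid ν) (h : P.Violates ν u l r) :
    P.check u < l ∧ r < P.hat u ∧ (l < r → l < P.hat u ∧ P.check u < r) := by
  rw [violates_iff hu hl hr] at h
  rcases lt_or_ge l r with hlr | hlr
  · suffices (P.check u < l ∧ l < P.hat u) ∧ (P.check u < r ∧ r < P.hat u) from
      ⟨this.1.1, this.2.2, fun _ => ⟨this.1.2, this.2.1⟩⟩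
    have h0 := (P.speedGrid_subset ν hu).1
    have hl' := P.grid_subset ν hl
    have hr' := P.grid_subset ν hr
    have hd := flux_sub_mul (P := P) hlr.ne rfl u
    rw [riemann_shock hl hr hlr] at h
    rw [← P.lt_flux_iff h0 hl', ← P.lt_flux_iff h0 hr']
    split_ifs at h with hs
    · rw [← P.lt_flux_iff h0 hl'] at h
      exact ⟨h, by nlinarith⟩
    · rw [← P.lt_flux_iff h0 hr'] at h
      exact ⟨by nlinarith, h⟩
  · have hm := (riemann_rarefaction hl hr hlr u).2.1
    exact ⟨h.1.trans_le hm.2, hm.1.trans_lt h.2, fun h' => absurd h' (not_lt.2 hlr)⟩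

/-- In a rarefaction the state at speed `u` maximizes `f - u·id` among the nodes of `[r, l]`, so one
node there strictly between `ρ̌_u` and `ρ̂_u` suffices for a violation. If neither `r` nor `l` is
such a node, `exists_grid_between` provides one. -/
theorem not_violates_or {u l r : ℝ} (hν : 1 ≤ ν) (hu : u ∈ P.speedGrid ν)
    (hl : l ∈ P.densityGrid ν) (hr : r ∈ P.densityGrid ν) (hrl : r ≤ l)
    (h : ¬ P.Violates ν u l r) : l ≤ P.check u ∨ P.hat u ≤ r := by
  have hu' := P.speedGrid_subset ν hu
  rcases hu'.2.eq_or_lt with rfl | hV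
  · right; rw [hat_V]; exact (P.grid_subset ν hr).1
  by_contra! hc
  have hlt := P.check_lt_hat ⟨hu'.1, hV⟩
  refine h ((violates_iff hu hl hr).2 ?_)
  have hm := riemann_mem hl hr u
  suffices ∃ q ∈ P.densityGrid ν, r ≤ q ∧ q ≤ l ∧ P.check u < q ∧ q < P.hat u by
    obtain ⟨q, hq, h1, h2, h3⟩ := this
    rw [← P.lt_flux_iff hu'.1 (P.grid_subset ν hq)] at h3
    rw [← P.lt_flux_iff hu'.1 (P.grid_subset ν hm)]
    have := riemann_max hl hr hq h1 h2 u
    linarith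
  rcases lt_or_ge (P.check u) r with h1 | h1
  · exact ⟨r, hr, le_rfl, hrl, h1, hc.2⟩
  rcases lt_or_ge l (P.hat u) with h2 | h2
  · exact ⟨l, hl, hrl, le_rfl, hc.1, h2⟩
  obtain ⟨m, hm, h3⟩ := P.exists_grid_between hν hu hlt
  exact ⟨m, hm, h1.trans h3.1.le, h3.2.le.trans h2, h3⟩

/-- The jump at an enforcing vehicle triggers the constraint again, which makes it persist under
repeated solving. -/
theorem violates_active {u : ℝ} (hν : 1 ≤ ν) (hu : u ∈ P.speedGrid ν)
    (h : P.check u < P.hat u) : P.Violates ν u (P.hat u) (P.check u) := by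
  by_contra hc
  rcases not_violates_or hν hu (P.hat_mem_grid hu) (P.check_mem_grid hu) h.le hc with h' | h' <;>
    linarith

/-- Right after a Riemann problem at the vehicle where the constraint is not enforced: the states
`a`, `b` next to the vehicle of speed `c`, which travels along with a wave if `m`. -/
structure Inactive (P : LWRModel) (ν : ℕ) (u a b c : ℝ) (m : Prop) : Prop where
  not_violates : ¬ P.Violates ν u a b
  speed : c = min u (P.v b)
  front : m → P.Front ν a b c
  eq : ¬ m → a = b

/-- The states next to a vehicle of speed `c` which enforces the constraint. -/
structure Active (P : LWRModel) (u a b c : ℝ) (m : Prop) : Prop where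
  lt : P.check u < P.hat u
  left : a = P.hat u
  right : b = P.check u
  speed : c = u
  mem : m

/-- An admissible front is its own Riemann solution: a shock, or a rarefaction over a single cell.
-/
theorem Front.riemann_eq {a b s : ℝ} (h : P.Front ν a b s) (ξ : ℝ) :
    P.riemann ν a b ξ = if ξ < s then a else b := by
  obtain ⟨S, D, hf⟩ := exists_riemannFan h.left_mem h.right_mem
  have hS := hf.single s h
  have ht := hf.total
  subst hS
  rw [Finset.sum_singleton] at ht
  rw [hf.eq, stepLe, Finset.filter_singleton]
  simp only [id, ← not_lt]
  split_ifs with h1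
  · simp
  · simpa using ht

/-- In a rarefaction, maximality of the state `m` against `r` says that `ξ` is at most the chord
between them, and this chord is at most `v(m)`. -/
theorem le_v_riemann {l r ξ : ℝ} (hl : l ∈ P.densityGrid ν) (hr : r ∈ P.densityGrid ν)
    (h : ξ ≤ P.v r) : ξ ≤ P.v (P.riemann ν l r ξ) := by
  have hl' := P.grid_subset ν hl
  have hr' := P.grid_subset ν hr
  rcases lt_or_ge l r with hlr | hlr
  · rw [riemann_shock hl hr hlr]; split_ifs
    · exact h.trans (P.v_strictAntiOn.antitoneOn hl' hr' hlr.le)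
    · exact h
  · have hm := (riemann_rarefaction hl hr hlr ξ).2.1
    have hg := P.grid_subset ν (riemann_mem hl hr ξ)
    rcases hm.1.eq_or_lt with he | hlt
    · rwa [← he]
    · have h1 := riemann_max hl hr hr le_rfl hlr ξ
      refine le_trans ?_ (P.chord_le_v hr'.1 hlt hg.2)
      rw [chord_comm, chord, le_div_iff₀ (sub_pos.2 hlt)]
      linarith

/-- Right after the solution of the Riemann problem the vehicle sees the fan at its own speed. If `u
≤ v(r)`, this is the state already tested against the constraint. Otherwise no wave outruns the
vehicle, the state at its right is `r`, and `f(r) = r v(r) ≤ u r` rules out a violation. -/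
theorem inactive_of_not_violates {u l r : ℝ} {S : Finset ℝ} {D : ℝ → ℝ} (hu : u ∈ P.speedGrid ν)
    (hl : l ∈ P.densityGrid ν) (hr : r ∈ P.densityGrid ν) (hf : P.RiemannFan ν l r S D)
    (h : ¬ P.Violates ν u l r) :
    P.Inactive ν u (l + stepLt S id D (min u (P.v r))) (l + stepLe S id D (min u (P.v r)))
      (min u (P.v r)) (min u (P.v r) ∈ S) := by
  set c := min u (P.v r) with hc
  have hgrid : ∀ ξ, l + stepLe S id D ξ ∈ P.densityGrid ν := fun ξ => by
    rw [← hf.eq]; exact riemann_mem hl hr ξ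
  have hfr : c ∈ S → P.Front ν (l + stepLt S id D c) (l + stepLe S id D c) c := hf.fan c
  have heq : c ∉ S → l + stepLt S id D c = l + stepLe S id D c := fun hcS => by
    rw [stepLe_eq_stepLt_of_forall_ne]
    rintro i hi rfl
    exact hcS hi
  have hm : P.riemann ν (l + stepLt S id D c) (l + stepLe S id D c) u = l + stepLe S id D c := by
    by_cases hcS : c ∈ S
    · rw [(hfr hcS).riemann_eq, if_neg (not_lt.2 (min_le_left _ _))]
    · rw [heq hcS]; exact riemann_self (hgrid c) u
  have hlmem : l + stepLt S id D c ∈ P.densityGrid ν := by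
    by_cases hcS : c ∈ S
    · exact (hfr hcS).left_mem
    · rw [heq hcS]; exact hgrid c
  refine ⟨?_, ?_, hfr, heq⟩
  · rw [violates_iff hu hlmem (hgrid c), hm]
    rcases le_total u (P.v r) with hle | hle
    · rw [violates_iff hu hl hr, hf.eq] at h
      rwa [hc, min_eq_left hle]
    · have hall : l + stepLe S id D c = r := by
        rw [hc, min_eq_right hle, stepLe_of_forall_le (x := id) hf.le_v, hf.total]
      have hr' := P.grid_subset ν hr
      rw [hall, ← P.lt_flux_iff (P.speedGrid_subset ν hu).1 hr']
      have := P.capacity_nonneg u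
      have : P.flux r ≤ u * r := by
        rw [flux, mul_comm]; exact mul_le_mul_of_nonneg_right hle hr'.1
      linarith
  · rcases le_total u (P.v r) with hle | hle
    · have := le_v_riemann hl hr hle
      rw [hf.eq] at this
      rw [hc, min_eq_left hle, min_eq_left this]
    · have hall : l + stepLe S id D c = r := by
        rw [hc, min_eq_right hle, stepLe_of_forall_le (x := id) hf.le_v, hf.total]
      rw [hall]

/-- The waves which solve the constrained Riemann problem when the constraint is enforced. -/
structure ActiveFan (P : LWRModel) (ν : ℕ) (u l r : ℝ) (S : Finset ℝ) (D : ℝ → ℝ) : Prop where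
  eq : ∀ ξ, (if ξ < u then P.riemann ν l (P.hat u) ξ else P.riemann ν (P.check u) r ξ) =
    l + stepLe S id D ξ
  fan : ∀ s ∈ S, s ≠ u → P.Front ν (l + stepLt S id D s) (l + stepLe S id D s) s
  total : l + ∑ s ∈ S, D s = r
  active : P.Active u (l + stepLt S id D u) (l + stepLe S id D u) u (u ∈ S)
  variation : ∑ s ∈ S, |D s| =
    |l - P.hat u| + (P.hat u - P.check u) + |P.check u - r|
  single : l = P.hat u → r = P.check u → S = {u}

/-- The points `ρ̌_u` and `ρ̂_u` are joined by a chord of slope `u`. By concavity every wave from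
`l` to `ρ̂_u` is slower than `u` and every wave from `ρ̌_u` to `r` is faster, so both fans and the
jump at `u` fit together. -/
theorem exists_activeFan {u l r : ℝ} (hu : u ∈ P.speedGrid ν)
    (hl : l ∈ P.densityGrid ν) (hr : r ∈ P.densityGrid ν) (h : P.Violates ν u l r) :
    ∃ S D, P.ActiveFan ν u l r S D := by
  classical
  have hu' := P.speedGrid_subset ν hu
  have hhg := P.hat_mem_grid hu
  have hcg := P.check_mem_grid hu
  have hl' := P.grid_subset ν hl
  have hr' := P.grid_subset ν hr
  obtain ⟨hcl, hrh, -⟩ := h.bounds hu hl hr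
  have hlt : P.check u < P.hat u := by
    rw [violates_iff hu hl hr] at h; exact h.1.trans h.2
  have hchord : P.chord (P.check u) (P.hat u) = u := by
    have h1 := P.chord_mul hlt.ne
    rw [flux_check, flux_hat] at h1
    have h2 : P.hat u - P.check u ≠ 0 := sub_ne_zero.2 hlt.ne'
    exact mul_right_cancel₀ h2 (by linarith)
  obtain ⟨S₁, D₁, h₁⟩ := exists_riemannFan hl hhg
  obtain ⟨S₂, D₂, h₂⟩ := exists_riemannFan hcg hr
  have hS₁ : ∀ s ∈ S₁, s < u := by
    intro s hs
    rcases lt_or_ge l (P.hat u) with hlh | hlh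
    · rw [h₁.shock hlh, Finset.mem_singleton] at hs
      rw [hs]
      refine lt_of_lt_of_eq ?_ hchord
      exact (P.chord_lt (P.check_mem u).1 hcl hlh (P.hat_mem u).2).1
    · have hf := h₁.fan s hs
      have hr1 := riemann_rarefaction hl hhg hlh
      have hb := (hr1 s).2.1.1
      rw [h₁.eq] at hb
      have hg := P.grid_subset ν hf.left_mem
      have hg2 := P.grid_subset ν hf.right_mem
      have ha : P.hat u ≤ l + stepLt S₁ id D₁ s := by
        by_contra! hcon
        obtain ⟨s', hs's, hs'⟩ := exists_stepLe_eq_stepLt S₁ id D₁ s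
        have h5 := (hr1 s').2.1.1
        rw [h₁.eq, hs' s' le_rfl hs's] at h5
        linarith
      rw [hf.speed]
      refine lt_of_lt_of_eq ?_ hchord
      rcases lt_trichotomy (l + stepLt S₁ id D₁ s) (l + stepLe S₁ id D₁ s) with hab | hab | hab
      · exact P.chord_lt_chord (P.check_mem u).1 hlt ha hab hg2.2
      · exact absurd hab hf.ne
      · rw [P.chord_comm (l + _)]
        exact P.chord_lt_chord (P.check_mem u).1 hlt hb hab hg.2
  have hS₂ : ∀ s ∈ S₂, u < s := by
    intro s hs
    rcases lt_or_ge (P.check u) r with hlh | hlh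
    · rw [h₂.shock hlh, Finset.mem_singleton] at hs
      rw [hs]
      refine lt_of_eq_of_lt hchord.symm ?_
      exact (P.chord_lt (P.check_mem u).1 hlh hrh (P.hat_mem u).2).2
    · have hf := h₂.fan s hs
      have hg := P.grid_subset ν hf.left_mem
      have hg2 := P.grid_subset ν hf.right_mem
      have hb := (riemann_rarefaction hcg hr hlh s).2.1.2
      rw [h₂.eq] at hb
      have ha : P.check u + stepLt S₂ id D₂ s ≤ P.check u := by
        by_contra! hcon
        obtain ⟨s', hs's, hs'⟩ := exists_stepLe_eq_stepLt S₂ id D₂ s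
        have h5 := (riemann_rarefaction hcg hr hlh s').2.1.2
        rw [h₂.eq, hs' s' le_rfl hs's] at h5
        linarith
      rw [hf.speed]
      refine lt_of_eq_of_lt hchord.symm ?_
      rcases lt_trichotomy (P.check u + stepLt S₂ id D₂ s) (P.check u + stepLe S₂ id D₂ s)
        with hab | hab | hab
      · exact P.chord_lt_chord hg.1 hab hb hlt (P.hat_mem u).2
      · exact absurd hab hf.ne
      · rw [P.chord_comm (P.check u + _)]
        exact P.chord_lt_chord hg2.1 hab ha hlt (P.hat_mem u).2
  have hdisj : Disjoint S₁ S₂ := Finset.disjoint_left.2 fun s hs hs' =>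
    lt_asymm (hS₁ s hs) (hS₂ s hs')
  have huS : u ∉ S₁ ∪ S₂ := fun h => (Finset.mem_union.1 h).elim
    (fun h => lt_irrefl _ (hS₁ u h)) fun h => lt_irrefl _ (hS₂ u h)
  set D : ℝ → ℝ := fun s => if s < u then D₁ s else if s = u then P.check u - P.hat u else D₂ s
    with hD
  have hD₁ : ∀ s ∈ S₁, D s = D₁ s := fun s hs => by simp [hD, hS₁ s hs]
  have hD₂ : ∀ s ∈ S₂, D s = D₂ s := fun s hs => by
    simp [hD, (hS₂ s hs).not_gt, (hS₂ s hs).ne']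
  have hDu : D u = P.check u - P.hat u := by simp [hD]
  have hLe : ∀ ξ, stepLe (insert u (S₁ ∪ S₂)) id D ξ = stepLe S₁ id D₁ ξ + stepLe S₂ id D₂ ξ +
      if u ≤ ξ then P.check u - P.hat u else 0 := fun ξ => by
    rw [stepLe_insert huS, stepLe_union hdisj, stepLe_congr (fun _ _ => Iff.rfl) hD₁,
      stepLe_congr (fun _ _ => Iff.rfl) hD₂, hDu]; rfl
  have hLt : ∀ ξ, stepLt (insert u (S₁ ∪ S₂)) id D ξ = stepLt S₁ id D₁ ξ + stepLt S₂ id D₂ ξ +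
      if u < ξ then P.check u - P.hat u else 0 := fun ξ => by
    rw [stepLt_insert huS, stepLt_union hdisj, stepLt_congr (fun _ _ => Iff.rfl) hD₁,
      stepLt_congr (fun _ _ => Iff.rfl) hD₂, hDu]; rfl
  have e₁ : ∀ ξ, u ≤ ξ → l + stepLe S₁ id D₁ ξ = P.hat u := fun ξ hξ => by
    rw [stepLe_of_forall_le (x := id) fun s hs => (hS₁ s hs).le.trans hξ, h₁.total]
  have e₁' : ∀ ξ, u ≤ ξ → l + stepLt S₁ id D₁ ξ = P.hat u := fun ξ hξ => by
    rw [stepLt_of_forall_lt (x := id) fun s hs => (hS₁ s hs).trans_le hξ, h₁.total]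
  have e₂ : ∀ ξ, ξ ≤ u → stepLe S₂ id D₂ ξ = 0 := fun ξ hξ =>
    stepLe_of_forall_gt (x := id) fun s hs => hξ.trans_lt (hS₂ s hs)
  have e₂' : ∀ ξ, ξ ≤ u → stepLt S₂ id D₂ ξ = 0 := fun ξ hξ =>
    stepLt_of_forall_ge (x := id) fun s hs => hξ.trans (hS₂ s hs).le
  refine ⟨insert u (S₁ ∪ S₂), D, fun ξ => ?_, fun s hs hsu => ?_, ?_, ?_, ?_, fun hlh hrc => ?_⟩
  · rw [hLe]
    rcases lt_or_ge ξ u with h | h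
    · rw [if_pos h, if_neg (not_le.2 h), e₂ ξ h.le, h₁.eq]; ring
    · rw [if_neg (not_lt.2 h), if_pos h, h₂.eq]
      linarith [e₁ ξ h]
  · rw [hLe, hLt]
    rcases Finset.mem_union.1 (Finset.mem_of_mem_insert_of_ne hs hsu) with h | h
    · have hlt := hS₁ s h
      rw [if_neg (not_lt.2 hlt.le), if_neg (not_le.2 hlt), e₂ s hlt.le, e₂' s hlt.le]
      simpa using h₁.fan s h
    · have hlt := hS₂ s h
      rw [if_pos hlt, if_pos hlt.le]
      have h3 := h₂.fan s h
      have h4 := e₁ s hlt.le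
      have h5 := e₁' s hlt.le
      convert h3 using 1 <;> linarith
  · rw [Finset.sum_insert huS, Finset.sum_union hdisj, Finset.sum_congr rfl hD₁,
      Finset.sum_congr rfl hD₂, hDu]
    linarith [h₁.total, h₂.total]
  · refine ⟨hlt, ?_, ?_, rfl, Finset.mem_insert_self _ _⟩
    · rw [hLt, if_neg (lt_irrefl _), e₂' u le_rfl]; linarith [e₁' u le_rfl]
    · rw [hLe, if_pos le_rfl, e₂ u le_rfl]; linarith [e₁ u le_rfl]
  · rw [Finset.sum_insert huS, Finset.sum_union hdisj,
      Finset.sum_congr rfl fun s hs => congrArg abs (hD₁ s hs),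
      Finset.sum_congr rfl fun s hs => congrArg abs (hD₂ s hs), hDu, h₁.variation, h₂.variation,
      abs_of_neg (sub_neg.2 hlt)]
    ring
  · rw [h₁.empty hlh, h₂.empty hrc.symm]; rfl

end LWRModel

/-! ### One-sided limits, total variation and `L¹` distance of step functions -/

section Step

variable {ι : Type*} {L : Finset ι} {x d : ι → ℝ}

theorem stepLe_tendsto_left (L : Finset ι) (x d : ι → ℝ) (y : ℝ) :
    Tendsto (stepLe L x d) (𝓝[<] y) (𝓝 (stepLt L x d y)) := by
  obtain ⟨y', hy', h⟩ := exists_stepLe_eq_stepLt L x d y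
  refine tendsto_const_nhds.congr' ?_
  filter_upwards [Ico_mem_nhdsLT hy'] with z hz using (h z hz.1 hz.2).symm

theorem stepLe_continuousWithinAt (L : Finset ι) (x d : ι → ℝ) (y : ℝ) :
    ContinuousWithinAt (stepLe L x d) (Ici y) y := by
  obtain ⟨y', hy', h⟩ := exists_stepLe_eq L x d y
  refine tendsto_const_nhds.congr' ?_
  filter_upwards [Ico_mem_nhdsGE hy'] with z hz using (h z hz.1 hz.2).symm

@[simp] theorem leftLim_stepLe (L : Finset ι) (x d : ι → ℝ) (y : ℝ) :
    Function.leftLim (stepLe L x d) y = stepLt L x d y :=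
  leftLim_eq_of_tendsto (stepLe_tendsto_left L x d y)

@[simp] theorem rightLim_stepLe (L : Finset ι) (x d : ι → ℝ) (y : ℝ) :
    Function.rightLim (stepLe L x d) y = stepLe L x d y :=
  (stepLe_continuousWithinAt L x d y).rightLim_eq

theorem continuousAt_stepLe_iff {y : ℝ} :
    ContinuousAt (stepLe L x d) y ↔ stepLt L x d y = stepLe L x d y := by
  constructor
  · intro h
    exact tendsto_nhds_unique (stepLe_tendsto_left L x d y) (h.mono_left nhdsWithin_le_nhds)
  · intro h
    rw [continuousAt_iff_continuous_left'_right']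
    refine ⟨?_, (stepLe_continuousWithinAt L x d y).mono Ioi_subset_Ici_self⟩
    have := stepLe_tendsto_left L x d y
    rwa [h] at this

theorem exists_of_not_continuousAt_stepLe {y : ℝ} (h : ¬ ContinuousAt (stepLe L x d) y) :
    ∃ i ∈ L, x i = y := by
  by_contra! hc
  exact h (continuousAt_stepLe_iff.2 (stepLe_eq_stepLt_of_forall_ne hc).symm)

theorem stepLe_isPiecewiseConstOn (L : Finset ι) (x d : ι → ℝ) (s : Set ℝ) :
    IsPiecewiseConstOn (stepLe L x d) s := by
  classical
  refine ⟨L.image x, fun a _ b _ hab h => stepLe_congr (fun i hi => ?_) fun _ _ => rfl⟩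
  refine ⟨fun hle => hle.trans hab, fun hle => ?_⟩
  by_contra! hc
  exact h _ (Finset.mem_image_of_mem x hi) ⟨hc.le, hle⟩

/-- The total jump at `y`. -/
def jumpAt (L : Finset ι) (x d : ι → ℝ) (y : ℝ) : ℝ := ∑ i ∈ L with x i = y, d i

theorem stepLe_eq_add_jumpAt (y : ℝ) : stepLe L x d y = stepLt L x d y + jumpAt L x d y :=
  stepLe_eq_add y

/-- The total variation of `stepLe`. -/
def stepVar (L : Finset ι) (x d : ι → ℝ) : ℝ :=
  ∑ y ∈ L.image x, |jumpAt L x d y|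

theorem stepLe_eq_of_forall_mem {X : Finset ℝ} (h : ∀ i ∈ L, x i ∈ X) (y : ℝ) :
    stepLe L x d y = stepLe X id (jumpAt L x d) y := by
  unfold stepLe jumpAt
  rw [← Finset.sum_fiberwise_of_maps_to (s := L.filter (x · ≤ y))
    (t := X.filter (id · ≤ y)) (g := x)]
  · refine Finset.sum_congr rfl fun z hz => Finset.sum_congr ?_ fun _ _ => rfl
    ext i
    simp only [Finset.mem_filter]
    refine ⟨fun h => ⟨h.1.1, h.2⟩, fun h => ⟨⟨h.1, ?_⟩, h.2⟩⟩
    rw [h.2]; exact (Finset.mem_filter.1 hz).2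
  · intro i hi
    rw [Finset.mem_filter] at hi ⊢
    exact ⟨h i hi.1, hi.2⟩

theorem eVariationOn_eq_zero_of_const {f : ℝ → ℝ} {s : Set ℝ} {c : ℝ} (h : ∀ z ∈ s, f z = c) :
    eVariationOn f s = 0 := by
  refine (eVariationOn.eq_of_eqOn (f' := fun _ => c) h).trans ?_
  simp [eVariationOn]

theorem eVariationOn_split (f : ℝ → ℝ) (z : ℝ) :
    eVariationOn f univ = eVariationOn f (Iic z) + eVariationOn f (Ici z) := by
  rw [← eVariationOn.union f (isGreatest_Iic) (isLeast_Ici), Iic_union_Ici]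

theorem eVariationOn_jump {f : ℝ → ℝ} {a b l r : ℝ} (hab : a < b) (h : ∀ z ∈ Ico a b, f z = l)
    (hb : f b = r) : eVariationOn f (Icc a b) = ENNReal.ofReal |r - l| := by
  wlog hlr : l ≤ r generalizing f l r
  · have h1 : eVariationOn f (Icc a b) = eVariationOn (fun z => -f z) (Icc a b) := by
      simp [eVariationOn]
    rw [h1, this (f := fun z => -f z) (l := -l) (r := -r) (fun z hz => by rw [h z hz])
      (by rw [hb]) (by linarith), ← abs_neg]
    congr 2; ring
  have hm : MonotoneOn f (Icc a b) := by
    intro y hy z hz hyz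
    rcases hz.2.eq_or_lt with rfl | hzb
    · rcases hy.2.eq_or_lt with rfl | hyb
      · exact le_rfl
      · rw [h y ⟨hy.1, hyb⟩, hb]; exact hlr
    · rw [h z ⟨hz.1, hzb⟩, h y ⟨hy.1, hyz.trans_lt hzb⟩]
  have := MonotoneOn.eVariationOn_eq hm (left_mem_Icc.2 hab.le) (right_mem_Icc.2 hab.le)
  rw [inter_self] at this
  rw [this, h a ⟨le_rfl, hab⟩, hb, abs_of_nonneg (sub_nonneg.2 hlr)]

/-- Induction on the rightmost jump `m`. A cut at a point `m'` after all other jumps separates the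
old variation on the left from the single jump on `[m', m]`. -/
theorem eVariationOn_stepLe_id (X : Finset ℝ) (j : ℝ → ℝ) :
    eVariationOn (stepLe X id j) univ = ENNReal.ofReal (∑ y ∈ X, |j y|) := by
  classical
  induction X using Finset.induction_on_max with
  | empty => 
    rw [eVariationOn_eq_zero_of_const (c := 0) fun z _ => stepLe_empty (x := id) (d := j) z]
    simp
  | insert m X hlt ih =>
    have hm : m ∉ X := fun h => lt_irrefl _ (hlt m h)
    obtain ⟨m', hm', hX⟩ : ∃ m' < m, ∀ y ∈ X, y ≤ m' := by
      rcases X.eq_empty_or_nonempty with rfl | hne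
      · exact ⟨m - 1, by linarith, by simp⟩
      · exact ⟨X.max' hne, hlt _ (X.max'_mem hne), fun y hy => X.le_max' y hy⟩
    have hins := fun y => stepLe_insert (x := id) (d := j) hm y
    have hold : ∀ y, m' ≤ y → stepLe X id j y = ∑ y ∈ X, j y := fun y hy =>
      stepLe_of_forall_le (x := id) fun z hz => (hX z hz).trans hy
    have e1 : eVariationOn (stepLe (insert m X) id j) (Iic m') =
        eVariationOn (stepLe X id j) (Iic m') := by
      refine eVariationOn.eq_of_eqOn fun y hy => ?_
      rw [hins, if_neg (by exact not_le.2 (lt_of_le_of_lt hy hm')), add_zero]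
    have e2 : eVariationOn (stepLe X id j) (Ici m') = 0 :=
      eVariationOn_eq_zero_of_const fun z hz => hold z hz
    have e3 : eVariationOn (stepLe (insert m X) id j) (Ici m) = 0 :=
      eVariationOn_eq_zero_of_const (c := ∑ y ∈ X, j y + j m) fun z hz => by
        rw [hins, hold z (hm'.le.trans hz), if_pos (by exact hz)]
    have e4 : eVariationOn (stepLe (insert m X) id j) (Icc m' m) = ENNReal.ofReal |j m| := by
      rw [eVariationOn_jump (l := ∑ y ∈ X, j y) (r := ∑ y ∈ X, j y + j m) hm']
      · rw [add_sub_cancel_left]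
      · intro z hz
        rw [hins, hold z hz.1, if_neg (by exact not_le.2 hz.2), add_zero]
      · rw [hins, hold m hm'.le, if_pos (by exact le_rfl)]
    have e5 : eVariationOn (stepLe (insert m X) id j) (Ici m') =
        eVariationOn (stepLe (insert m X) id j) (Icc m' m) +
          eVariationOn (stepLe (insert m X) id j) (Ici m) := by
      rw [← eVariationOn.union _ (isGreatest_Icc hm'.le) isLeast_Ici, Icc_union_Ici_eq_Ici hm'.le]
    rw [eVariationOn_split _ m', e2, add_zero] at ih
    rw [eVariationOn_split _ m', e1, ih, e5, e4, e3, add_zero, Finset.sum_insert hm,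
      ← ENNReal.ofReal_add (Finset.sum_nonneg fun _ _ => abs_nonneg _) (abs_nonneg _), add_comm]

theorem eVariationOn_stepLe (L : Finset ι) (x d : ι → ℝ) :
    eVariationOn (stepLe L x d) univ = ENNReal.ofReal (stepVar L x d) := by
  rw [show stepLe L x d = stepLe (L.image x) id (jumpAt L x d) from
    funext fun y => stepLe_eq_of_forall_mem (fun _ => Finset.mem_image_of_mem x) y, eVariationOn_stepLe_id, stepVar]

theorem stepVar_nonneg : 0 ≤ stepVar L x d := Finset.sum_nonneg fun _ _ => abs_nonneg _

theorem toReal_eVariationOn_stepLe (L : Finset ι) (x d : ι → ℝ) :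
    (eVariationOn (stepLe L x d) univ).toReal = stepVar L x d := by
  rw [eVariationOn_stepLe, ENNReal.toReal_ofReal stepVar_nonneg]

theorem stepVar_eq_of_image_subset {X : Finset ℝ} (h : ∀ i ∈ L, x i ∈ X) :
    stepVar L x d = ∑ y ∈ X, |jumpAt L x d y| := by
  rw [stepVar]
  refine Finset.sum_subset (fun y hy => ?_) fun y _ hy => ?_
  · obtain ⟨i, hi, rfl⟩ := Finset.mem_image.1 hy
    exact h i hi
  · have he : L.filter (x · = y) = ∅ :=
      Finset.filter_false_of_mem fun i hi he => hy (Finset.mem_image.2 ⟨i, hi, he⟩)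
    rw [jumpAt, he, Finset.sum_empty, abs_zero]

theorem stepVar_eq_of_injOn (h : ∀ i ∈ L, ∀ j ∈ L, x i = x j → i = j) :
    stepVar L x d = ∑ i ∈ L, |d i| := by
  classical
  rw [stepVar, Finset.sum_image fun i hi j hj => h i hi j hj]
  refine Finset.sum_congr rfl fun i hi => ?_
  have : L.filter (x · = x i) = {i} := by
    ext k
    simp only [Finset.mem_filter, Finset.mem_singleton]
    exact ⟨fun hk => h k hk.1 i hi hk.2, fun hk => by rw [hk]; exact ⟨hi, rfl⟩⟩
  rw [jumpAt, this, Finset.sum_singleton]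

theorem lintegral_indicator_sub_le (a b : ℝ) :
    ∫⁻ y, ‖(if a ≤ y then (1 : ℝ) else 0) - (if b ≤ y then 1 else 0)‖ₑ =
      ENNReal.ofReal |a - b| := by
  wlog hab : a ≤ b generalizing a b
  · rw [abs_sub_comm, ← this b a (le_of_not_ge hab)]
    refine lintegral_congr fun y => ?_
    rw [← enorm_neg, neg_sub]
  have : (fun y => ‖(if a ≤ y then (1 : ℝ) else 0) - (if b ≤ y then 1 else 0)‖ₑ) =
      (Ico a b).indicator 1 := by
    funext y
    by_cases h1 : a ≤ y <;> by_cases h2 : b ≤ y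
    · simp [h1, h2]
    · simp [h1, h2, not_le.1 h2]
    · exact absurd (hab.trans h2) h1
    · simp [h1, h2]
  rw [this, lintegral_indicator_one measurableSet_Ico, Real.volume_Ico, abs_sub_comm,
    abs_of_nonneg (sub_nonneg.2 hab)]

/-- Displacing one jump changes the profile, on the interval between its two positions, by the size
of the jump. -/
theorem lintegral_stepLe_sub_le (L : Finset ι) (x x' d : ι → ℝ) :
    ∫⁻ y, ‖stepLe L x d y - stepLe L x' d y‖ₑ ≤
      ∑ i ∈ L, ‖d i‖ₑ * ENNReal.ofReal |x i - x' i| := by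
  have hpt : ∀ y, ‖stepLe L x d y - stepLe L x' d y‖ₑ ≤ ∑ i ∈ L,
      ‖d i‖ₑ * ‖(if x i ≤ y then (1 : ℝ) else 0) - (if x' i ≤ y then 1 else 0)‖ₑ := by
    intro y
    have : stepLe L x d y - stepLe L x' d y = ∑ i ∈ L,
        d i * ((if x i ≤ y then (1 : ℝ) else 0) - (if x' i ≤ y then 1 else 0)) := by
      simp only [stepLe, Finset.sum_filter, mul_sub, mul_ite, mul_one, mul_zero,
        Finset.sum_sub_distrib]
    rw [this]
    refine (enorm_sum_le _ _).trans (Finset.sum_le_sum fun i _ => ?_)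
    rw [enorm_mul]
  refine (lintegral_mono hpt).trans ?_
  have hmeas : ∀ a : ℝ, Measurable fun y : ℝ => if a ≤ y then (1 : ℝ) else 0 := fun a =>
    Measurable.ite measurableSet_Ici measurable_const measurable_const
  have hmeas' : ∀ i, Measurable fun y : ℝ =>
      ‖(if x i ≤ y then (1 : ℝ) else 0) - (if x' i ≤ y then 1 else 0)‖ₑ := fun i =>
    ((hmeas _).sub (hmeas _)).enorm
  rw [lintegral_finsetSum _ fun i _ => (hmeas' i).const_mul _]
  refine Finset.sum_le_sum fun i _ => ?_
  rw [lintegral_const_mul _ (hmeas' i), lintegral_indicator_sub_le]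

end Step

theorem IsPiecewiseConstOn.measurable {g : ℝ → ℝ} (h : IsPiecewiseConstOn g univ) :
    Measurable g := by
  obtain ⟨D, hD⟩ := h
  intro s _
  have hopen : IsOpen (g ⁻¹' s ∩ (D : Set ℝ)ᶜ) := by
    rw [isOpen_iff_mem_nhds]
    rintro y ⟨hy, hyD⟩
    obtain ⟨ε, hε, hball⟩ := Metric.isOpen_iff.1 D.finite_toSet.isClosed.isOpen_compl y hyD
    refine Filter.mem_of_superset (Metric.ball_mem_nhds y hε) fun z hz => ⟨?_, hball hz⟩
    have hIcc : uIcc y z ⊆ Metric.ball y ε :=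
      (convex_ball y ε).ordConnected.uIcc_subset (Metric.mem_ball_self hε) hz
    have : g y = g z := by
      rcases le_total y z with hyz | hyz
      · exact hD y trivial z trivial hyz fun d hd hd' =>
          hball (hIcc (by rw [uIcc_of_le hyz]; exact hd')) hd
      · exact (hD z trivial y trivial hyz fun d hd hd' =>
          hball (hIcc (by rw [uIcc_of_ge hyz]; exact hd')) hd).symm
    rw [mem_preimage, ← this]; exact hy
  have : g ⁻¹' s = (g ⁻¹' s ∩ (D : Set ℝ)ᶜ) ∪ (g ⁻¹' s ∩ D) := by
    rw [← inter_union_distrib_left, compl_union_self, inter_univ]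
  rw [this]
  exact hopen.measurableSet.union (D.finite_toSet.subset inter_subset_right).measurableSet

namespace LWRModel

variable {P : LWRModel} {ν : ℕ} {ι : Type*}

theorem chord_check_hat {u : ℝ} (hlt : P.check u < P.hat u) : P.chord (P.check u) (P.hat u) = u := by
  have h1 := P.chord_mul hlt.ne
  rw [flux_check, flux_hat] at h1
  have h2 : P.hat u - P.check u ≠ 0 := sub_ne_zero.2 hlt.ne'
  exact mul_right_cancel₀ h2 (by linarith)

/-! ### Fronts meeting at a point -/

/-- The fronts `i ∈ G`, of speeds `-x i`, are, in the order of decreasing speeds, the fronts of a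
profile with leftmost state `a`. -/
def Chain (P : LWRModel) (ν : ℕ) (G : Finset ι) (x d : ι → ℝ) (a : ℝ) : Prop :=
  ∀ i ∈ G, P.Front ν (a + stepLt G x d (x i)) (a + stepLe G x d (x i)) (-x i)

theorem Chain.of_insert_max [DecidableEq ι] {G : Finset ι} {x d : ι → ℝ} {a : ℝ} {m : ι}
    (hm : m ∉ G) (hlt : ∀ i ∈ G, x i < x m) (h : P.Chain ν (insert m G) x d a) :
    P.Chain ν G x d a ∧
      P.Front ν (a + ∑ i ∈ G, d i) (a + ∑ i ∈ G, d i + d m) (-x m) := by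
  constructor
  · intro i hi
    have := h i (Finset.mem_insert_of_mem hi)
    rwa [stepLe_insert hm, stepLt_insert hm, if_neg (not_lt.2 (hlt i hi).le),
      if_neg (not_le.2 (hlt i hi)), add_zero, add_zero] at this
  · have := h m (Finset.mem_insert_self _ _)
    rwa [stepLe_insert hm, stepLt_insert hm, if_neg (lt_irrefl _), if_pos le_rfl,
      stepLt_of_forall_lt hlt, stepLe_of_forall_le fun i hi => (hlt i hi).le, add_zero,
      ← add_assoc] at this

theorem Chain.of_insert_min [DecidableEq ι] {G : Finset ι} {x d : ι → ℝ} {a : ℝ} {m : ι}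
    (hm : m ∉ G) (hlt : ∀ i ∈ G, x m < x i) (h : P.Chain ν (insert m G) x d a) :
    P.Chain ν G x d (a + d m) ∧ P.Front ν a (a + d m) (-x m) := by
  constructor
  · intro i hi
    have := h i (Finset.mem_insert_of_mem hi)
    rw [stepLe_insert hm, stepLt_insert hm, if_pos (hlt i hi), if_pos (hlt i hi).le] at this
    convert this using 1 <;> ring
  · have := h m (Finset.mem_insert_self _ _)
    rwa [stepLe_insert hm, stepLt_insert hm, if_neg (lt_irrefl _), if_pos le_rfl,
      stepLt_of_forall_ge fun i hi => (hlt i hi).le, stepLe_of_forall_gt hlt, add_zero,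
      add_zero, zero_add] at this

theorem lt_of_le_of_injOn [DecidableEq ι] {G : Finset ι} {x : ι → ℝ} {m : ι} (hm : m ∉ G)
    (hinj : Set.InjOn x (insert m G : Finset ι)) {i : ι} (hi : i ∈ G) : x i ≠ x m := fun he =>
  hm (hinj (Finset.mem_insert_of_mem hi) (Finset.mem_insert_self _ _) he ▸ hi)

/-- Append the fronts from left to right, hence in order of decreasing speed. A final jump down
reaches only the adjacent node, so it cannot pass below `a` from a higher state. Starting at `a`
itself, it would have the speed of the cell just below `a`; the second clause, carried along for
this purpose, bounds all earlier speeds by that one, although they must be larger. Two consecutive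
jumps down cannot meet, because the lower one is faster. -/
theorem Chain.le_aux (G : Finset ι) {x d : ι → ℝ} {a : ℝ} :
    Set.InjOn x G → P.Chain ν G x d a →
    (2 ≤ G.card → a ≤ a + ∑ i ∈ G, d i) ∧
    ∀ c ∈ P.densityGrid ν, c < a → (∀ z ∈ P.densityGrid ν, ¬ (c < z ∧ z < a)) →
      ∀ i ∈ G, -x i ≤ P.chord c a := by
  classical
  induction G using Finset.induction_on_max_value x with
  | empty => exact fun _ _ => ⟨by simp, by simp⟩
  | insert m G hm hle ih =>
    intro hinj h
    have hlt : ∀ i ∈ G, x i < x m := fun i hi => lt_of_le_of_ne (hle i hi)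
      (lt_of_le_of_injOn hm hinj hi)
    obtain ⟨hG, hf⟩ := h.of_insert_max hm hlt
    obtain ⟨ih1, ih2⟩ := ih (hinj.mono (Finset.coe_subset.2 (Finset.subset_insert _ _))) hG
    rw [Finset.sum_insert hm, Finset.card_insert_of_notMem hm]
    rcases G.eq_empty_or_nonempty with rfl | ⟨k, hk⟩
    · refine ⟨by simp, fun c hc hca hadj i hi => ?_⟩
      obtain rfl : i = m := by simpa using hi
      simp only [Finset.sum_empty, add_zero] at hf
      rw [hf.speed]
      rcases lt_or_gt_of_ne hf.ne with hab | hab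
      · exact (P.chord_lt_left (P.grid_subset ν hc).1 hca hab
          (P.grid_subset ν hf.right_mem).2).le
      · have h1 := hf.adjacent hab
        have : a + d i = c := by
          rcases lt_trichotomy (a + d i) c with h2 | h2 | h2
          · exact absurd ⟨h2, hca⟩ (h1 c hc)
          · exact h2
          · exact absurd ⟨h2, hab⟩ (hadj _ hf.right_mem)
        rw [this, chord_comm]
    · refine ⟨fun _ => ?_, fun c hc hca hadj i hi => ?_⟩
      · rcases lt_or_gt_of_ne hf.ne with hab | hab
        · by_cases h2 : 2 ≤ G.card
          · linarith [ih1 h2]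
          have hcard : G.card = 1 := le_antisymm (by omega) (Finset.card_pos.2 ⟨k, hk⟩)
          obtain ⟨k', rfl⟩ := Finset.card_eq_one.1 hcard
          have hk' := hG k' (by simp)
          simp only [stepLt, stepLe, Finset.filter_singleton, lt_irrefl, if_false, le_refl,
            if_true, Finset.sum_empty, Finset.sum_singleton, add_zero] at hk' hab hf ⊢
          rcases lt_or_gt_of_ne hk'.ne with h3 | h3
          · linarith
          · by_contra! hcon
            exact hk'.adjacent h3 _ hf.right_mem ⟨hab, by linarith⟩
        · by_cases hcard : 2 ≤ G.card
          · rcases (ih1 hcard).eq_or_lt with h3 | h3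
            · rw [← h3] at hf hab
              have := ih2 _ hf.right_mem hab (hf.adjacent hab) k hk
              rw [chord_comm, ← hf.speed] at this
              linarith [hlt k hk]
            · by_contra! hcon
              have ha : a ∈ P.densityGrid ν := by
                obtain ⟨j, hj, hmin⟩ := Finset.exists_min_image G x ⟨k, hk⟩
                have := (hG j hj).left_mem
                rwa [stepLt_of_forall_ge fun i hi => hmin i hi, add_zero] at this
              exact hf.adjacent hab a ha ⟨by linarith, h3⟩
          · have hcard : G.card = 1 := le_antisymm (by omega) (Finset.card_pos.2 ⟨k, hk⟩)
            obtain ⟨k', rfl⟩ := Finset.card_eq_one.1 hcard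
            have hk' := hG k' (by simp)
            have hlt' := hlt k' (by simp)
            simp only [stepLt, stepLe, Finset.filter_singleton, lt_irrefl, if_false, le_refl,
              if_true, Finset.sum_empty, Finset.sum_singleton, add_zero] at hk' hab hf ⊢
            by_contra! hcon
            rcases lt_or_gt_of_ne hk'.ne with h3 | h3
            · exact hf.adjacent hab a hk'.left_mem ⟨by linarith, h3⟩
            · have := P.chord_lt_left (P.grid_subset ν hf.right_mem).1 hab h3
                (P.grid_subset ν hk'.left_mem).2
              rw [chord_comm, ← hk'.speed, chord_comm, ← hf.speed] at this
              linarith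
      · rcases Finset.mem_insert.1 hi with rfl | hi
        · have := ih2 c hc hca hadj k hk
          linarith [hlt k hk]
        · exact ih2 c hc hca hadj i hi

/-- When at least two classical fronts meet, the left state is at most the right state. -/
theorem Chain.le {G : Finset ι} {x d : ι → ℝ} {a : ℝ} (hinj : Set.InjOn x G)
    (h : P.Chain ν G x d a) (hG : 2 ≤ G.card) : a ≤ a + ∑ i ∈ G, d i :=
  (Chain.le_aux G hinj h).1 hG

/-- The excess `f - φ_u` changes by `(s - u)(b - a)` across a front, so a fast jump up from inside
`[ρ̌_u, ρ̂_u]` stays strictly inside, and beyond `ρ̂_u` chords are too slow. A jump down cannot step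
over the node `ρ̌_u`. If it lands there, the last clause prevents a slower jump from going further
down. -/
theorem Front.fast {u a b s : ℝ} (hu : u ∈ P.speedGrid ν) (hlt : P.check u < P.hat u)
    (h : P.Front ν a b s) (hs : u < s) (ha : P.check u ≤ a) (hab : a = P.check u → a < b) :
    P.check u ≤ b ∧ b < P.hat u ∧
      (b = P.check u → ∀ c ∈ P.densityGrid ν, c < P.check u → s < P.chord c (P.check u)) := by
  have h0 := (P.speedGrid_subset ν hu).1
  have ha' := P.grid_subset ν h.left_mem
  have hb' := P.grid_subset ν h.right_mem
  have hch := chord_check_hat hlt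
  have hd := flux_sub_mul h.ne h.speed u
  rcases lt_or_gt_of_ne h.ne with hlt' | hlt'
  · have hah : a < P.hat u := by
      by_contra! hcon
      have := P.chord_lt_chord (P.check_mem u).1 hlt hcon hlt' hb'.2
      rw [← h.speed, hch] at this
      linarith
    have h1 := (P.le_flux_iff h0 ha').2 ⟨ha, hah.le⟩
    have h2 := (P.lt_flux_iff h0 hb').1 (by nlinarith)
    exact ⟨h2.1.le, h2.2, fun he => absurd he h2.1.ne'⟩
  · have hca : P.check u < a := lt_of_le_of_ne ha fun he => absurd (hab he.symm) hlt'.not_gt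
    have hcb : P.check u ≤ b := by
      by_contra! hcon
      exact h.adjacent hlt' _ (P.check_mem_grid hu) ⟨hcon, hca⟩
    have hah : a < P.hat u := by
      by_contra! hcon
      rcases le_or_gt (P.hat u) b with hb | hb
      · have := P.chord_lt_chord (P.check_mem u).1 hlt hb hlt' ha'.2
        rw [chord_comm, ← h.speed, hch] at this
        linarith
      · have hea : a = P.hat u := by
          refine le_antisymm ?_ hcon
          by_contra! hc2
          exact h.adjacent hlt' _ (P.hat_mem_grid hu) ⟨hb, hc2⟩
        have h1 := (P.le_flux_iff h0 hb').2 ⟨hcb, hb.le⟩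
        have h2 := P.flux_hat u
        rw [← hea] at h2
        nlinarith
    refine ⟨hcb, hlt'.trans hah, fun he c hc hcc => ?_⟩
    rw [h.speed, he, chord_comm]
    exact P.chord_lt_left (P.grid_subset ν hc).1 hcc hca ha'.2

/-- Mirror image of `Front.fast`, read from the right state to the left state, with `ρ̂_u` in the
role of `ρ̌_u`. -/
theorem Front.slow {u a b s : ℝ} (hu : u ∈ P.speedGrid ν) (hlt : P.check u < P.hat u)
    (h : P.Front ν a b s) (hs : s < u) (hb : b ≤ P.hat u) (hab : b = P.hat u → a < b) :
    P.check u < a ∧ a ≤ P.hat u ∧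
      (a = P.hat u → ∀ c ∈ P.densityGrid ν, P.hat u < c → P.chord (P.hat u) c < s) := by
  have h0 := (P.speedGrid_subset ν hu).1
  have ha' := P.grid_subset ν h.left_mem
  have hb' := P.grid_subset ν h.right_mem
  have hch := chord_check_hat hlt
  have hd := flux_sub_mul h.ne h.speed u
  rcases lt_or_gt_of_ne h.ne with hlt' | hlt'
  · have hah : P.check u < b := by
      by_contra! hcon
      have := P.chord_lt_chord ha'.1 hlt' hcon hlt (P.hat_mem u).2
      rw [← h.speed, hch] at this
      linarith
    have h1 := (P.le_flux_iff h0 hb').2 ⟨hah.le, hb⟩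
    have h2 := (P.lt_flux_iff h0 ha').1 (by nlinarith)
    exact ⟨h2.1, h2.2.le, fun he => absurd he h2.2.ne⟩
  · have hca : b < P.hat u := lt_of_le_of_ne hb fun he => absurd (hab he) hlt'.not_gt
    have hcb : a ≤ P.hat u := by
      by_contra! hcon
      exact h.adjacent hlt' _ (P.hat_mem_grid hu) ⟨hca, hcon⟩
    have hah : P.check u < b := by
      by_contra! hcon
      rcases le_or_gt a (P.check u) with hb2 | hb2
      · have := P.chord_lt_chord hb'.1 hlt' hb2 hlt (P.hat_mem u).2
        rw [P.chord_comm b, ← h.speed, hch] at this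
        linarith
      · have hea : b = P.check u := by
          refine le_antisymm hcon ?_
          by_contra! hc2
          exact h.adjacent hlt' _ (P.check_mem_grid hu) ⟨hc2, hb2⟩
        have h1 := (P.le_flux_iff h0 ha').2 ⟨hb2.le, hcb⟩
        have h2 := P.flux_check u
        rw [← hea] at h2
        nlinarith
    refine ⟨hah.trans hlt', hcb, fun he c hc hcc => ?_⟩
    rw [h.speed, he, P.chord_comm _ b]
    exact P.chord_lt_left hb'.1 hca hcc (P.grid_subset ν hc).2

/-- The range found in `Front.fast` is propagated from left to right. When an intermediate state
equals `ρ̌_u`, the retained speed bound forces the next, slower front to jump up. -/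
theorem Chain.fast_aux {u : ℝ} (hu : u ∈ P.speedGrid ν) (hlt : P.check u < P.hat u)
    (G : Finset ι) {x d : ι → ℝ} {a : ℝ} (ha : P.check u < a) :
    Set.InjOn x G → P.Chain ν G x d a → (∀ i ∈ G, u < -x i) → G.Nonempty →
    P.check u ≤ a + ∑ i ∈ G, d i ∧ a + ∑ i ∈ G, d i < P.hat u ∧
      (a + ∑ i ∈ G, d i = P.check u →
        ∃ i ∈ G, ∀ c ∈ P.densityGrid ν, c < P.check u → -x i < P.chord c (P.check u)) := by
  classical
  induction G using Finset.induction_on_max_value x with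
  | empty => exact fun _ _ _ h => absurd rfl h.ne_empty
  | insert m G hm hle ih =>
    intro hinj h hs _
    have hlt' : ∀ i ∈ G, x i < x m := fun i hi => lt_of_le_of_ne (hle i hi)
      (lt_of_le_of_injOn hm hinj hi)
    obtain ⟨hG, hf⟩ := h.of_insert_max hm hlt'
    have hsm := hs m (Finset.mem_insert_self _ _)
    rw [Finset.sum_insert hm, add_comm (d m), ← add_assoc]
    have key : P.check u ≤ a + ∑ i ∈ G, d i ∧ (a + ∑ i ∈ G, d i = P.check u →
        a + ∑ i ∈ G, d i < a + ∑ i ∈ G, d i + d m) := by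
      rcases G.eq_empty_or_nonempty with rfl | hne
      · simp only [Finset.sum_empty, add_zero]
        exact ⟨ha.le, fun he => absurd he ha.ne'⟩
      · obtain ⟨i1, -, i3⟩ := ih (hinj.mono (Finset.coe_subset.2 (Finset.subset_insert _ _))) hG
          (fun i hi => hs i (Finset.mem_insert_of_mem hi)) hne
        refine ⟨i1, fun he => ?_⟩
        obtain ⟨k, hk, hk'⟩ := i3 he
        by_contra! hcon
        have hlt2 := lt_of_le_of_ne hcon hf.ne.symm
        have := hk' _ hf.right_mem (he ▸ hlt2)
        rw [← he, chord_comm, ← hf.speed] at this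
        linarith [hlt' k hk]
    obtain ⟨r1, r2, r3⟩ := hf.fast hu hlt hsm key.1 key.2
    exact ⟨r1, r2, fun he => ⟨m, Finset.mem_insert_self _ _, r3 he⟩⟩

/-- The range found in `Front.slow` is propagated from right to left, which is why the leftmost
front is removed and `a` is generalized. -/
theorem Chain.slow_aux {u : ℝ} (hu : u ∈ P.speedGrid ν) (hlt : P.check u < P.hat u)
    (G : Finset ι) {x d : ι → ℝ} :
    Set.InjOn x G → ∀ {a : ℝ}, a + ∑ i ∈ G, d i < P.hat u → P.Chain ν G x d a →
    (∀ i ∈ G, -x i < u) → G.Nonempty →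
    P.check u < a ∧ a ≤ P.hat u ∧
      (a = P.hat u →
        ∃ i ∈ G, ∀ c ∈ P.densityGrid ν, P.hat u < c → P.chord (P.hat u) c < -x i) := by
  classical
  induction G using Finset.induction_on_min_value x with
  | empty => exact fun _ _ _ _ _ h => absurd rfl h.ne_empty
  | insert m G hm hle ih =>
    intro hinj a he h hs _
    have hlt' : ∀ i ∈ G, x m < x i := fun i hi => lt_of_le_of_ne (hle i hi)
      (lt_of_le_of_injOn hm hinj hi).symm
    obtain ⟨hG, hf⟩ := h.of_insert_min hm hlt'
    have hsm := hs m (Finset.mem_insert_self _ _)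
    rw [Finset.sum_insert hm, ← add_assoc] at he
    have key : a + d m ≤ P.hat u ∧ (a + d m = P.hat u → a < a + d m) := by
      rcases G.eq_empty_or_nonempty with rfl | hne
      · simp only [Finset.sum_empty, add_zero] at he
        exact ⟨he.le, fun he' => absurd he' he.ne⟩
      · obtain ⟨-, i1, i3⟩ := ih (hinj.mono (Finset.coe_subset.2 (Finset.subset_insert _ _))) he hG
          (fun i hi => hs i (Finset.mem_insert_of_mem hi)) hne
        refine ⟨i1, fun he => ?_⟩
        obtain ⟨k, hk, hk'⟩ := i3 he
        by_contra! hcon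
        have hlt2 := lt_of_le_of_ne hcon hf.ne.symm
        have := hk' _ hf.left_mem (he ▸ hlt2)
        rw [← he, chord_comm, ← hf.speed] at this
        linarith [hlt' k hk]
    obtain ⟨r1, r2, r3⟩ := hf.slow hu hlt hsm key.1 key.2
    exact ⟨r1, r2, fun he => ⟨m, Finset.mem_insert_self _ _, r3 he⟩⟩

/-- Fronts which hit a vehicle enforcing the constraint from the left come from a state which is at
most `ρ̌_u`. -/
theorem Chain.le_check {u : ℝ} (hu : u ∈ P.speedGrid ν) (hlt : P.check u < P.hat u)
    {G : Finset ι} {x d : ι → ℝ} {a : ℝ} (hinj : Set.InjOn x G) (h : P.Chain ν G x d a)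
    (hs : ∀ i ∈ G, u < -x i) (hne : G.Nonempty) (he : a + ∑ i ∈ G, d i = P.hat u) :
    a ≤ P.check u := by
  by_contra! hc
  exact (Chain.fast_aux hu hlt G hc hinj h hs hne).2.1.ne he

/-- Fronts which are hit by a vehicle enforcing the constraint lead to a state which is at least
`ρ̂_u`. -/
theorem Chain.hat_le {u : ℝ} (hu : u ∈ P.speedGrid ν) (hlt : P.check u < P.hat u)
    {G : Finset ι} {x d : ι → ℝ} (hinj : Set.InjOn x G) (h : P.Chain ν G x d (P.check u))
    (hs : ∀ i ∈ G, -x i < u) (hne : G.Nonempty) : P.hat u ≤ P.check u + ∑ i ∈ G, d i := by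
  by_contra! hc
  exact absurd (Chain.slow_aux hu hlt G hinj hc h hs hne).1 (lt_irrefl _)

end LWRModel

/-! ### Configurations of fronts -/

/-- The position at time `t` on the line with slope `i.1` and intercept `i.2`. -/
def pos (i : ℝ × ℝ) (t : ℝ) : ℝ := i.1 * t + i.2

theorem pos_eq_add (i : ℝ × ℝ) (t s : ℝ) : pos i s = pos i t + i.1 * (s - t) := by
  unfold pos; ring

theorem eq_of_pos_eq {i j : ℝ × ℝ} {t : ℝ} (h : pos i t = pos j t) (h1 : i.1 = j.1) : i = j := by
  refine Prod.ext h1 ?_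
  unfold pos at h
  rw [h1] at h
  linarith

theorem continuous_pos (i : ℝ × ℝ) : Continuous (pos i) := by
  unfold pos; fun_prop

theorem pos_lt_of_not_meet {i j : ℝ × ℝ} {s t : ℝ}
    (h : ∀ τ ∈ uIcc s t, pos i τ ≠ pos j τ) (hs : pos i s < pos j s) : pos i t < pos j t := by
  by_contra! hc
  have hcont : ContinuousOn (fun τ => pos j τ - pos i τ) (uIcc s t) :=
    ((continuous_pos j).sub (continuous_pos i)).continuousOn
  have hz : (0 : ℝ) ∈ uIcc (pos j s - pos i s) (pos j t - pos i t) :=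
    mem_uIcc_of_ge (by linarith) (by linarith)
  obtain ⟨τ, hτ, h0⟩ := intermediate_value_uIcc hcont hz
  exact h τ hτ (by simp only at h0; linarith)

/-- Just before `t₁` lines are ordered by their positions at `t₁`, and among those which meet there
the faster ones are further left. -/
theorem pos_lt_iff_before {i j : ℝ × ℝ} {t t₁ : ℝ} (ht : t < t₁)
    (h : ∀ s ∈ Ico t t₁, pos j s = pos i s → j = i) :
    pos j t < pos i t ↔ pos j t₁ < pos i t₁ ∨ (pos j t₁ = pos i t₁ ∧ -j.1 < -i.1) := by
  have hji := pos_eq_add j t₁ t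
  have hii := pos_eq_add i t₁ t
  have aux : ∀ i j : ℝ × ℝ, (∀ s ∈ Ico t t₁, pos j s = pos i s → j = i) →
      pos j t₁ < pos i t₁ → pos j t < pos i t := by
    intro i j h h1
    refine pos_lt_of_not_meet (s := t₁) (fun τ hτ he => ?_) h1
    rw [uIcc_of_ge ht.le] at hτ
    rcases hτ.2.eq_or_lt with rfl | h2
    · exact h1.ne he
    · rw [h τ ⟨hτ.1, h2⟩ he] at h1
      exact lt_irrefl _ h1
  constructor
  · intro hlt
    rcases lt_trichotomy (pos j t₁) (pos i t₁) with h1 | h1 | h1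
    · exact Or.inl h1
    · refine Or.inr ⟨h1, ?_⟩
      by_contra! hc
      nlinarith
    · exact absurd (aux j i (fun s hs he => (h s hs he.symm).symm) h1) hlt.not_gt
  · rintro (h1 | ⟨h1, h2⟩)
    · exact aux i j h h1
    · nlinarith

theorem pos_lt_iff_after {i j : ℝ × ℝ} {t t₁ : ℝ} (ht : t₁ < t)
    (h : ∀ s ∈ Ioc t₁ t, pos j s = pos i s → j = i) :
    pos j t < pos i t ↔ pos j t₁ < pos i t₁ ∨ (pos j t₁ = pos i t₁ ∧ j.1 < i.1) := by
  have hji := pos_eq_add j t₁ t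
  have hii := pos_eq_add i t₁ t
  have aux : ∀ i j : ℝ × ℝ, (∀ s ∈ Ioc t₁ t, pos j s = pos i s → j = i) →
      pos j t₁ < pos i t₁ → pos j t < pos i t := by
    intro i j h h1
    refine pos_lt_of_not_meet (s := t₁) (fun τ hτ he => ?_) h1
    rw [uIcc_of_le ht.le] at hτ
    rcases hτ.1.eq_or_lt with rfl | h2
    · exact h1.ne he
    · rw [h τ ⟨h2, hτ.2⟩ he] at h1
      exact lt_irrefl _ h1
  constructor
  · intro hlt
    rcases lt_trichotomy (pos j t₁) (pos i t₁) with h1 | h1 | h1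
    · exact Or.inl h1
    · refine Or.inr ⟨h1, ?_⟩
      by_contra! hc
      nlinarith
    · exact absurd (aux j i (fun s hs he => (h s hs he.symm).symm) h1) hlt.not_gt
  · rintro (h1 | ⟨h1, h2⟩)
    · exact aux i j h h1
    · nlinarith

/-- A profile made of finitely many straight fronts: the lines `i ∈ L` carry the jumps `d i`, the
vehicle follows the line `c`. -/
structure FrontConfig where
  L : Finset (ℝ × ℝ)
  d : ℝ × ℝ → ℝ
  c : ℝ × ℝ

namespace FrontConfig

variable (C : FrontConfig)

/-- The density. -/
def rho (t : ℝ) : ℝ → ℝ := stepLe C.L (fun i => pos i t) C.d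

/-- The left limits of the density. -/
def left (t : ℝ) : ℝ → ℝ := stepLt C.L (fun i => pos i t) C.d

/-- The position of the vehicle. -/
def y (t : ℝ) : ℝ := pos C.c t

/-- The lines through `(t, z)`. -/
def through (t z : ℝ) : Finset (ℝ × ℝ) := C.L.filter fun i => pos i t = z

/-- The set of lines, with that of the vehicle. -/
def lines : Finset (ℝ × ℝ) := insert C.c C.L

theorem c_mem : C.c ∈ C.lines := Finset.mem_insert_self _ _

variable {C} in
theorem mem_lines {i : ℝ × ℝ} (hi : i ∈ C.L) : i ∈ C.lines := Finset.mem_insert_of_mem hi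

variable {C} in
theorem mem_through {t z : ℝ} {i : ℝ × ℝ} : i ∈ C.through t z ↔ i ∈ C.L ∧ pos i t = z :=
  Finset.mem_filter

theorem injOn_through (t z : ℝ) : Set.InjOn Prod.fst (C.through t z : Set (ℝ × ℝ)) :=
  fun _ hi _ hj h => eq_of_pos_eq
    ((mem_through.1 hi).2.trans (mem_through.1 hj).2.symm) h

/-- The lines do not meet at time `t`. -/
def Separated (t : ℝ) : Prop := ∀ i ∈ C.lines, ∀ j ∈ C.lines, pos i t = pos j t → i = j

theorem rho_eq (t z : ℝ) : C.rho t z = C.left t z + ∑ i ∈ C.through t z, C.d i := stepLe_eq_add z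

variable {C}

theorem through_eq_singleton {t : ℝ} (h : C.Separated t) {i : ℝ × ℝ} (hi : i ∈ C.L) :
    C.through t (pos i t) = {i} := by
  ext j
  rw [mem_through, Finset.mem_singleton]
  exact ⟨fun hj => h j (mem_lines hj.1) i (mem_lines hi) hj.2, fun hj => by rw [hj]; exact ⟨hi, rfl⟩⟩

theorem through_eq_empty {t : ℝ} {z : ℝ} (h : ∀ i ∈ C.L, pos i t ≠ z) :
    C.through t z = ∅ := Finset.filter_false_of_mem h

/-- The states on both sides of a line before a meeting are expressed through the data of the
meeting point alone. Summing the jumps in the order of `-speed` reproduces the spatial order. -/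
theorem left_before {t t₁ : ℝ} (ht : t < t₁) (h : ∀ s ∈ Ico t t₁, C.Separated s)
    {i : ℝ × ℝ} (hi : i ∈ C.lines) :
    C.left t (pos i t) = C.left t₁ (pos i t₁) +
        stepLt (C.through t₁ (pos i t₁)) (fun j => -j.1) C.d (-i.1) ∧
      C.rho t (pos i t) = C.left t₁ (pos i t₁) +
        stepLe (C.through t₁ (pos i t₁)) (fun j => -j.1) C.d (-i.1) := by
  have hord : ∀ j ∈ C.L, (pos j t < pos i t ↔
      pos j t₁ < pos i t₁ ∨ (pos j t₁ = pos i t₁ ∧ -j.1 < -i.1)) := fun j hj =>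
    pos_lt_iff_before ht fun s hs he => h s hs j (mem_lines hj) i hi he
  have hord' : ∀ j ∈ C.L, (pos j t ≤ pos i t ↔
      pos j t₁ < pos i t₁ ∨ (pos j t₁ = pos i t₁ ∧ -j.1 ≤ -i.1)) := fun j hj => by
    have := pos_lt_iff_before ht (i := j) (j := i)
      fun s hs he => h s hs i hi j (mem_lines hj) he
    rw [← not_lt, this]
    constructor
    · intro h'
      push Not at h'
      rcases h'.1.eq_or_lt with h1 | h1
      · exact Or.inr ⟨h1, h'.2 h1.symm⟩
      · exact Or.inl h1
    · rintro (h1 | ⟨h1, h2⟩) (h3 | ⟨h3, h4⟩) <;> linarith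
  have hdisj : ∀ p : ℝ × ℝ → Prop, [DecidablePred p] →
      Disjoint (C.L.filter fun j => pos j t₁ < pos i t₁)
        (C.L.filter fun j => pos j t₁ = pos i t₁ ∧ p j) := fun p _ => by
    rw [Finset.disjoint_filter]
    exact fun j _ h1 h2 => h1.ne h2.1
  constructor
  · unfold left stepLt through
    rw [Finset.filter_filter, ← Finset.sum_union (hdisj _), ← Finset.filter_or,
      Finset.filter_congr hord]
  · unfold left rho stepLt stepLe through
    rw [Finset.filter_filter, ← Finset.sum_union (hdisj _), ← Finset.filter_or,
      Finset.filter_congr hord']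

/-- After the meeting the order is by increasing speed, as in a Riemann fan. -/
theorem left_after {t t₁ : ℝ} (ht : t₁ < t) (h : ∀ s ∈ Ioc t₁ t, C.Separated s)
    {i : ℝ × ℝ} (hi : i ∈ C.lines) :
    C.left t (pos i t) = C.left t₁ (pos i t₁) +
        stepLt (C.through t₁ (pos i t₁)) Prod.fst C.d i.1 ∧
      C.rho t (pos i t) = C.left t₁ (pos i t₁) +
        stepLe (C.through t₁ (pos i t₁)) Prod.fst C.d i.1 := by
  have hord : ∀ j ∈ C.L, (pos j t < pos i t ↔
      pos j t₁ < pos i t₁ ∨ (pos j t₁ = pos i t₁ ∧ j.1 < i.1)) := fun j hj =>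
    pos_lt_iff_after ht fun s hs he => h s hs j (mem_lines hj) i hi he
  have hord' : ∀ j ∈ C.L, (pos j t ≤ pos i t ↔
      pos j t₁ < pos i t₁ ∨ (pos j t₁ = pos i t₁ ∧ j.1 ≤ i.1)) := fun j hj => by
    have := pos_lt_iff_after ht (i := j) (j := i)
      fun s hs he => h s hs i hi j (mem_lines hj) he
    rw [← not_lt, this]
    constructor
    · intro h'
      push Not at h'
      rcases h'.1.eq_or_lt with h1 | h1
      · exact Or.inr ⟨h1, h'.2 h1.symm⟩
      · exact Or.inl h1
    · rintro (h1 | ⟨h1, h2⟩) (h3 | ⟨h3, h4⟩) <;> linarith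
  have hdisj : ∀ p : ℝ × ℝ → Prop, [DecidablePred p] →
      Disjoint (C.L.filter fun j => pos j t₁ < pos i t₁)
        (C.L.filter fun j => pos j t₁ = pos i t₁ ∧ p j) := fun p _ => by
    rw [Finset.disjoint_filter]
    exact fun j _ h1 h2 => h1.ne h2.1
  constructor
  · unfold left stepLt through
    rw [Finset.filter_filter, ← Finset.sum_union (hdisj _), ← Finset.filter_or,
      Finset.filter_congr hord]
  · unfold left rho stepLt stepLe through
    rw [Finset.filter_filter, ← Finset.sum_union (hdisj _), ← Finset.filter_or,
      Finset.filter_congr hord']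

/-- The density right after time `t`. -/
theorem exists_local (C : FrontConfig) (t : ℝ) (X : Finset ℝ) (hX : ∀ i ∈ C.L, pos i t ∈ X) :
    ∃ r > 0, ∀ᶠ s in 𝓝[>] t, ∀ x,
      (∀ z ∈ X, |x - z| < r → C.rho s x = C.left t z +
        stepLe (C.through t z) Prod.fst C.d ((x - z) / (s - t)) ∧
        C.rho t x = if x < z then C.left t z else C.rho t z) ∧
      ((∀ z ∈ X, r ≤ |x - z|) → C.rho s x = C.rho t x) := by
  classical
  -- The points of `X` are at least `2r` apart and, for `s` close to `t`, every line has moved by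
  -- less than `r`. Within distance `r` of `z` only the lines through `z` are then relevant.
  obtain ⟨r, hr, hsep⟩ : ∃ r > 0, ∀ z ∈ X, ∀ z' ∈ X, z ≠ z' → 2 * r ≤ |z - z'| := by
    set Y := ((X ×ˢ X).filter fun q => q.1 ≠ q.2).image fun q => |q.1 - q.2| with hY
    rcases Y.eq_empty_or_nonempty with h | h
    · refine ⟨1, one_pos, fun z hz z' hz' hne => ?_⟩
      have : |z - z'| ∈ Y := Finset.mem_image.2 ⟨(z, z'), by simp [hz, hz', hne], rfl⟩
      simp [h] at this
    · refine ⟨Y.min' h / 2, ?_, fun z hz z' hz' hne => ?_⟩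
      · obtain ⟨q, hq, hq'⟩ := Finset.mem_image.1 (Y.min'_mem h)
        rw [← hq']
        exact half_pos (abs_pos.2 (sub_ne_zero.2 (Finset.mem_filter.1 hq).2))
      · have : |z - z'| ∈ Y := Finset.mem_image.2 ⟨(z, z'), by simp [hz, hz', hne], rfl⟩
        have := Y.min'_le _ this
        linarith
  refine ⟨r, hr, ?_⟩
  have hev : ∀ᶠ s in 𝓝[>] t, ∀ i ∈ C.L, |i.1 * (s - t)| < r := by
    rw [Filter.eventually_all_finset]
    intro i _
    have : Tendsto (fun s => |i.1 * (s - t)|) (𝓝[>] t) (𝓝 |i.1 * (t - t)|) :=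
      ((by fun_prop : Continuous fun s => |i.1 * (s - t)|).tendsto t).mono_left nhdsWithin_le_nhds
    rw [sub_self, mul_zero, abs_zero] at this
    exact this.eventually_lt_const hr
  filter_upwards [hev, self_mem_nhdsWithin] with s hs hts x
  have hts : 0 < s - t := sub_pos.2 hts
  refine ⟨fun z hz hxz => ⟨?_, ?_⟩, fun hfar => ?_⟩
  · have hord : ∀ i ∈ C.L, (pos i s ≤ x ↔ pos i t < z ∨ (pos i t = z ∧ i.1 ≤ (x - z) / (s - t))) := by
      intro i hi
      have h1 := abs_lt.1 (hs i hi)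
      have h2 := pos_eq_add i t s
      have h3 := abs_lt.1 hxz
      rcases lt_trichotomy (pos i t) z with h | h | h
      · have h4 := hsep _ (hX i hi) z hz h.ne
        rw [abs_of_neg (sub_neg.2 h)] at h4
        exact ⟨fun _ => Or.inl h, fun _ => by linarith⟩
      · rw [le_div_iff₀ hts]
        exact ⟨fun h' => Or.inr ⟨h, by linarith⟩, fun h' => by
          rcases h' with h' | h'
          · exact absurd h h'.ne
          · linarith [h'.2]⟩
      · have h4 := hsep _ (hX i hi) z hz h.ne'
        rw [abs_of_pos (sub_pos.2 h)] at h4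
        refine ⟨fun h' => by linarith, fun h' => ?_⟩
        rcases h' with h' | h'
        · exact absurd h h'.not_gt
        · exact absurd h'.1 h.ne'
    unfold left rho stepLt stepLe through
    rw [Finset.filter_filter, ← Finset.sum_union, ← Finset.filter_or, Finset.filter_congr hord]
    rw [Finset.disjoint_filter]
    exact fun j _ h1 h2 => h1.ne h2.1
  · have h3 := abs_lt.1 hxz
    split_ifs with hlt
    · refine Finset.sum_congr (Finset.filter_congr fun i hi => ?_) fun _ _ => rfl
      constructor
      · intro h; exact h.trans_lt hlt
      · intro h
        have h4 := hsep _ (hX i hi) z hz h.ne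
        rw [abs_of_neg (sub_neg.2 h)] at h4
        linarith
    · refine Finset.sum_congr (Finset.filter_congr fun i hi => ?_) fun _ _ => rfl
      constructor
      · intro h
        by_contra! hc
        have h4 := hsep _ (hX i hi) z hz hc.ne'
        rw [abs_of_pos (sub_pos.2 hc)] at h4
        linarith
      · intro h; linarith
  · refine Finset.sum_congr (Finset.filter_congr fun i hi => ?_) fun _ _ => rfl
    have h1 := abs_lt.1 (hs i hi)
    have h2 := pos_eq_add i t s
    rcases le_abs.1 (hfar _ (hX i hi)) with h3 | h3
    · constructor <;> intro <;> linarith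
    · constructor <;> intro <;> linarith

end FrontConfig

/-! ### Configurations which solve the Riemann problems of their profile -/

namespace LWRModel

variable {P : LWRModel} {ν : ℕ} {u : ℝ} {C : FrontConfig} {t : ℝ}

/-- The fronts emanating from time `t` solve the Riemann problems of the profile at time `t`. -/
structure Resolved (P : LWRModel) (ν : ℕ) (u : ℝ) (C : FrontConfig) (t : ℝ) : Prop where
  mem_grid : ∀ z, C.rho t z ∈ P.densityGrid ν
  classical : ∀ z, z ≠ C.y t → ∀ ξ, P.riemann ν (C.left t z) (C.rho t z) ξ =
    C.left t z + stepLe (C.through t z) Prod.fst C.d ξ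
  constrained : ∀ ξ, P.constrainedRiemann ν u (C.left t (C.y t)) (C.rho t (C.y t)) ξ =
    C.left t (C.y t) + stepLe (C.through t (C.y t)) Prod.fst C.d ξ
  speed : P.vehicleSpeed ν u (C.left t (C.y t)) (C.rho t (C.y t)) = C.c.1

theorem Resolved.followsRiemann (h : P.Resolved ν u C t) {ρ : ℝ → ℝ → ℝ} {y : ℝ → ℝ}
    (hρ : ∀ᶠ s in 𝓝[>] t, ρ s = C.rho s ∧ y s = C.y s) (hρt : ρ t = C.rho t) (hyt : y t = C.y t) :
    P.FollowsRiemann ν u ρ y t := by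
  classical
  set X := insert (C.y t) (C.L.image fun i => pos i t) with hXdef
  have hX : ∀ i ∈ C.L, pos i t ∈ X := fun i hi =>
    Finset.mem_insert_of_mem (Finset.mem_image_of_mem _ hi)
  obtain ⟨r, hr, hloc⟩ := C.exists_local t X hX
  have hl : ∀ z, Function.leftLim (C.rho t) z = C.left t z := fun z => leftLim_stepLe _ _ _ _
  have hrt : ∀ z, Function.rightLim (C.rho t) z = C.rho t z := fun z => rightLim_stepLe _ _ _ _
  refine ⟨r, hr, ?_⟩
  filter_upwards [hloc, hρ, self_mem_nhdsWithin] with s hs hρs hts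
  rw [hρs.1, hρs.2, hρt, hyt]
  refine ⟨?_, fun x => ⟨fun hx => ?_, fun z hz hzd hx => ?_, fun hx hxd => ?_⟩⟩
  · rw [hl, hrt, h.speed]
    exact pos_eq_add _ _ _
  · rw [hl, hrt, h.constrained]
    exact ((hs x).1 _ (Finset.mem_insert_self _ _) hx).1
  · obtain ⟨i, hi, rfl⟩ := exists_of_not_continuousAt_stepLe hzd
    rw [hl, hrt, h.classical _ hz]
    exact ((hs x).1 _ (hX i hi) hx).1
  · by_cases hfar : ∀ z ∈ X, r ≤ |x - z|
    · exact (hs x).2 hfar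
    · push Not at hfar
      obtain ⟨z, hz, hxz⟩ := hfar
      -- Several lines may pass through a point where the jumps cancel. There both traces agree, the
      -- Riemann solution is constant, and so the nearby density does not change.
      have hzy : z ≠ C.y t := by rintro rfl; linarith
      have hzc : ContinuousAt (C.rho t) z := by
        by_contra hc
        linarith [hxd z hc]
      have heq : C.left t z = C.rho t z := continuousAt_stepLe_iff.1 hzc
      obtain ⟨e1, e2⟩ := (hs x).1 z hz hxz
      have e3 := h.classical z hzy ((x - z) / (s - t))
      rw [heq, riemann_self (h.mem_grid z)] at e3
      rw [e1, e2, heq, ite_self]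
      exact e3.symm

/-- At time `t` the fronts do not meet, are admissible, and the vehicle moves accordingly. -/
structure GoodAt (P : LWRModel) (ν : ℕ) (u : ℝ) (C : FrontConfig) (t : ℝ) : Prop where
  separated : C.Separated t
  front : ∀ i ∈ C.L, i ≠ C.c → P.Front ν (C.left t (pos i t)) (C.rho t (pos i t)) i.1
  vehicle : P.Active u (C.left t (C.y t)) (C.rho t (C.y t)) C.c.1 (C.c ∈ C.L) ∨
    P.Inactive ν u (C.left t (C.y t)) (C.rho t (C.y t)) C.c.1 (C.c ∈ C.L)

/-- To the left of all fronts the density is `0`, which is a node as `ρ̌_V = 0`. Elsewhere it is the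
right state of the last front passed. -/
theorem GoodAt.mem_grid (hu : u ∈ P.speedGrid ν) (h : P.GoodAt ν u C t) (z : ℝ) :
    C.rho t z ∈ P.densityGrid ν := by
  have key : ∀ i ∈ C.L, C.rho t (pos i t) ∈ P.densityGrid ν := by
    intro i hi
    by_cases hc : i = C.c
    · subst hc
      rcases h.vehicle with hv | hv
      · have := hv.right
        unfold FrontConfig.y at this
        rw [this]; exact P.check_mem_grid hu
      · exact (hv.front hi).right_mem
    · exact (h.front i hi hc).right_mem
  rcases (C.L.filter fun i => pos i t ≤ z).eq_empty_or_nonempty with he | hne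
  · have : C.rho t z = 0 := by
      unfold FrontConfig.rho stepLe
      rw [he, Finset.sum_empty]
    rw [this]; exact P.zero_mem_grid ν
  · obtain ⟨i, hi, hmax⟩ := Finset.exists_max_image _ (fun i => pos i t) hne
    rw [Finset.mem_filter] at hi
    have : C.rho t z = C.rho t (pos i t) := by
      refine stepLe_congr (fun j hj => ⟨fun hle => hmax j (Finset.mem_filter.2 ⟨hj, hle⟩),
        fun hle => hle.trans hi.2⟩) fun _ _ => rfl
    rw [this]; exact key i hi.1

theorem left_mem_grid (h : ∀ z, C.rho t z ∈ P.densityGrid ν) (z : ℝ) :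
    C.left t z ∈ P.densityGrid ν := by
  obtain ⟨z', hz', he⟩ := exists_stepLe_eq_stepLt C.L (fun i => pos i t) C.d z
  have := h z'
  rwa [FrontConfig.rho, he z' le_rfl hz'] at this

/-- At such a time at most one front passes through each point. A classical front is its own Riemann
solution, and the jump at an enforcing vehicle is reproduced by `violates_active`. -/
theorem GoodAt.resolved (hν : 1 ≤ ν) (hu : u ∈ P.speedGrid ν) (h : P.GoodAt ν u C t) :
    P.Resolved ν u C t := by
  have hg := h.mem_grid hu
  have hfan : ∀ i ∈ C.L, ∀ ξ, C.left t (pos i t) +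
      stepLe (C.through t (pos i t)) Prod.fst C.d ξ =
        if ξ < i.1 then C.left t (pos i t) else C.rho t (pos i t) := by
    intro i hi ξ
    rw [C.rho_eq, FrontConfig.through_eq_singleton h.separated hi, stepLe, Finset.filter_singleton,
      Finset.sum_singleton]
    split_ifs with h1 h2 h2
    · linarith
    · simp
    · simp
    · linarith
  have hnone : ∀ z, (∀ i ∈ C.L, pos i t ≠ z) → C.left t z = C.rho t z ∧
      ∀ ξ, C.left t z + stepLe (C.through t z) Prod.fst C.d ξ = C.rho t z := by
    intro z hz
    rw [FrontConfig.through_eq_empty hz]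
    have : C.left t z = C.rho t z := (stepLe_eq_stepLt_of_forall_ne hz).symm
    exact ⟨this, fun ξ => by rw [stepLe_empty, add_zero, this]⟩
  have hcnone : C.c ∉ C.L → ∀ i ∈ C.L, pos i t ≠ C.y t := fun hc i hi he =>
    hc (h.separated i (FrontConfig.mem_lines hi) C.c C.c_mem he ▸ hi)
  refine ⟨hg, fun z hz ξ => ?_, fun ξ => ?_, ?_⟩
  · by_cases hex : ∃ i ∈ C.L, pos i t = z
    · obtain ⟨i, hi, rfl⟩ := hex
      have hic : i ≠ C.c := by rintro rfl; exact hz rfl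
      rw [hfan i hi, (h.front i hi hic).riemann_eq]
    · push Not at hex
      obtain ⟨h1, h2⟩ := hnone z hex
      rw [h2, h1, riemann_self (hg z)]
  · rcases h.vehicle with hv | hv
    · have hvi := violates_active hν hu hv.lt
      have h3 := hfan _ hv.mem ξ
      change C.left t (C.y t) + stepLe (C.through t (C.y t)) Prod.fst C.d ξ =
        if ξ < C.c.1 then C.left t (C.y t) else C.rho t (C.y t) at h3
      rw [h3, hv.left, hv.right, hv.speed, constrainedRiemann, if_pos hvi,
        riemann_self (P.hat_mem_grid hu), riemann_self (P.check_mem_grid hu)]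
    · rw [constrainedRiemann, if_neg hv.not_violates]
      by_cases hc : C.c ∈ C.L
      · have h3 := hfan _ hc ξ
        change C.left t (C.y t) + stepLe (C.through t (C.y t)) Prod.fst C.d ξ =
          if ξ < C.c.1 then C.left t (C.y t) else C.rho t (C.y t) at h3
        rw [h3, (hv.front hc).riemann_eq]
      · obtain ⟨h1, h2⟩ := hnone (C.y t) (hcnone hc)
        rw [h2, h1, riemann_self (hg _)]
  · rcases h.vehicle with hv | hv
    · rw [hv.left, hv.right, vehicleSpeed, if_pos (violates_active hν hu hv.lt), hv.speed]
    · rw [vehicleSpeed, if_neg hv.not_violates, hv.speed]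

/-- The fronts of `C` solve the Riemann problems of the profile at time `t`, with full information
on the waves. -/
structure Resolution (P : LWRModel) (ν : ℕ) (u : ℝ) (C : FrontConfig) (t : ℝ) : Prop where
  mem_grid : ∀ z, C.rho t z ∈ P.densityGrid ν
  classical : ∀ z, z ≠ C.y t → P.RiemannFan ν (C.left t z) (C.rho t z)
    ((C.through t z).image Prod.fst) fun s => C.d (s, z - s * t)
  vehicle : (P.Violates ν u (C.left t (C.y t)) (C.rho t (C.y t)) ∧ C.c.1 = u ∧
      P.ActiveFan ν u (C.left t (C.y t)) (C.rho t (C.y t))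
        ((C.through t (C.y t)).image Prod.fst) fun s => C.d (s, C.y t - s * t)) ∨
    (¬ P.Violates ν u (C.left t (C.y t)) (C.rho t (C.y t)) ∧
      C.c.1 = min u (P.v (C.rho t (C.y t))) ∧
      P.RiemannFan ν (C.left t (C.y t)) (C.rho t (C.y t))
        ((C.through t (C.y t)).image Prod.fst) fun s => C.d (s, C.y t - s * t))

theorem sum_through_image (C : FrontConfig) (t z : ℝ) (g : ℝ → ℝ) :
    ∑ s ∈ (C.through t z).image Prod.fst, g (C.d (s, z - s * t)) =
      ∑ i ∈ C.through t z, g (C.d i) := by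
  rw [Finset.sum_image (C.injOn_through t z)]
  refine Finset.sum_congr rfl fun i hi => ?_
  have : (i.1, z - i.1 * t) = i := by
    rw [← (FrontConfig.mem_through.1 hi).2, pos]
    ext <;> simp
  rw [this]

theorem stepLe_through_image (C : FrontConfig) (t z ξ : ℝ) :
    stepLe ((C.through t z).image Prod.fst) id (fun s => C.d (s, z - s * t)) ξ =
      stepLe (C.through t z) Prod.fst C.d ξ := by
  unfold stepLe
  rw [Finset.filter_image, Finset.sum_image
    ((C.injOn_through t z).mono (Finset.coe_subset.2 (Finset.filter_subset _ _)))]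
  refine Finset.sum_congr rfl fun i hi => ?_
  have : (i.1, z - i.1 * t) = i := by
    rw [← (FrontConfig.mem_through.1 (Finset.mem_filter.1 hi).1).2, pos]
    ext <;> simp
  rw [this]

theorem stepLt_through_image (C : FrontConfig) (t z ξ : ℝ) :
    stepLt ((C.through t z).image Prod.fst) id (fun s => C.d (s, z - s * t)) ξ =
      stepLt (C.through t z) Prod.fst C.d ξ := by
  unfold stepLt
  rw [Finset.filter_image, Finset.sum_image
    ((C.injOn_through t z).mono (Finset.coe_subset.2 (Finset.filter_subset _ _)))]
  refine Finset.sum_congr rfl fun i hi => ?_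
  have : (i.1, z - i.1 * t) = i := by
    rw [← (FrontConfig.mem_through.1 (Finset.mem_filter.1 hi).1).2, pos]
    ext <;> simp
  rw [this]

theorem Resolution.resolved (h : P.Resolution ν u C t) : P.Resolved ν u C t := by
  refine ⟨h.mem_grid, fun z hz ξ => ?_, fun ξ => ?_, ?_⟩
  · rw [(h.classical z hz).eq, stepLe_through_image]
  · rcases h.vehicle with ⟨h1, -, h3⟩ | ⟨h1, -, h3⟩
    · rw [constrainedRiemann, if_pos h1, h3.eq, stepLe_through_image]
    · rw [constrainedRiemann, if_neg h1, h3.eq, stepLe_through_image]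
  · rcases h.vehicle with ⟨h1, h2, -⟩ | ⟨h1, h2, -⟩
    · rw [vehicleSpeed, if_pos h1, h2]
    · rw [vehicleSpeed, if_neg h1, h2]

theorem c_fst_mem_iff (C : FrontConfig) (t : ℝ) :
    C.c.1 ∈ (C.through t (C.y t)).image Prod.fst ↔ C.c ∈ C.L := by
  rw [Finset.mem_image]
  constructor
  · rintro ⟨i, hi, he⟩
    have := FrontConfig.mem_through.1 hi
    rw [← eq_of_pos_eq this.2 he]; exact this.1
  · intro h
    exact ⟨C.c, FrontConfig.mem_through.2 ⟨h, rfl⟩, rfl⟩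

/-- After `t₁` the lines through a point are spread out in the order of their speeds, so their
traces are the states of the fan issued there, by `left_after`. -/
theorem Resolution.goodAt (hu : u ∈ P.speedGrid ν) {t₁ : ℝ} (h : P.Resolution ν u C t₁)
    (ht : t₁ < t) (hsep : ∀ s ∈ Ioc t₁ t, C.Separated s) : P.GoodAt ν u C t := by
  refine ⟨hsep t ⟨ht, le_rfl⟩, fun i hi hic => ?_, ?_⟩
  · obtain ⟨e1, e2⟩ := C.left_after ht hsep (FrontConfig.mem_lines hi)
    have hmem : i.1 ∈ (C.through t₁ (pos i t₁)).image Prod.fst :=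
      Finset.mem_image_of_mem _ (FrontConfig.mem_through.2 ⟨hi, rfl⟩)
    rw [e1, e2, ← stepLe_through_image, ← stepLt_through_image]
    by_cases hy : pos i t₁ = C.y t₁
    · rw [hy] at hmem ⊢
      rcases h.vehicle with ⟨-, h2, h3⟩ | ⟨-, -, h3⟩
      · refine h3.fan _ hmem fun he => hic (eq_of_pos_eq hy (he.trans h2.symm))
      · exact h3.fan _ hmem
    · exact (h.classical _ hy).fan _ hmem
  · obtain ⟨e1, e2⟩ := C.left_after ht hsep C.c_mem
    change C.left t (C.y t) = C.left t₁ (C.y t₁) +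
      stepLt (C.through t₁ (C.y t₁)) Prod.fst C.d C.c.1 at e1
    change C.rho t (C.y t) = C.left t₁ (C.y t₁) +
      stepLe (C.through t₁ (C.y t₁)) Prod.fst C.d C.c.1 at e2
    rw [e1, e2, ← stepLe_through_image, ← stepLt_through_image]
    have hcm := c_fst_mem_iff C t₁
    rcases h.vehicle with ⟨-, h2, h3⟩ | ⟨h1, h2, h3⟩
    · left
      have := h3.active
      rw [← h2] at this
      exact ⟨h2 ▸ this.lt, by rw [← h2] at *; exact this.left, by rw [← h2] at *; exact this.right,
        h2, hcm.1 this.mem⟩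
    · right
      have hl := left_mem_grid h.mem_grid (C.y t₁)
      have := inactive_of_not_violates hu hl (h.mem_grid _) h3 h1
      rw [← h2] at this
      exact ⟨this.not_violates, this.speed, fun h => this.front (hcm.2 h),
        fun h' => this.eq fun h'' => h' (hcm.1 h'')⟩

end LWRModel

/-! ### Meeting times of the lines and the weight of the fronts -/

namespace FrontConfig

variable {C : FrontConfig}

/-- The finitely many times at which two of the lines meet. -/
def meetTimes (C : FrontConfig) : Finset ℝ :=
  (C.lines ×ˢ C.lines).image fun q => (q.2.2 - q.1.2) / (q.1.1 - q.2.1)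

theorem mem_meetTimes {t : ℝ} (h : ¬ C.Separated t) : t ∈ C.meetTimes := by
  unfold Separated at h
  push Not at h
  obtain ⟨i, hi, j, hj, hpos, hne⟩ := h
  refine Finset.mem_image.2 ⟨(i, j), Finset.mem_product.2 ⟨hi, hj⟩, ?_⟩
  have h1 : i.1 - j.1 ≠ 0 := fun h1 => hne (eq_of_pos_eq hpos (sub_eq_zero.1 h1))
  simp only
  rw [div_eq_iff h1]
  unfold pos at hpos
  linarith

theorem eventually_separated (C : FrontConfig) (t : ℝ) :
    ∃ t' > t, ∀ s ∈ Ioo t t', C.Separated s := by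
  obtain ⟨t', ht', h⟩ : ∃ t' > t, ∀ s ∈ C.meetTimes, t < s → t' ≤ s := by
    rcases (C.meetTimes.filter (t < ·)).eq_empty_or_nonempty with he | hne
    · refine ⟨t + 1, by linarith, fun s hs hts => ?_⟩
      have : s ∈ C.meetTimes.filter (t < ·) := Finset.mem_filter.2 ⟨hs, hts⟩
      simp [he] at this
    · exact ⟨_, (Finset.mem_filter.1 (Finset.min'_mem _ hne)).2,
        fun s hs hts => Finset.min'_le _ _ (Finset.mem_filter.2 ⟨hs, hts⟩)⟩
  refine ⟨t', ht', fun s hs => ?_⟩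
  by_contra hc
  exact absurd (h s (mem_meetTimes hc) hs.1) (not_le.2 hs.2)

theorem pos_lt_iff_of_separated {t t' : ℝ} (h : ∀ s ∈ uIcc t t', C.Separated s)
    {i j : ℝ × ℝ} (hi : i ∈ C.lines) (hj : j ∈ C.lines) :
    pos i t < pos j t ↔ pos i t' < pos j t' := by
  by_cases hij : i = j
  · subst hij; simp
  · constructor
    · exact pos_lt_of_not_meet fun τ hτ he => hij (h τ hτ i hi j hj he)
    · exact pos_lt_of_not_meet fun τ hτ he => hij (h τ (by rwa [uIcc_comm]) i hi j hj he)

theorem left_congr {t t' : ℝ} (h : ∀ s ∈ uIcc t t', C.Separated s) {i : ℝ × ℝ}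
    (hi : i ∈ C.lines) : C.left t (pos i t) = C.left t' (pos i t') :=
  stepLt_congr (fun _ hj => pos_lt_iff_of_separated h (mem_lines hj) hi) fun _ _ => rfl

theorem rho_congr {t t' : ℝ} (h : ∀ s ∈ uIcc t t', C.Separated s) {i : ℝ × ℝ}
    (hi : i ∈ C.lines) : C.rho t (pos i t) = C.rho t' (pos i t') :=
  stepLe_congr (fun j hj => by
    rw [← not_lt, ← not_lt, pos_lt_iff_of_separated h hi (mem_lines hj)]) fun _ _ => rfl

/-- The line `i` and the vehicle approach each other across the line of slope `u`. -/
def Approaches (C : FrontConfig) (u t : ℝ) (i : ℝ × ℝ) : Prop :=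
  (pos i t < C.y t ∧ u < i.1) ∨ (C.y t < pos i t ∧ i.1 < u)

open Classical in
/-- The number of the fronts `i ∈ G`, where those which approach the vehicle count three times and
the others twice. -/
def weight (C : FrontConfig) (u t : ℝ) (G : Finset (ℝ × ℝ)) : ℕ :=
  ∑ i ∈ G, (2 + if C.Approaches u t i then 1 else 0)

theorem approaches_congr {u t t' : ℝ} (h : ∀ s ∈ uIcc t t', C.Separated s) {i : ℝ × ℝ}
    (hi : i ∈ C.lines) : C.Approaches u t i ↔ C.Approaches u t' i := by
  unfold Approaches y
  rw [pos_lt_iff_of_separated h hi C.c_mem, pos_lt_iff_of_separated h C.c_mem hi]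

theorem weight_congr {u t t' : ℝ} (h : ∀ s ∈ uIcc t t', C.Separated s) :
    C.weight u t C.L = C.weight u t' C.L := by
  classical
  unfold weight
  refine Finset.sum_congr rfl fun i hi => ?_
  simp only [approaches_congr h (mem_lines hi)]

end FrontConfig

namespace LWRModel

variable {P : LWRModel} {ν : ℕ} {u : ℝ} {C : FrontConfig}

theorem GoodAt.congr {t t' : ℝ} (hg : P.GoodAt ν u C t) (h : ∀ s ∈ uIcc t t', C.Separated s) :
    P.GoodAt ν u C t' := by
  refine ⟨h t' right_mem_uIcc, fun i hi hic => ?_, ?_⟩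
  · rw [← FrontConfig.left_congr h (FrontConfig.mem_lines hi),
      ← FrontConfig.rho_congr h (FrontConfig.mem_lines hi)]
    exact hg.front i hi hic
  · have := hg.vehicle
    unfold FrontConfig.y at this ⊢
    rwa [← FrontConfig.left_congr h C.c_mem, ← FrontConfig.rho_congr h C.c_mem]

/-- Choose a fan at every point `z` and let each wave speed `s` of it define the line of slope `s`
through `(t, z)`. -/
theorem exists_resolution (hu : u ∈ P.speedGrid ν) {ι : Type*} (L₀ : Finset ι) (x₀ d₀ : ι → ℝ)
    (t z₀ : ℝ) (hgrid : ∀ z, stepLe L₀ x₀ d₀ z ∈ P.densityGrid ν) :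
    ∃ C : FrontConfig, C.rho t = stepLe L₀ x₀ d₀ ∧ C.left t = stepLt L₀ x₀ d₀ ∧ C.y t = z₀ ∧
      P.Resolution ν u C t := by
  classical
  set l := stepLt L₀ x₀ d₀ with hl
  set r := stepLe L₀ x₀ d₀ with hr
  have hlgrid : ∀ z, l z ∈ P.densityGrid ν := fun z => by
    obtain ⟨z', hz', he⟩ := exists_stepLe_eq_stepLt L₀ x₀ d₀ z
    have := hgrid z'
    rwa [hr, he z' le_rfl hz'] at this
  have hex : ∀ z, ∃ S D, (z ≠ z₀ → P.RiemannFan ν (l z) (r z) S D) ∧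
      (z = z₀ → (P.Violates ν u (l z) (r z) ∧ P.ActiveFan ν u (l z) (r z) S D) ∨
        (¬ P.Violates ν u (l z) (r z) ∧ P.RiemannFan ν (l z) (r z) S D)) := by
    intro z
    by_cases hv : z = z₀ ∧ P.Violates ν u (l z) (r z)
    · obtain ⟨S, D, h⟩ := exists_activeFan hu (hlgrid z) (hgrid z) hv.2
      exact ⟨S, D, fun h' => absurd hv.1 h', fun _ => Or.inl ⟨hv.2, h⟩⟩
    · obtain ⟨S, D, h⟩ := exists_riemannFan (hlgrid z) (hgrid z)
      exact ⟨S, D, fun _ => h, fun h' => Or.inr ⟨fun h'' => hv ⟨h', h''⟩, h⟩⟩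
  choose S D h1 h2 using hex
  have htot : ∀ z, l z + ∑ s ∈ S z, D z s = r z := by
    intro z
    by_cases hz : z = z₀
    · rcases h2 z hz with h | h
      exacts [h.2.total, h.2.total]
    · exact (h1 z hz).total
  set X := insert z₀ (L₀.image x₀) with hX
  -- Away from the vehicle and from the jumps both traces agree and the fan is empty, so only
  -- finitely many lines arise.
  have hSX : ∀ z, z ∉ X → S z = ∅ := by
    intro z hz
    have hz0 : z ≠ z₀ := fun h => hz (h ▸ Finset.mem_insert_self _ _)
    refine (h1 z hz0).empty ?_
    refine (stepLe_eq_stepLt_of_forall_ne fun i hi he => hz ?_).symm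
    exact Finset.mem_insert_of_mem (Finset.mem_image.2 ⟨i, hi, he⟩)
  set cs : ℝ := if P.Violates ν u (l z₀) (r z₀) then u else min u (P.v (r z₀)) with hcs
  set L := X.biUnion fun z => (S z).image fun s => (s, z - s * t) with hL
  have hposz : ∀ s z : ℝ, pos (s, z - s * t) t = z := fun s z => by simp [pos]
  have hmem : ∀ i : ℝ × ℝ, i ∈ L ↔ i.1 ∈ S (pos i t) := by
    intro i
    rw [hL, Finset.mem_biUnion]
    constructor
    · rintro ⟨z, hz, hi⟩
      obtain ⟨s, hs, rfl⟩ := Finset.mem_image.1 hi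
      rw [hposz]; exact hs
    · intro hi
      refine ⟨pos i t, ?_, Finset.mem_image.2 ⟨i.1, hi, ?_⟩⟩
      · by_contra hc
        rw [hSX _ hc] at hi
        exact absurd hi (Finset.notMem_empty _)
      · ext <;> simp [pos]
  set C : FrontConfig := ⟨L, fun i => D (pos i t) i.1, (cs, z₀ - cs * t)⟩ with hC
  have hthrough : ∀ z, (C.through t z).image Prod.fst = S z := by
    intro z
    ext s
    rw [Finset.mem_image]
    constructor
    · rintro ⟨i, hi, rfl⟩
      obtain ⟨hi1, hi2⟩ := FrontConfig.mem_through.1 hi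
      have := (hmem i).1 hi1
      rwa [hi2] at this
    · intro hs
      refine ⟨(s, z - s * t), FrontConfig.mem_through.2 ⟨(hmem _).2 ?_, hposz s z⟩, rfl⟩
      rw [hposz]; exact hs
  have hD : ∀ z, (fun s => C.d (s, z - s * t)) = D z := by
    intro z; funext s
    change D (pos (s, z - s * t) t) s = D z s
    rw [hposz]
  have hjump : ∀ z, ∑ i ∈ C.through t z, C.d i = r z - l z := by
    intro z
    have := sum_through_image C t z id
    simp only [id] at this
    rw [← this, hthrough, ← htot z, add_sub_cancel_left]
    exact Finset.sum_congr rfl fun s _ => congrFun (hD z) s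
  have hXL : ∀ i ∈ C.L, pos i t ∈ X := by
    intro i hi
    by_contra hc
    have := (hmem i).1 hi
    rw [hSX _ hc] at this
    exact absurd this (Finset.notMem_empty _)
  have hrho : C.rho t = r := by
    funext z
    rw [FrontConfig.rho, stepLe_eq_of_forall_mem hXL, hr, stepLe_eq_of_forall_mem (X := X)
      fun i hi => Finset.mem_insert_of_mem (Finset.mem_image_of_mem x₀ hi)]
    refine stepLe_congr (fun _ _ => Iff.rfl) fun z _ => ?_
    have h3 := stepLe_eq_add_jumpAt (L := L₀) (x := x₀) (d := d₀) z
    change ∑ i ∈ C.through t z, C.d i = _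
    rw [hjump, hr, hl]; linarith
  have hleft : C.left t = l := by
    funext z
    have := C.rho_eq t z
    rw [hjump, hrho] at this
    linarith
  have hy : C.y t = z₀ := hposz cs z₀
  refine ⟨C, hrho, hleft, hy, fun z => by rw [hrho]; exact hgrid z, fun z hz => ?_, ?_⟩
  · rw [hleft, hrho, hthrough, hD]
    exact h1 z (by rwa [hy] at hz)
  · rw [hleft, hrho, hthrough, hD, hy]
    change (_ ∧ cs = u ∧ _) ∨ (_ ∧ cs = _ ∧ _)
    rcases h2 z₀ rfl with h | h
    · exact Or.inl ⟨h.1, by rw [hcs, if_pos h.1], h.2⟩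
    · exact Or.inr ⟨h.1, by rw [hcs, if_neg h.1], h.2⟩

end LWRModel

/-! ### Variation and `γ` when fronts meet the vehicle or the control jumps -/

namespace LWRModel

variable {P : LWRModel} {ν : ℕ} {u : ℝ}

open Classical in
/-- The term `γ` of the functional, for the traces `a`, `b` at the vehicle. -/
def gam (P : LWRModel) (u a b : ℝ) : ℝ :=
  if a = P.hat u ∧ b = P.check u then -2 * (P.hat u - P.check u) else 0

theorem gam_nonpos (u a b : ℝ) : P.gam u a b ≤ 0 := by
  unfold gam
  split_ifs
  · linarith [P.check_le_hat u]
  · exact le_rfl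

theorem neg_two_mul_le_gam (u a b : ℝ) : -2 * P.R ≤ P.gam u a b := by
  unfold gam
  split_ifs
  · linarith [(P.check_mem u).1, (P.hat_mem u).2]
  · linarith [P.R_pos]

theorem gam_hat_check (u : ℝ) : P.gam u (P.hat u) (P.check u) = -2 * (P.hat u - P.check u) :=
  if_pos ⟨rfl, rfl⟩

theorem gamma_eq (u : ℝ) (q : ℝ → ℝ) (z : ℝ) :
    P.gamma u q z = P.gam u (Function.leftLim q z) (Function.rightLim q z) := rfl

/-- Traces `ρ̂_u` and `ρ̌_u` would violate the constraint unless they coincide, and in that case the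
value is `0` anyway. -/
theorem Inactive.gam_eq {a b c : ℝ} {m : Prop} (hν : 1 ≤ ν) (hu : u ∈ P.speedGrid ν)
    (h : P.Inactive ν u a b c m) : P.gam u a b = 0 := by
  unfold gam
  split_ifs with hab
  · rcases (P.check_le_hat u).eq_or_lt with he | hlt
    · rw [he]; ring
    · have := violates_active hν hu hlt
      rw [← hab.1, ← hab.2] at this
      exact absurd this h.not_violates
  · rfl

/-- The right trace at a vehicle which does not enforce the constraint satisfies it. -/
theorem Inactive.right_not_mem {a b c : ℝ} {m : Prop} (hu : u ∈ P.speedGrid ν)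
    (hb : b ∈ P.densityGrid ν) (h : P.Inactive ν u a b c m) : b ≤ P.check u ∨ P.hat u ≤ b := by
  by_contra! hc
  have hab : P.riemann ν a b u = b := by
    by_cases hm : m
    · rw [(h.front hm).riemann_eq, if_neg]
      rw [not_lt, h.speed]; exact min_le_left _ _
    · rw [h.eq hm]; exact riemann_self hb u
  have ha : a ∈ P.densityGrid ν := by
    by_cases hm : m
    · exact (h.front hm).left_mem
    · rw [h.eq hm]; exact hb
  exact h.not_violates ((violates_iff hu ha hb).2 (by rwa [hab]))

/-- The fronts `i ∈ G`, of speed `i.1`, meet at a point of the trajectory of the vehicle, which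
follows the line `c`, and where the density to the left is `l`. -/
structure Meeting (P : LWRModel) (ν : ℕ) (u : ℝ) (G : Finset (ℝ × ℝ)) (d : ℝ × ℝ → ℝ) (l : ℝ)
    (c : ℝ × ℝ) : Prop where
  inj : Set.InjOn Prod.fst (G : Set (ℝ × ℝ))
  eq_of_fst : ∀ i ∈ G, i.1 = c.1 → i = c
  front : ∀ i ∈ G, i ≠ c → P.Front ν (l + stepLt G (fun j => -j.1) d (-i.1))
    (l + stepLe G (fun j => -j.1) d (-i.1)) i.1
  vehicle : P.Active u (l + stepLt G (fun j => -j.1) d (-c.1))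
      (l + stepLe G (fun j => -j.1) d (-c.1)) c.1 (c ∈ G) ∨
    P.Inactive ν u (l + stepLt G (fun j => -j.1) d (-c.1))
      (l + stepLe G (fun j => -j.1) d (-c.1)) c.1 (c ∈ G)

namespace Meeting

variable {G : Finset (ℝ × ℝ)} {d : ℝ × ℝ → ℝ} {l : ℝ} {c : ℝ × ℝ}

theorem chain_of_inactive (h : P.Meeting ν u G d l c)
    (hi : P.Inactive ν u (l + stepLt G (fun j => -j.1) d (-c.1))
      (l + stepLe G (fun j => -j.1) d (-c.1)) c.1 (c ∈ G)) :
    P.Chain ν G (fun j => -j.1) d l := by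
  intro i hiG
  by_cases hc : i = c
  · subst hc
    simpa using hi.front hiG
  · simpa using h.front i hiG hc

theorem injOn_neg (h : P.Meeting ν u G d l c) :
    Set.InjOn (fun j : ℝ × ℝ => -j.1) (G : Set (ℝ × ℝ)) :=
  fun _ hi _ hj he => h.inj hi hj (neg_injective he)

/-- Fronts which meet a vehicle enforcing the constraint leave a profile which satisfies it. -/
theorem of_active (hu : u ∈ P.speedGrid ν) (h : P.Meeting ν u G d l c)
    (ha : P.Active u (l + stepLt G (fun j => -j.1) d (-c.1))
      (l + stepLe G (fun j => -j.1) d (-c.1)) c.1 (c ∈ G)) :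
    G = {c} ∨ ((l ≤ P.check u ∨ P.hat u ≤ l + ∑ i ∈ G, d i) ∧ l ≤ l + ∑ i ∈ G, d i ∧
      |∑ i ∈ G, d i| ≤ ∑ i ∈ G, |d i| - 2 * (P.hat u - P.check u)) := by
  classical
  set x : ℝ × ℝ → ℝ := fun j => -j.1 with hx
  -- Fronts faster than the vehicle come from its left and slower ones from its right. Each group is
  -- a chain ending, respectively starting, at the jump from `ρ̂_u` to `ρ̌_u`.
  set Gl := G.filter fun i => x i < -c.1 with hGl
  set Gr := G.filter fun i => -c.1 < x i with hGr
  have hinj := h.injOn_neg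
  have hdisj1 : Disjoint Gl {c} := by
    rw [Finset.disjoint_singleton_right, hGl, Finset.mem_filter]
    exact fun h' => lt_irrefl _ h'.2
  have hdisj2 : Disjoint (Gl ∪ {c}) Gr := by
    rw [Finset.disjoint_left]
    intro i hi hi'
    have h2 := (Finset.mem_filter.1 hi').2
    rcases Finset.mem_union.1 hi with h1 | h1
    · exact (Finset.mem_filter.1 h1).2.not_gt h2
    · rw [Finset.mem_singleton.1 h1] at h2; exact lt_irrefl _ h2
  have hG : G = Gl ∪ {c} ∪ Gr := by
    ext i
    simp only [hGl, hGr, Finset.mem_union, Finset.mem_filter, Finset.mem_singleton]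
    constructor
    · intro hi
      rcases lt_trichotomy (x i) (-c.1) with h1 | h1 | h1
      · exact Or.inl (Or.inl ⟨hi, h1⟩)
      · exact Or.inl (Or.inr (h.eq_of_fst i hi (neg_injective h1)))
      · exact Or.inr ⟨hi, h1⟩
    · rintro ((h1 | rfl) | h1)
      exacts [h1.1, ha.mem, h1.1]
  have hsum : ∀ f : ℝ × ℝ → ℝ, ∑ i ∈ G, f i = ∑ i ∈ Gl, f i + f c + ∑ i ∈ Gr, f i := by
    intro f
    rw [hG, Finset.sum_union hdisj2, Finset.sum_union hdisj1, Finset.sum_singleton]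
  have hleft : l + ∑ i ∈ Gl, d i = P.hat u := ha.left
  have hle : stepLe G x d (-c.1) = ∑ i ∈ Gl, d i + d c := by
    rw [hG, stepLe_union hdisj2, stepLe_union hdisj1,
      stepLe_of_forall_le fun i hi => (Finset.mem_filter.1 hi).2.le,
      stepLe_of_forall_le fun i hi => (by rw [Finset.mem_singleton.1 hi] : x i ≤ -c.1),
      stepLe_of_forall_gt fun i hi => (Finset.mem_filter.1 hi).2, Finset.sum_singleton, add_zero]
  have hright : l + (∑ i ∈ Gl, d i + d c) = P.check u := by rw [← hle]; exact ha.right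
  have hcl : P.Chain ν Gl x d l := by
    intro i hi
    have hi' := Finset.mem_filter.1 hi
    have hic : i ≠ c := by rintro rfl; exact lt_irrefl _ hi'.2
    have := h.front i hi'.1 hic
    have e1 : stepLt G x d (x i) = stepLt Gl x d (x i) := by
      unfold stepLt
      rw [hGl, Finset.filter_filter]
      refine Finset.sum_congr (Finset.filter_congr fun j _ => ?_) fun _ _ => rfl
      exact ⟨fun hj => ⟨hj.trans hi'.2, hj⟩, fun hj => hj.2⟩
    have e2 : stepLe G x d (x i) = stepLe Gl x d (x i) := by
      unfold stepLe
      rw [hGl, Finset.filter_filter]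
      refine Finset.sum_congr (Finset.filter_congr fun j _ => ?_) fun _ _ => rfl
      exact ⟨fun hj => ⟨hj.trans_lt hi'.2, hj⟩, fun hj => hj.2⟩
    rw [← e1, ← e2]
    simpa [hx] using this
  have hcr : P.Chain ν Gr x d (P.check u) := by
    intro i hi
    have hi' := Finset.mem_filter.1 hi
    have hic : i ≠ c := by rintro rfl; exact lt_irrefl _ hi'.2
    have := h.front i hi'.1 hic
    have e1 : stepLt G x d (x i) = ∑ i ∈ Gl, d i + d c + stepLt Gr x d (x i) := by
      conv_lhs => rw [hG]
      rw [stepLt_union hdisj2, stepLt_union hdisj1,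
        stepLt_of_forall_lt fun j hj => (Finset.mem_filter.1 hj).2.trans hi'.2,
        stepLt_of_forall_lt fun j hj =>
          (by rw [Finset.mem_singleton.1 hj]; exact hi'.2 : x j < x i), Finset.sum_singleton]
    have e2 : stepLe G x d (x i) = ∑ i ∈ Gl, d i + d c + stepLe Gr x d (x i) := by
      conv_lhs => rw [hG]
      rw [stepLe_union hdisj2, stepLe_union hdisj1,
        stepLe_of_forall_le fun j hj => ((Finset.mem_filter.1 hj).2.trans hi'.2).le,
        stepLe_of_forall_le fun j hj =>
          (by rw [Finset.mem_singleton.1 hj]; exact hi'.2.le : x j ≤ x i), Finset.sum_singleton]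
    have e3 : P.check u + stepLt Gr x d (x i) = l + stepLt G x d (x i) := by rw [e1, ← hright]; ring
    have e4 : P.check u + stepLe Gr x d (x i) = l + stepLe G x d (x i) := by rw [e2, ← hright]; ring
    rw [e3, e4]
    simpa [hx] using this
  have hl : Gl.Nonempty → l ≤ P.check u := fun hne =>
    hcl.le_check hu ha.lt (hinj.mono (Finset.coe_subset.2 (Finset.filter_subset _ _)))
      (fun i hi => by
        have := (Finset.mem_filter.1 hi).2
        rw [← ha.speed]; linarith) hne hleft
  have hr : Gr.Nonempty → P.hat u ≤ P.check u + ∑ i ∈ Gr, d i := fun hne =>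
    hcr.hat_le hu ha.lt (hinj.mono (Finset.coe_subset.2 (Finset.filter_subset _ _)))
      (fun i hi => by
        have := (Finset.mem_filter.1 hi).2
        rw [← ha.speed]; linarith) hne
  have habsl := Finset.abs_sum_le_sum_abs d Gl
  have habsr := Finset.abs_sum_le_sum_abs d Gr
  have hlt := ha.lt
  -- The net jump is nonnegative while the jump at the vehicle is negative. The cancellation
  -- therefore costs twice the size of the latter.
  have hdc : |d c| = P.hat u - P.check u := by
    rw [show d c = -(P.hat u - P.check u) by linarith, abs_neg, abs_of_pos (by linarith)]
  rw [hsum d, hsum fun i => |d i|]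
  rcases Gl.eq_empty_or_nonempty with hle0 | hlne
  · rcases Gr.eq_empty_or_nonempty with hre | hrne
    · left; rw [hG, hle0, hre]; simp
    · right
      have h1 := hr hrne
      have s0 : ∑ i ∈ Gl, d i = 0 := by rw [hle0, Finset.sum_empty]
      have s1 : ∑ i ∈ Gl, |d i| = 0 := by rw [hle0, Finset.sum_empty]
      refine ⟨Or.inr (by linarith), by linarith, ?_⟩
      rw [abs_of_nonneg (by linarith)]
      have := le_abs_self (∑ i ∈ Gr, d i)
      linarith
  · right
    have h1 := hl hlne
    rcases Gr.eq_empty_or_nonempty with hre | hrne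
    · have s0 : ∑ i ∈ Gr, d i = 0 := by rw [hre, Finset.sum_empty]
      have s1 : ∑ i ∈ Gr, |d i| = 0 := by rw [hre, Finset.sum_empty]
      refine ⟨Or.inl h1, by linarith, ?_⟩
      rw [abs_of_nonneg (by linarith)]
      have := le_abs_self (∑ i ∈ Gl, d i)
      linarith
    · have h2 := hr hrne
      refine ⟨Or.inl h1, by linarith, ?_⟩
      rw [abs_of_nonneg (by linarith)]
      have := le_abs_self (∑ i ∈ Gl, d i)
      have := le_abs_self (∑ i ∈ Gr, d i)
      linarith

/-- The functional does not increase when fronts merge at the vehicle. -/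
theorem merge (hν : 1 ≤ ν) (hu : u ∈ P.speedGrid ν) (h : P.Meeting ν u G d l c) :
    |∑ i ∈ G, d i| + P.gam u l (l + ∑ i ∈ G, d i) ≤
      ∑ i ∈ G, |d i| + P.gam u (l + stepLt G (fun j => -j.1) d (-c.1))
        (l + stepLe G (fun j => -j.1) d (-c.1)) := by
  rcases h.vehicle with ha | hi
  · rcases h.of_active hu ha with rfl | ⟨-, -, h3⟩
    · have e1 : stepLt {c} (fun j : ℝ × ℝ => -j.1) d (-c.1) = 0 := by
        apply stepLt_of_forall_ge
        simp
      have e2 : stepLe {c} (fun j : ℝ × ℝ => -j.1) d (-c.1) = d c := by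
        rw [stepLe_of_forall_le] <;> simp
      rw [e1, e2]
      simp
    -- The loss of `2(ρ̂_u - ρ̌_u)` in variation pays for the disappearance of `γ`.
    · rw [ha.left, ha.right, gam_hat_check]
      linarith [P.gam_nonpos u l (l + ∑ i ∈ G, d i)]
  · rw [hi.gam_eq hν hu]
    linarith [Finset.abs_sum_le_sum_abs d G, P.gam_nonpos u l (l + ∑ i ∈ G, d i)]

/-- When the vehicle starts to enforce the constraint, the functional drops. -/
theorem drop (hν : 1 ≤ ν) (hu : u ∈ P.speedGrid ν) {δ : ℝ}
    (hδ : ∀ a ∈ P.densityGrid ν, ∀ b ∈ P.densityGrid ν, a < b → a + δ ≤ b)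
    (hi : P.Inactive ν u (l + stepLt G (fun j => -j.1) d (-c.1))
      (l + stepLe G (fun j => -j.1) d (-c.1)) c.1 (c ∈ G))
    (hl : l ∈ P.densityGrid ν) (hr : l + ∑ i ∈ G, d i ∈ P.densityGrid ν)
    (hb : l + stepLe G (fun j => -j.1) d (-c.1) ∈ P.densityGrid ν)
    (hv : P.Violates ν u l (l + ∑ i ∈ G, d i)) :
    |l - P.hat u| + (P.hat u - P.check u) + |P.check u - (l + ∑ i ∈ G, d i)| +
        -2 * (P.hat u - P.check u) + 2 * δ ≤
      ∑ i ∈ G, |d i| + P.gam u (l + stepLt G (fun j => -j.1) d (-c.1))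
        (l + stepLe G (fun j => -j.1) d (-c.1)) := by
  classical
  rw [hi.gam_eq hν hu, add_zero]
  have hnm := hi.right_not_mem hu hb
  obtain ⟨h1, h2, -⟩ := hv.bounds hu hl hr
  have hlt : P.check u < P.hat u := by
    have := (violates_iff hu hl hr).1 hv
    exact this.1.trans this.2
  have g1 := hδ _ (P.check_mem_grid hu) _ hl h1
  have g2 := hδ _ hr _ (P.hat_mem_grid hu) h2
  have g3 := hδ _ (P.check_mem_grid hu) _ (P.hat_mem_grid hu) hlt
  set b := l + stepLe G (fun j => -j.1) d (-c.1) with hbdef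
  set r := l + ∑ i ∈ G, d i with hrdef
  have hs : |l - b| + |b - r| ≤ ∑ i ∈ G, |d i| := by
    have e1 := Finset.sum_filter_add_sum_filter_not G (fun i => -i.1 ≤ -c.1) fun i => |d i|
    have e2 := Finset.sum_filter_add_sum_filter_not G (fun i => -i.1 ≤ -c.1) d
    have e3 := Finset.abs_sum_le_sum_abs d (G.filter fun i => -i.1 ≤ -c.1)
    have e4 := Finset.abs_sum_le_sum_abs d (G.filter fun i => ¬ -i.1 ≤ -c.1)
    have e5 : l - b = -∑ i ∈ G with -i.1 ≤ -c.1, d i := by rw [hbdef, stepLe]; ring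
    have e6 : b - r = -∑ i ∈ G with ¬ -i.1 ≤ -c.1, d i := by
      rw [hrdef, hbdef, stepLe, ← e2]; ring
    rw [e5, e6, abs_neg, abs_neg]
    linarith
  -- The old states run from `l` through `b` to `r`. As `b` lies outside `]ρ̌_u, ρ̂_u[`, while `l >
  -- ρ̌_u` and `r < ρ̂_u` by at least `δ`, the detour through `b` costs `2δ` more than the new fan
  -- does after compensation by `γ`.
  rcases hnm with h3 | h3
  · rcases abs_cases (l - P.hat u) with h4 | h4 <;> rcases abs_cases (P.check u - r) with h5 | h5 <;>
    rcases abs_cases (l - b) with h6 | h6 <;> rcases abs_cases (b - r) with h7 | h7 <;> linarith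
  · rcases abs_cases (l - P.hat u) with h4 | h4 <;> rcases abs_cases (P.check u - r) with h5 | h5 <;>
    rcases abs_cases (l - b) with h6 | h6 <;> rcases abs_cases (b - r) with h7 | h7 <;> linarith

end Meeting

theorem abs_check_sub_le {u₁ u₂ : ℝ} (h₁ : u₁ ∈ Icc 0 P.V) (h₂ : u₂ ∈ Icc 0 P.V) :
    |P.check u₁ - P.check u₂| ≤ 2 / P.β * |u₁ - u₂| := by
  rcases lt_trichotomy u₁ u₂ with h | rfl | h
  · rw [abs_of_nonneg (sub_nonneg.2 (P.check_antitone h₁.1 h.le h₂.2)), abs_of_neg (sub_neg.2 h), neg_sub]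
    exact P.check_sub_le h₁.1 h h₂.2
  · simp
  · rw [abs_sub_comm, abs_of_nonneg (sub_nonneg.2 (P.check_antitone h₂.1 h.le h₁.2)),
      abs_of_pos (sub_pos.2 h)]
    exact P.check_sub_le h₂.1 h h₁.2

/-- Only the loss of a previous negative `γ` matters. Its traces `ρ̂_{u₀}` and `ρ̌_{u₀}` no longer
violate the constraint, so the two intervals from `ρ̌` to `ρ̂` have disjoint interiors and `ρ̂_{u₀}
- ρ̌_{u₀}` is at most `2/β |u - u₀|` by the Lipschitz bounds. -/
theorem gam_le_of_not_violates {u₀ l r a b : ℝ} (hν : 1 ≤ ν) (hu₀ : u₀ ∈ P.speedGrid ν)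
    (hu : u ∈ P.speedGrid ν) (hl : l ∈ P.densityGrid ν) (hr : r ∈ P.densityGrid ν)
    (h : ¬ P.Violates ν u l r) :
    P.gam u a b ≤ P.gam u₀ l r + 6 / P.β * |u - u₀| := by
  have hu' := P.speedGrid_subset ν hu
  have hu₀' := P.speedGrid_subset ν hu₀
  have h1 := P.gam_nonpos u a b
  have hp : 0 ≤ 2 / P.β * |u₀ - u| := mul_nonneg (div_nonneg two_pos.le P.β_pos.le) (abs_nonneg _)
  have h6 : 6 / P.β * |u - u₀| = 3 * (2 / P.β * |u₀ - u|) := by rw [abs_sub_comm]; ring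
  rw [h6]
  unfold gam at h1 ⊢
  split_ifs at h1 ⊢ with h2 h3 h3 <;> try linarith
  all_goals
    obtain ⟨rfl, rfl⟩ := h3
    have e1 := le_abs_self (P.hat u₀ - P.hat u)
    have e2 := neg_abs_le (P.check u₀ - P.check u)
    have e3 := P.abs_hat_sub_le hu₀' hu'
    have e4 := abs_check_sub_le (P := P) hu₀' hu'
    rcases not_violates_or hν hu hl hr (P.check_le_hat _) h with h4 | h4 <;> linarith

/-- If the constraint was not saturated before, the bounds on `l` and `r` show that the detour
through `ρ̂_u` and `ρ̌_u` adds at most `2(ρ̂_u - ρ̌_u)`. If it was, the change of the control moves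
both states by a Lipschitz amount. -/
theorem gam_le_of_violates {u₀ l r : ℝ} (hu₀ : u₀ ∈ P.speedGrid ν)
    (hu : u ∈ P.speedGrid ν) (hl : l ∈ P.densityGrid ν) (hr : r ∈ P.densityGrid ν)
    (h : P.Violates ν u l r) :
    |l - P.hat u| + (P.hat u - P.check u) + |P.check u - r| + -2 * (P.hat u - P.check u) ≤
      |l - r| + P.gam u₀ l r + 6 / P.β * |u - u₀| := by
  have hu' := P.speedGrid_subset ν hu
  have hu₀' := P.speedGrid_subset ν hu₀
  have hp : 0 ≤ 2 / P.β * |u₀ - u| := mul_nonneg (div_nonneg two_pos.le P.β_pos.le) (abs_nonneg _)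
  have h6 : 6 / P.β * |u - u₀| = 3 * (2 / P.β * |u₀ - u|) := by rw [abs_sub_comm]; ring
  rw [h6]
  have hch := P.check_le_hat u
  have hch₀ := P.check_le_hat u₀
  unfold gam
  split_ifs with h3
  · obtain ⟨rfl, rfl⟩ := h3
    have e3 := P.abs_hat_sub_le hu₀' hu'
    have e4 := abs_check_sub_le (P := P) hu₀' hu'
    rw [abs_sub_comm (P.check u), abs_of_nonneg (sub_nonneg.2 hch₀)]
    -- Both states move in the same direction. One pair of terms thus cancels and a double
    -- displacement of only one state remains, which is within the budget `6/β |u - u₀|`.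
    rcases le_total u u₀ with hle | hle
    · have a1 := P.hat_antitone hu'.1 hle hu₀'.2
      have a2 := P.check_antitone hu'.1 hle hu₀'.2
      rw [abs_of_nonpos (sub_nonpos.2 a1)] at *
      rw [abs_of_nonpos (sub_nonpos.2 a2)] at *
      linarith
    · have a1 := P.hat_antitone hu₀'.1 hle hu'.2
      have a2 := P.check_antitone hu₀'.1 hle hu'.2
      rw [abs_of_nonneg (sub_nonneg.2 a1)] at *
      rw [abs_of_nonneg (sub_nonneg.2 a2)] at *
      linarith
  · obtain ⟨h1, h2, h4⟩ := h.bounds hu hl hr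
    rcases lt_or_ge l r with hlr | hlr
    · obtain ⟨h5, h7⟩ := h4 hlr
      rw [abs_of_neg (sub_neg.2 h5), abs_of_neg (sub_neg.2 h7), abs_of_neg (sub_neg.2 hlr)]
      linarith
    · rw [abs_of_nonneg (sub_nonneg.2 hlr)]
      rcases abs_cases (l - P.hat u) with h4 | h4 <;>
      rcases abs_cases (P.check u - r) with h5 | h5 <;> linarith

end LWRModel

/-! ### Sums over the lines, grouped by their common points -/

namespace FrontConfig

variable {C : FrontConfig}

theorem sum_through_eq {M : Type*} [AddCommMonoid M] {t : ℝ} {X : Finset ℝ}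
    (hX : ∀ i ∈ C.L, pos i t ∈ X) (f : ℝ × ℝ → M) :
    ∑ z ∈ X, ∑ i ∈ C.through t z, f i = ∑ i ∈ C.L, f i :=
  Finset.sum_fiberwise_of_maps_to hX f

theorem two_mul_card_le_weight (C : FrontConfig) (u t : ℝ) (G : Finset (ℝ × ℝ)) :
    2 * G.card ≤ C.weight u t G := by
  classical
  unfold weight
  rw [mul_comm, ← smul_eq_mul, ← Finset.sum_const]
  exact Finset.sum_le_sum fun i _ => Nat.le_add_right _ _

theorem weight_le (C : FrontConfig) (u t : ℝ) (G : Finset (ℝ × ℝ)) :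
    C.weight u t G ≤ 3 * G.card := by
  classical
  unfold weight
  rw [mul_comm, ← smul_eq_mul, ← Finset.sum_const]
  refine Finset.sum_le_sum fun i _ => ?_
  split_ifs <;> omega

theorem weight_eq (C : FrontConfig) (u t : ℝ) (G : Finset (ℝ × ℝ))
    (h : ∀ i ∈ G, ¬ C.Approaches u t i) : C.weight u t G = 2 * G.card := by
  classical
  unfold weight
  rw [mul_comm, ← smul_eq_mul, ← Finset.sum_const]
  refine Finset.sum_congr rfl fun i hi => ?_
  rw [if_neg (h i hi)]

theorem card_through_image (C : FrontConfig) (t z : ℝ) :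
    ((C.through t z).image Prod.fst).card = (C.through t z).card :=
  Finset.card_image_of_injOn (C.injOn_through t z)

theorem sum_through (C : FrontConfig) (t z : ℝ) :
    ∑ i ∈ C.through t z, C.d i = C.rho t z - C.left t z := by
  rw [C.rho_eq]; ring

theorem stepVar_eq_sum_through {t : ℝ} {X : Finset ℝ} (hX : ∀ i ∈ C.L, pos i t ∈ X) :
    stepVar C.L (fun i => pos i t) C.d = ∑ z ∈ X, |C.rho t z - C.left t z| := by
  rw [stepVar_eq_of_image_subset hX]
  exact Finset.sum_congr rfl fun z _ => by rw [← sum_through]; rfl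

theorem stepVar_eq_of_separated {t t₁ : ℝ} (h : C.Separated t) {X : Finset ℝ}
    (hX : ∀ i ∈ C.L, pos i t₁ ∈ X) :
    stepVar C.L (fun i => pos i t) C.d = ∑ z ∈ X, ∑ i ∈ C.through t₁ z, |C.d i| := by
  rw [stepVar_eq_of_injOn fun i hi j hj => h i (mem_lines hi) j (mem_lines hj),
    sum_through_eq hX]

theorem through_eq_of_image {C' : FrontConfig} {t z : ℝ} {i : ℝ × ℝ} (hi : pos i t = z)
    (h : (C'.through t z).image Prod.fst = {i.1}) : C'.through t z = {i} := by
  ext j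
  rw [Finset.mem_singleton]
  have key : ∀ j ∈ C'.through t z, j = i := fun j hj => by
    have h1 : j.1 ∈ (C'.through t z).image Prod.fst := Finset.mem_image_of_mem _ hj
    rw [h, Finset.mem_singleton] at h1
    exact eq_of_pos_eq ((mem_through.1 hj).2.trans hi.symm) h1
  refine ⟨key j, ?_⟩
  rintro rfl
  have h1 : j.1 ∈ (C'.through t z).image Prod.fst := by rw [h]; exact Finset.mem_singleton_self _
  obtain ⟨k, hk, -⟩ := Finset.mem_image.1 h1
  rwa [← key k hk]

end FrontConfig

namespace LWRModel

open FrontConfig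

variable {P : LWRModel} {ν : ℕ} {u u₀ : ℝ} {C C' : FrontConfig} {t t₁ s z : ℝ}

/-! ### Interactions -/

/-- The part of the functional which depends on the fronts. -/
def energy (P : LWRModel) (u : ℝ) (C : FrontConfig) (t : ℝ) : ℝ :=
  stepVar C.L (fun i => pos i t) C.d + P.gam u (C.left t (C.y t)) (C.rho t (C.y t))

theorem energy_congr (h : ∀ s ∈ uIcc t t₁, C.Separated s) :
    P.energy u C t = P.energy u C t₁ := by
  unfold energy y
  rw [left_congr h C.c_mem, rho_congr h C.c_mem,
    stepVar_eq_of_injOn fun i hi j hj => h t left_mem_uIcc i (mem_lines hi) j (mem_lines hj),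
    stepVar_eq_of_injOn fun i hi j hj => h t₁ right_mem_uIcc i (mem_lines hi) j (mem_lines hj)]

theorem energy_add_nonneg (u : ℝ) (C : FrontConfig) (t : ℝ) :
    0 ≤ P.energy u C t + 2 * P.R := by
  have h1 := P.neg_two_mul_le_gam u (C.left t (C.y t)) (C.rho t (C.y t))
  have h2 : 0 ≤ stepVar C.L (fun i => pos i t) C.d := stepVar_nonneg
  unfold energy
  linarith

section Before

theorem GoodAt.meeting (hg : P.GoodAt ν u₀ C t) (ht : t < t₁)
    (hsep : ∀ τ ∈ Ico t t₁, C.Separated τ) :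
    P.Meeting ν u₀ (C.through t₁ (C.y t₁)) C.d (C.left t₁ (C.y t₁)) C.c := by
  refine ⟨C.injOn_through _ _, fun i hi he => eq_of_pos_eq (mem_through.1 hi).2 he,
    fun i hi hic => ?_, ?_⟩
  · obtain ⟨hiL, hip⟩ := mem_through.1 hi
    have h1 := hg.front i hiL hic
    obtain ⟨e1, e2⟩ := C.left_before ht hsep (mem_lines hiL)
    rwa [e1, e2, hip] at h1
  · obtain ⟨e1, e2⟩ := C.left_before ht hsep C.c_mem
    have h1 := hg.vehicle
    unfold y at h1
    rw [e1, e2] at h1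
    have h2 : C.c ∈ C.through t₁ (C.y t₁) ↔ C.c ∈ C.L :=
      ⟨fun h => (mem_through.1 h).1, fun h => mem_through.2 ⟨h, rfl⟩⟩
    rw [h2]
    exact h1

theorem GoodAt.chain (hg : P.GoodAt ν u₀ C t) (ht : t < t₁)
    (hsep : ∀ τ ∈ Ico t t₁, C.Separated τ) (hz : z ≠ C.y t₁) :
    P.Chain ν (C.through t₁ z) (fun j => -j.1) C.d (C.left t₁ z) := by
  intro i hi
  obtain ⟨hiL, rfl⟩ := mem_through.1 hi
  have hic : i ≠ C.c := by rintro rfl; exact hz rfl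
  have h1 := hg.front i hiL hic
  obtain ⟨e1, e2⟩ := C.left_before ht hsep (mem_lines hiL)
  rw [e1, e2] at h1
  simpa using h1

theorem energy_before (ht : t < t₁) (hsep : ∀ τ ∈ Ico t t₁, C.Separated τ) {X : Finset ℝ}
    (hX : ∀ i ∈ C.L, pos i t₁ ∈ X) :
    P.energy u₀ C t = ∑ z ∈ X, ∑ i ∈ C.through t₁ z, |C.d i| +
      P.gam u₀ (C.left t₁ (C.y t₁) + stepLt (C.through t₁ (C.y t₁)) (fun j => -j.1) C.d (-C.c.1))
        (C.left t₁ (C.y t₁) + stepLe (C.through t₁ (C.y t₁)) (fun j => -j.1) C.d (-C.c.1)) := by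
  obtain ⟨e1, e2⟩ := C.left_before ht hsep C.c_mem
  unfold energy y
  rw [e1, e2, stepVar_eq_of_separated (hsep t ⟨le_rfl, ht⟩) hX]

/-- The functional does not increase when fronts meet. -/
theorem energy_merge (hν : 1 ≤ ν) (hu₀ : u₀ ∈ P.speedGrid ν) (hg : P.GoodAt ν u₀ C t) (ht : t < t₁)
    (hsep : ∀ τ ∈ Ico t t₁, C.Separated τ) : P.energy u₀ C t₁ ≤ P.energy u₀ C t := by
  classical
  set X := insert (C.y t₁) (C.L.image fun i => pos i t₁)
  have hX : ∀ i ∈ C.L, pos i t₁ ∈ X := fun i hi =>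
    Finset.mem_insert_of_mem (Finset.mem_image_of_mem _ hi)
  have hyX : C.y t₁ ∈ X := Finset.mem_insert_self _ _
  have hm := (hg.meeting ht hsep).merge hν hu₀
  rw [energy_before ht hsep hX, energy, stepVar_eq_sum_through hX, ← Finset.add_sum_erase X _ hyX,
    ← Finset.add_sum_erase X (fun z => ∑ i ∈ C.through t₁ z, |C.d i|) hyX]
  have hrest : ∑ z ∈ X.erase (C.y t₁), |C.rho t₁ z - C.left t₁ z| ≤
      ∑ z ∈ X.erase (C.y t₁), ∑ i ∈ C.through t₁ z, |C.d i| :=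
    Finset.sum_le_sum fun z _ => by
      rw [← sum_through]; exact Finset.abs_sum_le_sum_abs _ _
  rw [← C.rho_eq, sum_through] at hm
  linarith

/-- The slowest line through a meeting point is the rightmost one just before `t₁`. Its right state,
a node, is the right trace of the merged profile. -/
theorem GoodAt.mem_grid_end (hu₀ : u₀ ∈ P.speedGrid ν) (hg : P.GoodAt ν u₀ C t) (ht : t < t₁)
    (hsep : ∀ τ ∈ Ico t t₁, C.Separated τ) (z : ℝ) : C.rho t₁ z ∈ P.densityGrid ν := by
  rcases (C.L.filter fun i => pos i t₁ ≤ z).eq_empty_or_nonempty with he | hne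
  · have : C.rho t₁ z = 0 := by
      unfold FrontConfig.rho stepLe
      rw [he, Finset.sum_empty]
    rw [this]; exact P.zero_mem_grid ν
  · obtain ⟨i, hi, hmax⟩ := Finset.exists_max_image _ (fun i => pos i t₁) hne
    rw [Finset.mem_filter] at hi
    have h1 : C.rho t₁ z = C.rho t₁ (pos i t₁) := by
      refine stepLe_congr (fun j hj => ⟨fun hle => hmax j (Finset.mem_filter.2 ⟨hj, hle⟩),
        fun hle => hle.trans hi.2⟩) fun _ _ => rfl
    obtain ⟨k, hk, hkmax⟩ := Finset.exists_max_image (C.through t₁ (pos i t₁)) (fun j => -j.1)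
      ⟨i, mem_through.2 ⟨hi.1, rfl⟩⟩
    obtain ⟨hkL, hkp⟩ := mem_through.1 hk
    obtain ⟨-, e2⟩ := C.left_before ht hsep (mem_lines hkL)
    rw [hkp, stepLe_of_forall_le hkmax, ← C.rho_eq] at e2
    rw [h1, ← e2]
    exact hg.mem_grid hu₀ _

end Before

section After

theorem energy_after (hs : t₁ < s) (hsep' : ∀ τ ∈ Ioc t₁ s, C'.Separated τ) {X : Finset ℝ}
    (hX : ∀ i ∈ C'.L, pos i t₁ ∈ X) :
    P.energy u C' s = ∑ z ∈ X, ∑ i ∈ C'.through t₁ z, |C'.d i| +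
      P.gam u (C'.left t₁ (C'.y t₁) + stepLt (C'.through t₁ (C'.y t₁)) Prod.fst C'.d C'.c.1)
        (C'.left t₁ (C'.y t₁) + stepLe (C'.through t₁ (C'.y t₁)) Prod.fst C'.d C'.c.1) := by
  obtain ⟨e1, e2⟩ := C'.left_after hs hsep' C'.c_mem
  unfold energy y
  rw [e1, e2, stepVar_eq_of_separated (hsep' s ⟨hs, le_rfl⟩) hX]

theorem Resolution.variation (hres : P.Resolution ν u C' t₁) (hz : z ≠ C'.y t₁) :
    ∑ i ∈ C'.through t₁ z, |C'.d i| = |C'.rho t₁ z - C'.left t₁ z| := by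
  have h1 := (hres.classical z hz).variation
  rwa [sum_through_image C' t₁ z fun x => |x|, abs_sub_comm] at h1

theorem Resolution.active_traces (h3 : P.ActiveFan ν u (C'.left t₁ (C'.y t₁)) (C'.rho t₁ (C'.y t₁))
      ((C'.through t₁ (C'.y t₁)).image Prod.fst) fun s => C'.d (s, C'.y t₁ - s * t₁))
    (h2 : C'.c.1 = u) :
    C'.left t₁ (C'.y t₁) + stepLt (C'.through t₁ (C'.y t₁)) Prod.fst C'.d C'.c.1 = P.hat u ∧
    C'.left t₁ (C'.y t₁) + stepLe (C'.through t₁ (C'.y t₁)) Prod.fst C'.d C'.c.1 = P.check u := by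
  rw [← stepLt_through_image, ← stepLe_through_image, h2]
  exact ⟨h3.active.left, h3.active.right⟩

/-- The increase of the functional when the Riemann problems are solved. -/
theorem energy_resolve (hν : 1 ≤ ν) (hu₀ : u₀ ∈ P.speedGrid ν) (hu : u ∈ P.speedGrid ν)
    (hres : P.Resolution ν u C' t₁) (hs : t₁ < s) (hsep' : ∀ τ ∈ Ioc t₁ s, C'.Separated τ) :
    P.energy u C' s ≤ P.energy u₀ C' t₁ + 6 / P.β * |u - u₀| := by
  classical
  set X := insert (C'.y t₁) (C'.L.image fun i => pos i t₁)
  have hX : ∀ i ∈ C'.L, pos i t₁ ∈ X := fun i hi =>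
    Finset.mem_insert_of_mem (Finset.mem_image_of_mem _ hi)
  have hyX : C'.y t₁ ∈ X := Finset.mem_insert_self _ _
  have hl := left_mem_grid hres.mem_grid (C'.y t₁)
  have hr := hres.mem_grid (C'.y t₁)
  rw [energy_after hs hsep' hX, energy, stepVar_eq_sum_through hX, ← Finset.add_sum_erase X _ hyX,
    ← Finset.add_sum_erase X (fun z => |C'.rho t₁ z - C'.left t₁ z|) hyX]
  have hrest : ∑ z ∈ X.erase (C'.y t₁), ∑ i ∈ C'.through t₁ z, |C'.d i| =
      ∑ z ∈ X.erase (C'.y t₁), |C'.rho t₁ z - C'.left t₁ z| :=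
    Finset.sum_congr rfl fun z hz => hres.variation (Finset.mem_erase.1 hz).1
  rcases hres.vehicle with ⟨h1, h2, h3⟩ | ⟨h1, h2, h3⟩
  · obtain ⟨e1, e2⟩ := Resolution.active_traces h3 h2
    have h4 := h3.variation
    rw [sum_through_image C' t₁ _ fun x => |x|] at h4
    have h5 := gam_le_of_violates hu₀ hu hl hr h1
    rw [e1, e2, gam_hat_check, abs_sub_comm (C'.rho t₁ (C'.y t₁))]
    linarith
  · have h4 := h3.variation
    rw [sum_through_image C' t₁ _ fun x => |x|] at h4
    have h5 := gam_le_of_not_violates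
      (a := C'.left t₁ (C'.y t₁) + stepLt (C'.through t₁ (C'.y t₁)) Prod.fst C'.d C'.c.1)
      (b := C'.left t₁ (C'.y t₁) + stepLe (C'.through t₁ (C'.y t₁)) Prod.fst C'.d C'.c.1)
      hν hu₀ hu hl hr h1
    rw [abs_sub_comm (C'.rho t₁ (C'.y t₁))]
    linarith

/-- A wave left behind is slower than the vehicle, hence slower than `u`. A wave ahead which is
slower than `u` would need a vehicle moving at `v(r) < u`, but no wave of the fan exceeds `v(r)`. -/
theorem Resolution.not_approaches (hres : P.Resolution ν u C' t₁) (hs : t₁ < s)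
    (hsep' : ∀ τ ∈ Ioc t₁ s, C'.Separated τ) {i : ℝ × ℝ} (hi : i ∈ C'.through t₁ (C'.y t₁)) :
    ¬ C'.Approaches u s i := by
  obtain ⟨hiL, hip⟩ := mem_through.1 hi
  have hmem : i.1 ∈ (C'.through t₁ (C'.y t₁)).image Prod.fst := Finset.mem_image_of_mem _ hi
  have e1 := pos_lt_iff_after hs (i := C'.c) (j := i)
    fun τ hτ he => hsep' τ hτ i (mem_lines hiL) C'.c C'.c_mem he
  have e2 := pos_lt_iff_after hs (i := i) (j := C'.c)
    fun τ hτ he => hsep' τ hτ C'.c C'.c_mem i (mem_lines hiL) he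
  have hip' : pos i t₁ = pos C'.c t₁ := hip
  rw [hip'] at e1 e2
  simp only [lt_irrefl, true_and, false_or] at e1 e2
  unfold Approaches y
  rw [e1, e2]
  rcases hres.vehicle with ⟨-, h2, h3⟩ | ⟨-, h2, h3⟩
  · rw [h2]
    rintro (h | h)
    · exact h.1.not_gt h.2
    · exact h.1.not_gt h.2
  · have h4 := h3.le_v _ hmem
    have h5 := min_le_left u (P.v (C'.rho t₁ (C'.y t₁)))
    rintro (h | h)
    · rw [h2] at h; linarith [h.1, h.2]
    · rw [h2] at h
      rcases min_choice u (P.v (C'.rho t₁ (C'.y t₁))) with h6 | h6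
      · rw [h6] at h; exact h.1.not_gt h.2
      · rw [h6] at h; linarith [h.1]

end After

section Event

/-- Outgoing fronts do not approach the vehicle and weigh two each. If the constraint was enforced,
either only its own jump is present and is reproduced, or the merged states are ordered and satisfy
the constraint, so at most one front leaves. If it was not enforced, a violation makes the
functional drop. Without one, several fronts leave at most one shock, and a single front changes
from weight three to two on crossing the vehicle. -/
theorem weight_vehicle (hν : 1 ≤ ν) (hu : u ∈ P.speedGrid ν) (hg : P.GoodAt ν u C t) (ht : t < t₁)
    (hsep : ∀ τ ∈ Ico t t₁, C.Separated τ) (hrho : C'.rho t₁ = C.rho t₁)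
    (hleft : C'.left t₁ = C.left t₁) (hy : C'.y t₁ = C.y t₁) (hres : P.Resolution ν u C' t₁)
    (hs : t₁ < s) (hsep' : ∀ τ ∈ Ioc t₁ s, C'.Separated τ) {δ : ℝ}
    (hδ : ∀ a ∈ P.densityGrid ν, ∀ b ∈ P.densityGrid ν, a < b → a + δ ≤ b) :
    P.energy u C' s + 2 * δ ≤ P.energy u C t ∨
    (C'.weight u s (C'.through t₁ (C.y t₁)) ≤ C.weight u t (C.through t₁ (C.y t₁)) ∧
      ((∃ i ∈ C.through t₁ (C.y t₁), i ≠ C.c) →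
        C'.weight u s (C'.through t₁ (C.y t₁)) < C.weight u t (C.through t₁ (C.y t₁)))) := by
  classical
  have hm := hg.meeting ht hsep
  have hl := left_mem_grid hres.mem_grid (C'.y t₁)
  have hr := hres.mem_grid (C'.y t₁)
  have hw' : C'.weight u s (C'.through t₁ (C.y t₁)) = 2 * (C'.through t₁ (C.y t₁)).card := by
    rw [← hy]
    exact C'.weight_eq u s _ fun i hi => hres.not_approaches hs hsep' hi
  have hw := C.two_mul_card_le_weight u t (C.through t₁ (C.y t₁))
  have hcard := C'.card_through_image t₁ (C.y t₁)
  have hrG := C.rho_eq t₁ (C.y t₁)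
  have hveh := hres.vehicle
  rw [hy, hleft] at hl
  rw [hy, hrho] at hr
  rw [hy, hrho, hleft] at hveh
  have htwo : (∃ i ∈ C.through t₁ (C.y t₁), i ≠ C.c) → C.c ∈ C.through t₁ (C.y t₁) →
      2 ≤ (C.through t₁ (C.y t₁)).card := fun ⟨i, hi, hic⟩ hc =>
    Finset.one_lt_card.2 ⟨i, hi, C.c, hc, hic⟩
  rcases hm.vehicle with ha | hi
  · right
    have hvi := violates_active hν hu ha.lt
    rcases hm.of_active hu ha with hG | ⟨h1, h2, -⟩
    · have e1 : C.left t₁ (C.y t₁) = P.hat u := by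
        rw [← ha.left, hG, stepLt_of_forall_ge (by simp), add_zero]
      have e2 : C.rho t₁ (C.y t₁) = P.check u := by
        rw [← ha.right, hrG, hG, stepLe_of_forall_le (by simp)]
      rw [e1, e2] at hveh
      rcases hveh with ⟨-, -, h3⟩ | ⟨h, -⟩
      · have h4 := h3.single rfl rfl
        rw [h4, Finset.card_singleton] at hcard
        rw [hG, Finset.card_singleton] at hw
        rw [hG, hw', ← hcard]
        refine ⟨hw, ?_⟩
        rintro ⟨i, hi, hic⟩
        exact absurd (Finset.mem_singleton.1 hi) hic
      · exact absurd hvi h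
    · have hnv : ¬ P.Violates ν u (C.left t₁ (C.y t₁)) (C.rho t₁ (C.y t₁)) := by
        intro hv
        obtain ⟨b1, b2, -⟩ := hv.bounds hu hl hr
        rw [← hrG] at h1
        rcases h1 with h1 | h1 <;> linarith
      rcases hveh with ⟨h, -⟩ | ⟨-, -, h3⟩
      · exact absurd h hnv
      · rw [← hrG] at h2
        have h4 := h3.card_le h2
        rw [hcard] at h4
        have hpos : 1 ≤ (C.through t₁ (C.y t₁)).card := Finset.card_pos.2 ⟨_, ha.mem⟩
        exact ⟨by omega, fun h => by have := htwo h ha.mem; omega⟩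
  · by_cases hv : P.Violates ν u (C.left t₁ (C.y t₁)) (C.rho t₁ (C.y t₁))
    · left
      rcases hveh with ⟨-, h2, h3⟩ | ⟨h, -⟩
      swap
      · exact absurd hv h
      set X := insert (C.y t₁) ((C.L.image fun i => pos i t₁) ∪ C'.L.image fun i => pos i t₁)
      have hX : ∀ i ∈ C.L, pos i t₁ ∈ X := fun i hi =>
        Finset.mem_insert_of_mem (Finset.mem_union_left _ (Finset.mem_image_of_mem _ hi))
      have hX' : ∀ i ∈ C'.L, pos i t₁ ∈ X := fun i hi =>
        Finset.mem_insert_of_mem (Finset.mem_union_right _ (Finset.mem_image_of_mem _ hi))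
      have hyX : C.y t₁ ∈ X := Finset.mem_insert_self _ _
      have hb : C.left t₁ (C.y t₁) +
          stepLe (C.through t₁ (C.y t₁)) (fun j => -j.1) C.d (-C.c.1) ∈ P.densityGrid ν := by
        have e2 : C.rho t (pos C.c t) = C.left t₁ (C.y t₁) + _ :=
          (C.left_before ht hsep C.c_mem).2
        rw [show pos C.c t₁ = C.y t₁ from rfl] at e2
        rw [← e2]
        exact hg.mem_grid hu _
      have hd := Meeting.drop hν hu hδ hi hl (by rwa [← hrG]) hb (by rwa [← hrG])
      have hact := Resolution.active_traces (P := P) (ν := ν) (u := u) (C' := C') (t₁ := t₁)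
        (by rw [hy, hleft, hrho]; exact h3) h2
      have h4 := h3.variation
      rw [sum_through_image C' t₁ _ fun x => |x|] at h4
      rw [energy_before ht hsep hX, energy_after hs hsep' hX', hact.1, hact.2, gam_hat_check,
        ← Finset.add_sum_erase X _ hyX,
        ← Finset.add_sum_erase X (fun z => ∑ i ∈ C.through t₁ z, |C.d i|) hyX]
      have hrest : ∑ z ∈ X.erase (C.y t₁), ∑ i ∈ C'.through t₁ z, |C'.d i| ≤
          ∑ z ∈ X.erase (C.y t₁), ∑ i ∈ C.through t₁ z, |C.d i| :=
        Finset.sum_le_sum fun z hz => by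
          rw [hres.variation (by rw [hy]; exact (Finset.mem_erase.1 hz).1), hrho, hleft,
            ← sum_through]
          exact Finset.abs_sum_le_sum_abs _ _
      rw [← hrG] at hd
      linarith
    · right
      rcases hveh with ⟨h, -⟩ | ⟨-, -, h3⟩
      · exact absurd h hv
      have hch := hm.chain_of_inactive hi
      rcases Nat.lt_or_ge (C.through t₁ (C.y t₁)).card 2 with hc | hc
      · rcases Nat.eq_zero_or_pos (C.through t₁ (C.y t₁)).card with h0 | h0
        · rw [Finset.card_eq_zero] at h0
          rw [h0, Finset.sum_empty, add_zero] at hrG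
          have h4 := h3.empty hrG.symm
          rw [h4, Finset.card_empty] at hcard
          rw [hw', ← hcard, h0]
          exact ⟨Nat.zero_le _, by simp⟩
        · obtain ⟨i, hGi⟩ := Finset.card_eq_one.1 (show (C.through t₁ (C.y t₁)).card = 1 by omega)
          have hiG : i ∈ C.through t₁ (C.y t₁) := by rw [hGi]; exact Finset.mem_singleton_self _
          obtain ⟨hiL, hip⟩ := mem_through.1 hiG
          have hf := hch i hiG
          rw [hGi, stepLt_of_forall_ge (by simp), stepLe_of_forall_le (by simp), add_zero, ← hGi,
            ← hrG, neg_neg] at hf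
          have h4 := h3.single _ hf
          rw [h4, Finset.card_singleton] at hcard
          rw [← hcard] at hw'
          rw [hGi, Finset.card_singleton] at hw
          refine ⟨by rw [hw', hGi]; exact hw, ?_⟩
          rintro ⟨j, hj, hjc⟩
          rw [hGi, Finset.mem_singleton] at hj
          subst hj
          -- A front ahead of the vehicle is slower than `c ≤ u`. A front hitting from behind has
          -- speed at most `v(r)`, so `c` is not `v(r)`; hence `c = u` and the front is faster than
          -- `u`.
          have happ : C.Approaches u t j := by
            have hip' : pos j t₁ = pos C.c t₁ := hip
            have e1 := pos_lt_iff_before ht (i := C.c) (j := j)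
              fun τ hτ he => hsep τ hτ j (mem_lines hiL) C.c C.c_mem he
            have e2 := pos_lt_iff_before ht (i := j) (j := C.c)
              fun τ hτ he => hsep τ hτ C.c C.c_mem j (mem_lines hiL) he
            rw [hip'] at e1 e2
            simp only [lt_irrefl, true_and, false_or, neg_lt_neg_iff] at e1 e2
            have hne : j.1 ≠ C.c.1 := fun h => hjc (eq_of_pos_eq hip' h)
            have hsp := hi.speed
            unfold Approaches y
            rw [e1, e2]
            rcases hne.lt_or_gt with h5 | h5
            · exact Or.inr ⟨h5, h5.trans_le (hsp ▸ min_le_left _ _)⟩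
            · refine Or.inl ⟨h5, ?_⟩
              rw [hGi, stepLe_of_forall_le (by simpa using h5.le), ← hGi, ← hrG] at hsp
              have hjv : j.1 ≤ P.v (C.rho t₁ (C.y t₁)) := by
                refine h3.le_v _ ?_
                rw [h4]; exact Finset.mem_singleton_self _
              rcases min_choice u (P.v (C.rho t₁ (C.y t₁))) with h6 | h6
              · rw [h6] at hsp; rwa [← hsp]
              · rw [h6] at hsp; linarith
          rw [hw', hGi]
          unfold weight
          rw [Finset.sum_singleton, if_pos happ]
          norm_num
      · have h4 := h3.card_le (by rw [hrG]; exact hch.le hm.injOn_neg hc)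
        rw [hcard] at h4
        exact ⟨by omega, fun _ => by omega⟩

/-- A single front continues unchanged on the same side of the vehicle. Two or more fronts, of total
weight at least four, leave at most one, of weight at most three; this is why the weights are two
and three and not one and two. -/
theorem weight_classical (hg : P.GoodAt ν u C t) (ht : t < t₁)
    (hsep : ∀ τ ∈ Ico t t₁, C.Separated τ) (hrho : C'.rho t₁ = C.rho t₁)
    (hleft : C'.left t₁ = C.left t₁) (hy : C'.y t₁ = C.y t₁) (hres : P.Resolution ν u C' t₁)
    (hs : t₁ < s) (hsep' : ∀ τ ∈ Ioc t₁ s, C'.Separated τ) (hz : z ≠ C.y t₁) :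
    C'.weight u s (C'.through t₁ z) ≤ C.weight u t (C.through t₁ z) ∧
      (2 ≤ (C.through t₁ z).card →
        C'.weight u s (C'.through t₁ z) < C.weight u t (C.through t₁ z)) := by
  classical
  have hch := hg.chain ht hsep hz
  have h3 := hres.classical z (by rwa [hy])
  rw [hrho, hleft] at h3
  have hcard := C'.card_through_image t₁ z
  have hrG := C.rho_eq t₁ z
  have hw := C.two_mul_card_le_weight u t (C.through t₁ z)
  have hw' := C'.weight_le u s (C'.through t₁ z)
  rcases Nat.lt_or_ge (C.through t₁ z).card 2 with hc | hc
  · refine ⟨?_, fun h => by omega⟩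
    rcases Nat.eq_zero_or_pos (C.through t₁ z).card with h0 | h0
    · rw [Finset.card_eq_zero] at h0
      rw [h0, Finset.sum_empty, add_zero] at hrG
      have h4 := h3.empty hrG.symm
      rw [h4, Finset.card_empty] at hcard
      omega
    · obtain ⟨i, hGi⟩ := Finset.card_eq_one.1 (show (C.through t₁ z).card = 1 by omega)
      have hiG : i ∈ C.through t₁ z := by rw [hGi]; exact Finset.mem_singleton_self _
      obtain ⟨hiL, hip⟩ := mem_through.1 hiG
      have hf := hch i hiG
      rw [hGi, stepLt_of_forall_ge (by simp), stepLe_of_forall_le (by simp), add_zero, ← hGi,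
        ← hrG, neg_neg] at hf
      have hG' := through_eq_of_image hip (h3.single _ hf)
      have hiL' : i ∈ C'.L := by
        have : i ∈ C'.through t₁ z := by rw [hG']; exact Finset.mem_singleton_self _
        exact (mem_through.1 this).1
      have hne : pos i t₁ ≠ pos C.c t₁ := by rw [hip]; exact hz
      have hcc : pos C'.c t₁ = pos C.c t₁ := hy
      have e1 := pos_lt_iff_before ht (i := C.c) (j := i)
        fun τ hτ he => hsep τ hτ i (mem_lines hiL) C.c C.c_mem he
      have e2 := pos_lt_iff_before ht (i := i) (j := C.c)
        fun τ hτ he => hsep τ hτ C.c C.c_mem i (mem_lines hiL) he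
      have e3 := pos_lt_iff_after hs (i := C'.c) (j := i)
        fun τ hτ he => hsep' τ hτ i (mem_lines hiL') C'.c C'.c_mem he
      have e4 := pos_lt_iff_after hs (i := i) (j := C'.c)
        fun τ hτ he => hsep' τ hτ C'.c C'.c_mem i (mem_lines hiL') he
      rw [hcc] at e3 e4
      simp only [hne, hne.symm, false_and, or_false] at e1 e2 e3 e4
      have happ : C'.Approaches u s i ↔ C.Approaches u t i := by
        unfold Approaches y
        rw [e1, e2, e3, e4]
      rw [hG', hGi]
      unfold weight
      rw [Finset.sum_singleton, Finset.sum_singleton]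
      simp only [happ]
      exact le_rfl
  · have hinj : Set.InjOn (fun j : ℝ × ℝ => -j.1) (C.through t₁ z : Set (ℝ × ℝ)) :=
      fun _ hi _ hj he => C.injOn_through t₁ z hi hj (neg_injective he)
    have h4 := h3.card_le (by rw [hrG]; exact hch.le hinj hc)
    rw [hcard] at h4
    exact ⟨by omega, fun _ => by omega⟩

/-- At an interaction of fronts, either the functional drops by a fixed amount or the weight of the
fronts decreases. -/
theorem energy_or_weight (hν : 1 ≤ ν) (hu : u ∈ P.speedGrid ν) (hg : P.GoodAt ν u C t) (ht : t < t₁)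
    (hsep : ∀ τ ∈ Ico t t₁, C.Separated τ) (hrho : C'.rho t₁ = C.rho t₁)
    (hleft : C'.left t₁ = C.left t₁) (hy : C'.y t₁ = C.y t₁) (hres : P.Resolution ν u C' t₁)
    (hs : t₁ < s) (hsep' : ∀ τ ∈ Ioc t₁ s, C'.Separated τ) {δ : ℝ}
    (hδ : ∀ a ∈ P.densityGrid ν, ∀ b ∈ P.densityGrid ν, a < b → a + δ ≤ b)
    (hmeet : ¬ C.Separated t₁) :
    P.energy u C' s + 2 * δ ≤ P.energy u C t ∨ C'.weight u s C'.L < C.weight u t C.L := by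
  classical
  rcases weight_vehicle hν hu hg ht hsep hrho hleft hy hres hs hsep' hδ with h | ⟨h1, h2⟩
  · exact Or.inl h
  right
  set X := insert (C.y t₁) ((C.L.image fun i => pos i t₁) ∪ C'.L.image fun i => pos i t₁)
  have hX : ∀ i ∈ C.L, pos i t₁ ∈ X := fun i hi =>
    Finset.mem_insert_of_mem (Finset.mem_union_left _ (Finset.mem_image_of_mem _ hi))
  have hX' : ∀ i ∈ C'.L, pos i t₁ ∈ X := fun i hi =>
    Finset.mem_insert_of_mem (Finset.mem_union_right _ (Finset.mem_image_of_mem _ hi))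
  have hyX : C.y t₁ ∈ X := Finset.mem_insert_self _ _
  have e1 : C.weight u t C.L = ∑ z ∈ X, C.weight u t (C.through t₁ z) :=
    (sum_through_eq hX _).symm
  have e2 : C'.weight u s C'.L = ∑ z ∈ X, C'.weight u s (C'.through t₁ z) :=
    (sum_through_eq hX' _).symm
  rw [e1, e2]
  have hc := fun z hz => weight_classical (z := z) hg ht hsep hrho hleft hy hres hs hsep' hz
  refine Finset.sum_lt_sum (fun z _ => ?_) ?_
  · by_cases hz : z = C.y t₁
    · rw [hz]; exact h1
    · exact (hc z hz).1
  · unfold Separated at hmeet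
    push Not at hmeet
    obtain ⟨i, hi, j, hj, hpos, hne⟩ := hmeet
    have hL : ∀ k ∈ C.lines, k ≠ C.c → k ∈ C.L := fun k hk hkc =>
      (Finset.mem_insert.1 hk).resolve_left hkc
    by_cases hz : pos i t₁ = C.y t₁
    · refine ⟨C.y t₁, hyX, h2 ?_⟩
      by_cases hic : i = C.c
      · have hjc : j ≠ C.c := fun h => hne (hic.trans h.symm)
        exact ⟨j, mem_through.2 ⟨hL j hj hjc, hpos.symm.trans hz⟩, hjc⟩
      · exact ⟨i, mem_through.2 ⟨hL i hi hic, hz⟩, hic⟩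
    · have hic : i ≠ C.c := by rintro rfl; exact hz rfl
      have hjc : j ≠ C.c := by rintro rfl; exact hz hpos
      refine ⟨pos i t₁, hX i (hL i hi hic), (hc _ hz).2 (Finset.one_lt_card.2
        ⟨i, mem_through.2 ⟨hL i hi hic, rfl⟩, j, mem_through.2 ⟨hL j hj hjc, hpos.symm⟩, hne⟩)⟩

end Event

end LWRModel

/-! ### Global solutions -/

/-- A step function which is left continuous on `]0, ∞[`, of finite variation, with discontinuities
in `D`. -/
structure StepControl (w : ℝ → ℝ) (D : Finset ℝ) : Prop where
  const : ∀ a ∈ Ici (0 : ℝ), ∀ b ∈ Ici (0 : ℝ), a ≤ b → (∀ d ∈ D, d ∉ Icc a b) → w a = w b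
  left : ∀ t > 0, ContinuousWithinAt w (Iic t) t
  right_zero : ContinuousWithinAt w (Ici 0) 0
  variation : eVariationOn w (Ici 0) ≠ ⊤

theorem exists_forall_notMem_Ioc (D : Finset ℝ) (t : ℝ) : ∃ t' > t, ∀ d ∈ D, d ∉ Ioc t t' := by
  rcases (D.filter (t < ·)).eq_empty_or_nonempty with he | hne
  · refine ⟨t + 1, by linarith, fun d hd hdt => ?_⟩
    have : d ∈ D.filter (t < ·) := Finset.mem_filter.2 ⟨hd, hdt.1⟩
    simp [he] at this
  · have h1 := (Finset.mem_filter.1 (Finset.min'_mem _ hne)).2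
    refine ⟨(t + (D.filter (t < ·)).min' hne) / 2, by linarith, fun d hd hdt => ?_⟩
    have := Finset.min'_le _ _ (Finset.mem_filter.2 ⟨hd, hdt.1⟩ : d ∈ D.filter (t < ·))
    linarith [hdt.2]

namespace StepControl

variable {w : ℝ → ℝ} {D : Finset ℝ} {t t' s : ℝ}

/-- Left continuity includes the end point `t'`, which may itself be a jump: the value there is
still the old one. -/
theorem eq_rightLim (h : StepControl w D) (ht : 0 ≤ t) (hD : ∀ d ∈ D, d ∉ Ioo t t')
    (hs : s ∈ Ioc t t') : w s = Function.rightLim w t := by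
  have hconst : ∀ a ∈ Ioo t t', ∀ b ∈ Ioo t t', a ≤ b → w a = w b := fun a ha b hb hab =>
    h.const a (ht.trans ha.1.le) b (ht.trans hb.1.le) hab fun d hd hdm =>
      hD d hd ⟨ha.1.trans_le hdm.1, hdm.2.trans_lt hb.2⟩
  have htt' := hs.1.trans_le hs.2
  obtain ⟨m, hm⟩ := exists_between htt'
  have hc : ∀ a ∈ Ioo t t', w a = w m := fun a ha => by
    rcases le_total a m with h1 | h1
    · exact hconst a ha m hm h1
    · exact (hconst m hm a ha h1).symm
  have hr : Function.rightLim w t = w m := by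
    refine rightLim_eq_of_tendsto ?_
    refine tendsto_const_nhds.congr' ?_
    filter_upwards [Ioo_mem_nhdsGT htt'] with a ha using (hc a ha).symm
  rw [hr]
  rcases hs.2.eq_or_lt with rfl | hlt
  · have h1 : Tendsto w (𝓝[<] s) (𝓝 (w s)) :=
      (h.left s (ht.trans_lt hs.1)).mono_left (nhdsWithin_mono _ Iio_subset_Iic_self)
    refine tendsto_nhds_unique h1 (tendsto_const_nhds.congr' ?_)
    filter_upwards [Ioo_mem_nhdsLT htt'] with a ha using (hc a ha).symm
  · exact hc s ⟨hs.1, hlt⟩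

theorem rightLim_eq (h : StepControl w D) (ht : 0 ≤ t) (hD : ∀ d ∈ D, d ∉ Ioo t t')
    (hs : s ∈ Ioo t t') : Function.rightLim w s = Function.rightLim w t := by
  obtain ⟨m, hm⟩ := exists_between hs.2
  rw [← h.eq_rightLim ht hD ⟨hs.1.trans hm.1, hm.2.le⟩,
    ← h.eq_rightLim (t := s) (t' := t') (ht.trans hs.1.le)
      (fun d hd hdm => hD d hd ⟨hs.1.trans hdm.1, hdm.2⟩) ⟨hm.1, hm.2.le⟩]

theorem rightLim_zero (h : StepControl w D) : Function.rightLim w 0 = w 0 :=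
  h.right_zero.rightLim_eq

theorem rightLim_mem (h : StepControl w D) (ht : 0 ≤ t) {S : Set ℝ} (hS : ∀ t ≥ 0, w t ∈ S) :
    Function.rightLim w t ∈ S := by
  obtain ⟨t', ht', hD⟩ := exists_forall_notMem_Ioc D t
  rw [← h.eq_rightLim ht (fun d hd hdm => hD d hd ⟨hdm.1, hdm.2.le⟩) ⟨ht', le_rfl⟩]
  exact hS _ (ht.trans ht'.le)

/-- This decrease of the control term pays for the control jumps between `t` and `s`. -/
theorem variation_le (h : StepControl w D) (ht : 0 ≤ t) (hts : t ≤ s) :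
    |w s - w t| + (eVariationOn w (Ici s)).toReal ≤ (eVariationOn w (Ici t)).toReal := by
  have htop : ∀ τ, 0 ≤ τ → eVariationOn w (Ici τ) ≠ ⊤ := fun τ hτ =>
    ne_top_of_le_ne_top h.variation (eVariationOn.mono _ (Ici_subset_Ici.2 hτ))
  have h1 : eVariationOn w (Ici t) = eVariationOn w (Icc t s) + eVariationOn w (Ici s) := by
    rw [← eVariationOn.union _ (isGreatest_Icc hts) isLeast_Ici, Icc_union_Ici_eq_Ici hts]
  have h2 : edist (w s) (w t) + eVariationOn w (Ici s) ≤ eVariationOn w (Ici t) := by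
    rw [h1]
    gcongr
    exact eVariationOn.edist_le _ ⟨hts, le_rfl⟩ ⟨le_rfl, hts⟩
  have h3 := ENNReal.toReal_mono (htop t ht) h2
  rwa [ENNReal.toReal_add (edist_ne_top _ _) (htop s (ht.trans hts)), edist_dist,
    ENNReal.toReal_ofReal dist_nonneg, Real.dist_eq] at h3

end StepControl

namespace LWRModel

open FrontConfig

variable {P : LWRModel} {ν : ℕ} {w : ℝ → ℝ} {D : Finset ℝ}

/-- A wave-front tracking solution on `[t₀, ∞[` made of finitely many fronts, along which the
functional is at most `E`. -/
structure FrontSolution (P : LWRModel) (ν : ℕ) (w : ℝ → ℝ) (t₀ E : ℝ) (ρ : ℝ → ℝ → ℝ)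
    (y : ℝ → ℝ) : Prop where
  right : ∀ t ≥ t₀, ∃ C : FrontConfig, P.Resolved ν (Function.rightLim w t) C t ∧
    ∀ᶠ s in 𝓝[≥] t, ρ s = C.rho s ∧ y s = C.y s
  left : ∀ t > t₀, ∃ C : FrontConfig, ∀ᶠ s in 𝓝[≤] t, ρ s = C.rho s ∧ y s = C.y s
  lines : ∃ L : Finset (ℝ × ℝ), ∀ t ≥ t₀, ∃ C : FrontConfig, C.lines ⊆ L ∧ ρ t = C.rho t ∧
    y t = C.y t
  upsilon : ∀ t > t₀, P.upsilon w ρ y t ≤ E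

theorem upsilon_eq {ρ : ℝ → ℝ → ℝ} {y : ℝ → ℝ} {C : FrontConfig} {t : ℝ} (hρ : ρ t = C.rho t)
    (hy : y t = C.y t) : P.upsilon w ρ y t = P.energy (w t) C t + 2 * P.R +
      6 / P.β * (eVariationOn w (Ici t)).toReal := by
  have h1 : (eVariationOn (C.rho t) univ).toReal = stepVar C.L (fun i => pos i t) C.d :=
    toReal_eVariationOn_stepLe _ _ _
  have h2 : P.gamma (w t) (C.rho t) (C.y t) =
      P.gam (w t) (C.left t (C.y t)) (C.rho t (C.y t)) := by
    rw [gamma_eq]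
    unfold rho
    rw [leftLim_stepLe, rightLim_stepLe]
    rfl
  rw [upsilon, hρ, hy, h1, h2, energy]
  ring

/-- The variation depends on the density only, not on the lines which represent it. The
configurations before and after an interaction can thus be compared at the interaction time. -/
theorem energy_eq_of_eq {u t : ℝ} {C C' : FrontConfig} (hrho : C'.rho t = C.rho t)
    (hleft : C'.left t = C.left t) (hy : C'.y t = C.y t) :
    P.energy u C' t = P.energy u C t := by
  unfold energy
  rw [hrho, hleft, hy, ← toReal_eVariationOn_stepLe, ← toReal_eVariationOn_stepLe]
  change (eVariationOn (C'.rho t) univ).toReal + _ = (eVariationOn (C.rho t) univ).toReal + _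
  rw [hrho]

theorem upsilon_congr {ρ ρ' : ℝ → ℝ → ℝ} {y y' : ℝ → ℝ} {t : ℝ} (hρ : ρ t = ρ' t)
    (hy : y t = y' t) : P.upsilon w ρ y t = P.upsilon w ρ' y' t := by
  unfold upsilon
  rw [hρ, hy]

theorem GoodAt.of_separated {u a b s t : ℝ} {C : FrontConfig} (hg : P.GoodAt ν u C s)
    (hs : s ∈ Ioo a b) (ht : t ∈ Ioo a b) (hsep : ∀ τ ∈ Ioo a b, C.Separated τ) :
    P.GoodAt ν u C t ∧ P.energy u C t = P.energy u C s ∧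
      C.weight u t C.L = C.weight u s C.L := by
  have h1 : ∀ τ ∈ uIcc s t, C.Separated τ := fun τ hτ =>
    hsep τ (ordConnected_Ioo.uIcc_subset hs ht hτ)
  exact ⟨hg.congr h1, (energy_congr h1).symm, (weight_congr h1).symm⟩

/-- The fronts of `C` continue the profile up to the time `t₁`. -/
theorem FrontSolution.prepend {t₀ t₁ E u s : ℝ} {C : FrontConfig} {ρ₁ : ℝ → ℝ → ℝ} {y₁ : ℝ → ℝ}
    (hν : 1 ≤ ν) (hw : StepControl w D) (hu : u ∈ P.speedGrid ν) (ht₀ : 0 ≤ t₀)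
    (h₁ : P.FrontSolution ν w t₁ E ρ₁ y₁) (hρ₁ : ρ₁ t₁ = C.rho t₁) (hy₁ : y₁ t₁ = C.y t₁)
    (huw : u = Function.rightLim w t₀) (hr : P.Resolved ν u C t₀) (hs : s ∈ Ioo t₀ t₁)
    (hD : ∀ d ∈ D, d ∉ Ioo t₀ t₁) (hsep : ∀ τ ∈ Ioo t₀ t₁, C.Separated τ)
    (hg : P.GoodAt ν u C s)
    (hE : ∀ t ∈ Ioc t₀ t₁, P.energy u C s + 2 * P.R +
      6 / P.β * (eVariationOn w (Ici t)).toReal ≤ E) :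
    ∃ ρ y, ρ t₀ = C.rho t₀ ∧ y t₀ = C.y t₀ ∧ P.FrontSolution ν w t₀ E ρ y := by
  have htt : t₀ < t₁ := hs.1.trans hs.2
  have hlt : ∀ t, t < t₁ → (if t < t₁ then C.rho t else ρ₁ t) = C.rho t ∧
      (if t < t₁ then C.y t else y₁ t) = C.y t := fun t ht => by rw [if_pos ht, if_pos ht]; simp
  have hge : ∀ t, t₁ ≤ t → (if t < t₁ then C.rho t else ρ₁ t) = ρ₁ t ∧
      (if t < t₁ then C.y t else y₁ t) = y₁ t := fun t ht => by
    rw [if_neg ht.not_gt, if_neg ht.not_gt]; simp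
  have hle : ∀ t, t ≤ t₁ → (if t < t₁ then C.rho t else ρ₁ t) = C.rho t ∧
      (if t < t₁ then C.y t else y₁ t) = C.y t := fun t ht => by
    rcases ht.eq_or_lt with h | h
    · exact ⟨(hge t h.ge).1.trans (by rw [h]; exact hρ₁), (hge t h.ge).2.trans (by rw [h]; exact hy₁)⟩
    · exact hlt t h
  refine ⟨fun t => if t < t₁ then C.rho t else ρ₁ t, fun t => if t < t₁ then C.y t else y₁ t,
    (hlt _ htt).1, (hlt _ htt).2, ⟨fun t ht => ?_, fun t ht => ?_, ?_, fun t ht => ?_⟩⟩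
  · rcases lt_or_ge t t₁ with htt₁ | htt₁
    · refine ⟨C, ?_, ?_⟩
      · rcases (show t₀ ≤ t from ht).eq_or_lt with rfl | h
        · rwa [← huw]
        · rw [hw.rightLim_eq ht₀ hD ⟨h, htt₁⟩, ← huw]
          exact (hg.of_separated hs ⟨h, htt₁⟩ hsep).1.resolved hν hu
      · filter_upwards [mem_nhdsWithin_of_mem_nhds (Iio_mem_nhds htt₁)] with τ hτ using hlt τ hτ
    · obtain ⟨C₁, hr₁, hC₁⟩ := h₁.right t htt₁
      refine ⟨C₁, hr₁, ?_⟩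
      filter_upwards [hC₁, self_mem_nhdsWithin] with τ hτ hτt
      rw [(hge τ (htt₁.trans hτt)).1, (hge τ (htt₁.trans hτt)).2]
      exact hτ
  · rcases le_or_gt t t₁ with htt₁ | htt₁
    · refine ⟨C, ?_⟩
      filter_upwards [self_mem_nhdsWithin] with τ hτ using hle τ (le_trans hτ htt₁)
    · obtain ⟨C₁, hC₁⟩ := h₁.left t htt₁
      refine ⟨C₁, ?_⟩
      filter_upwards [hC₁, mem_nhdsWithin_of_mem_nhds (Ioi_mem_nhds htt₁)] with τ hτ hτt
      rw [(hge τ (le_of_lt hτt)).1, (hge τ (le_of_lt hτt)).2]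
      exact hτ
  · classical
    obtain ⟨L₁, hL₁⟩ := h₁.lines
    refine ⟨C.lines ∪ L₁, fun t ht => ?_⟩
    rcases lt_or_ge t t₁ with htt₁ | htt₁
    · exact ⟨C, Finset.subset_union_left, hlt t htt₁⟩
    · obtain ⟨C₁, h1, h2⟩ := hL₁ t htt₁
      refine ⟨C₁, h1.trans Finset.subset_union_right, ?_⟩
      rw [(hge t htt₁).1, (hge t htt₁).2]
      exact h2
  · rcases lt_trichotomy t t₁ with htt₁ | rfl | htt₁
    · rw [upsilon_eq (hlt t htt₁).1 (hlt t htt₁).2, hw.eq_rightLim ht₀ hD ⟨ht, htt₁.le⟩, ← huw,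
        (hg.of_separated hs ⟨ht, htt₁⟩ hsep).2.1]
      exact hE t ⟨ht, htt₁.le⟩
    · rw [upsilon_eq (hle t le_rfl).1 (hle t le_rfl).2, hw.eq_rightLim ht₀ hD ⟨ht, le_rfl⟩, ← huw]
      have h1 := energy_merge hν hu hg hs.2 fun τ hτ => hsep τ ⟨hs.1.trans_le hτ.1, hτ.2⟩
      have h2 := hE t ⟨ht, le_rfl⟩
      linarith
    · rw [upsilon_congr (hge t htt₁.le).1 (hge t htt₁.le).2]
      exact h₁.upsilon t htt₁

/-- The fronts of `C` can be continued for ever, if they never meet and the control is constant. -/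
theorem frontSolution_of_separated {t₀ E u s : ℝ} {C : FrontConfig}
    (hν : 1 ≤ ν) (hw : StepControl w D) (hu : u ∈ P.speedGrid ν) (ht₀ : 0 ≤ t₀)
    (huw : u = Function.rightLim w t₀) (hr : P.Resolved ν u C t₀) (hs : t₀ < s)
    (hD : ∀ d ∈ D, d ≤ t₀) (hsep : ∀ τ > t₀, C.Separated τ)
    (hg : P.GoodAt ν u C s)
    (hE : ∀ t > t₀, P.energy u C s + 2 * P.R +
      6 / P.β * (eVariationOn w (Ici t)).toReal ≤ E) :
    P.FrontSolution ν w t₀ E C.rho C.y := by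
  have hev : ∀ l : Filter ℝ, ∀ᶠ s in l, C.rho s = C.rho s ∧ C.y s = C.y s := fun l =>
    Eventually.of_forall fun _ => ⟨rfl, rfl⟩
  have hD' : ∀ b, ∀ d ∈ D, d ∉ Ioo t₀ b := fun b d hd hdm => (hD d hd).not_gt hdm.1
  have hgood : ∀ t > t₀, P.GoodAt ν u C t ∧ P.energy u C t = P.energy u C s := fun t ht => by
    have := hg.of_separated (a := t₀) (b := max s t + 1) (t := t)
      ⟨hs, by linarith [le_max_left s t]⟩ ⟨ht, by linarith [le_max_right s t]⟩
      fun τ hτ => hsep τ hτ.1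
    exact ⟨this.1, this.2.1⟩
  refine ⟨fun t ht => ⟨C, ?_, hev _⟩, fun t _ => ⟨C, hev _⟩,
    ⟨C.lines, fun t _ => ⟨C, subset_rfl, rfl, rfl⟩⟩, fun t ht => ?_⟩
  · rcases (show t₀ ≤ t from ht).eq_or_lt with rfl | h
    · rwa [← huw]
    · rw [hw.rightLim_eq ht₀ (hD' (t + 1)) ⟨h, by linarith⟩, ← huw]
      exact (hgood t h).1.resolved hν hu
  · rw [upsilon_eq rfl rfl, hw.eq_rightLim ht₀ (hD' t) ⟨ht, le_rfl⟩, ← huw, (hgood t ht).2]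
    exact hE t ht

/-- Converts a drop by `2δ` into a drop of a natural number. -/
theorem floor_lt_floor {x y δ : ℝ} (hδ : 0 < δ) (hx : 0 ≤ x) (h : x + 2 * δ ≤ y) :
    ⌊x / (2 * δ)⌋₊ < ⌊y / (2 * δ)⌋₊ := by
  have h2 : 0 < 2 * δ := by linarith
  have h1 : x / (2 * δ) + 1 ≤ y / (2 * δ) := by
    rw [le_div_iff₀ h2, add_mul, div_mul_cancel₀ _ h2.ne']; linarith
  have h3 : ⌊x / (2 * δ) + 1⌋₊ = ⌊x / (2 * δ)⌋₊ + 1 := Nat.floor_add_one (by positivity)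
  have h4 := Nat.floor_le_floor h1
  omega

/-- A resolved profile can be continued for all times. -/
theorem exists_frontSolution (hν : 1 ≤ ν) (hw : StepControl w D)
    (hmem : ∀ t ≥ 0, w t ∈ P.speedGrid ν) {δ E : ℝ} (hδ₀ : 0 < δ)
    (hδ : ∀ a ∈ P.densityGrid ν, ∀ b ∈ P.densityGrid ν, a < b → a + δ ≤ b)
    (m : ℕ ×ₗ ℕ ×ₗ ℕ) : ∀ (t₀ s u : ℝ) (C : FrontConfig), 0 ≤ t₀ → u = Function.rightLim w t₀ →
      P.Resolved ν u C t₀ → t₀ < s → (∀ τ ∈ Ioc t₀ s, C.Separated τ) → (∀ d ∈ D, d ∉ Ioc t₀ s) →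
      P.GoodAt ν u C s →
      (∀ t ∈ Ioc t₀ s, P.energy u C s + 2 * P.R +
        6 / P.β * (eVariationOn w (Ici t)).toReal ≤ E) →
      toLex ((D.filter (t₀ < ·)).card, toLex (⌊(P.energy u C s + 2 * P.R) / (2 * δ)⌋₊,
        C.weight u s C.L)) = m →
      ∃ ρ y, ρ t₀ = C.rho t₀ ∧ y t₀ = C.y t₀ ∧ P.FrontSolution ν w t₀ E ρ y := by
  classical
  -- The lexicographic measure consists of the number of points of `D` still to come, the integer
  -- part of the shifted functional in units of `2δ`, and the weight.
  induction m using WellFoundedLT.induction with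
  | _ m ih =>
  intro t₀ s u C ht₀ huw hr hs hsep hDs hg hE hm
  have hu : u ∈ P.speedGrid ν := huw ▸ hw.rightLim_mem ht₀ hmem
  have hβ : 0 ≤ 6 / P.β := div_nonneg (by norm_num) P.β_pos.le
  have hE' : ∀ t > t₀, P.energy u C s + 2 * P.R +
      6 / P.β * (eVariationOn w (Ici t)).toReal ≤ E := by
    intro t ht
    rcases le_total t s with h | h
    · exact hE t ⟨ht, h⟩
    · have h1 := hE s ⟨hs, le_rfl⟩
      have h2 := hw.variation_le (ht₀.trans hs.le) h
      have h3 := mul_le_mul_of_nonneg_left ((le_add_of_nonneg_left (abs_nonneg _)).trans h2) hβ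
      linarith
  -- The events after `t₀`: possible jumps of the control and meetings of lines. The first of them
  -- ends the life of `C`.
  set A := (C.meetTimes ∪ D).filter fun t => t₀ < t ∧ (t ∈ D ∨ ¬ C.Separated t) with hA
  have hnot : ∀ τ, t₀ < τ → τ ∉ A → C.Separated τ ∧ τ ∉ D := by
    intro τ hτ hτA
    constructor
    · by_contra hc
      exact hτA (Finset.mem_filter.2
        ⟨Finset.mem_union_left _ (mem_meetTimes hc), hτ, Or.inr hc⟩)
    · intro hc
      exact hτA (Finset.mem_filter.2 ⟨Finset.mem_union_right _ hc, hτ, Or.inl hc⟩)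
  rcases A.eq_empty_or_nonempty with hA0 | hne
  · refine ⟨C.rho, C.y, rfl, rfl, frontSolution_of_separated hν hw hu ht₀ huw hr hs
      (fun d hd => ?_) (fun τ hτ => (hnot τ hτ (by simp [hA0])).1) hg hE'⟩
    by_contra! hc
    exact (hnot d hc (by simp [hA0])).2 hd
  set t₁ := A.min' hne with ht₁
  obtain ⟨-, ht₀₁, hevent⟩ := Finset.mem_filter.1 (A.min'_mem hne)
  have hfree : ∀ τ ∈ Ioo t₀ t₁, C.Separated τ ∧ τ ∉ D := fun τ hτ =>
    hnot τ hτ.1 fun h => (A.min'_le τ h).not_gt hτ.2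
  have hs₁ : s < t₁ := by
    by_contra! hc
    rcases hevent with h | h
    · exact hDs _ h ⟨ht₀₁, hc⟩
    · exact h (hsep _ ⟨ht₀₁, hc⟩)
  have hsep₁ : ∀ τ ∈ Ico s t₁, C.Separated τ := fun τ hτ => (hfree τ ⟨hs.trans_le hτ.1, hτ.2⟩).1
  have hDfree : ∀ d ∈ D, d ∉ Ioo t₀ t₁ := fun d hd hdm => (hfree d hdm).2 hd
  set u₁ := Function.rightLim w t₁ with hu₁def
  have ht₁0 : 0 ≤ t₁ := ht₀.trans ht₀₁.le
  have hu₁ : u₁ ∈ P.speedGrid ν := hw.rightLim_mem ht₁0 hmem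
  obtain ⟨C₁, hrho, hleft, hy, hres⟩ := exists_resolution hu₁ C.L (fun i => pos i t₁) C.d t₁
    (C.y t₁) (hg.mem_grid_end hu hs₁ hsep₁)
  change C₁.rho t₁ = C.rho t₁ at hrho
  change C₁.left t₁ = C.left t₁ at hleft
  obtain ⟨s₂, hs₂, hsep₂⟩ := C₁.eventually_separated t₁
  obtain ⟨s₃, hs₃, hD₃⟩ := exists_forall_notMem_Ioc D t₁
  -- The reference time `s₁` precedes every later meeting of the new lines and every later point of
  -- `D`.
  obtain ⟨s₁, hs₁₁, hs₁₂⟩ := exists_between (lt_min hs₂ hs₃)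
  have hsep' : ∀ τ ∈ Ioc t₁ s₁, C₁.Separated τ := fun τ hτ =>
    hsep₂ τ ⟨hτ.1, hτ.2.trans_lt (hs₁₂.trans_le (min_le_left _ _))⟩
  have hD' : ∀ d ∈ D, d ∉ Ioc t₁ s₁ := fun d hd hdm =>
    hD₃ d hd ⟨hdm.1, hdm.2.trans (hs₁₂.le.trans (min_le_right _ _))⟩
  have hwt₁ : w t₁ = u := by rw [huw]; exact hw.eq_rightLim ht₀ hDfree ⟨ht₀₁, le_rfl⟩
  have hE1 := energy_merge hν hu hg hs₁ hsep₁
  have hE2 := energy_resolve hν hu hu₁ hres hs₁₁ hsep'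
  rw [energy_eq_of_eq hrho hleft hy] at hE2
  -- At a point of `D` the first component decreases, whatever happens to the others. Otherwise the
  -- control is constant across `t₁` and `energy_or_weight` applies.
  obtain ⟨ρ₁, y₁, hρ₁, hy₁, hsol⟩ := ih _ (by
      rw [← hm]
      rw [Prod.Lex.toLex_lt_toLex, Prod.Lex.toLex_lt_toLex]
      have hsub : D.filter (t₁ < ·) ⊆ D.filter (t₀ < ·) :=
        Finset.monotone_filter_right D fun d _ hd => ht₀₁.trans hd
      by_cases ht₁D : t₁ ∈ D
      · left
        refine Finset.card_lt_card ⟨hsub, fun h => ?_⟩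
        have := (Finset.mem_filter.1 (h (Finset.mem_filter.2 ⟨ht₁D, ht₀₁⟩))).2
        exact lt_irrefl _ this
      · have hu₁u : u₁ = u := by
          obtain ⟨t', ht', hDt'⟩ := exists_forall_notMem_Ioc D t₁
          rw [huw, hu₁def]
          refine hw.rightLim_eq (t' := t') ht₀ (fun d hd hdm => ?_) ⟨ht₀₁, ht'⟩
          rcases lt_trichotomy d t₁ with h | rfl | h
          · exact hDfree d hd ⟨hdm.1, h⟩
          · exact ht₁D hd
          · exact hDt' d hd ⟨h, hdm.2.le⟩
        have hres' := hres
        rw [hu₁u] at hres' hE2 ⊢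
        rw [sub_self, abs_zero, mul_zero, add_zero] at hE2
        rcases (Finset.card_le_card hsub).lt_or_eq with h | h
        · exact Or.inl h
        · refine Or.inr ⟨h, ?_⟩
          have hfl : ⌊(P.energy u C₁ s₁ + 2 * P.R) / (2 * δ)⌋₊ ≤
              ⌊(P.energy u C s + 2 * P.R) / (2 * δ)⌋₊ := by
            refine Nat.floor_le_floor ?_
            gcongr
            linarith
          rcases energy_or_weight hν hu hg hs₁ hsep₁ hrho hleft hy hres' hs₁₁ hsep' hδ
            (hevent.resolve_left ht₁D) with h5 | h5
          · left
            refine floor_lt_floor hδ₀ (energy_add_nonneg _ _ _) ?_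
            linarith
          · rcases hfl.lt_or_eq with h6 | h6
            · exact Or.inl h6
            · exact Or.inr ⟨h6, h5⟩)
    t₁ s₁ u₁ C₁ ht₁0 rfl hres.resolved hs₁₁ hsep' hD' (hres.goodAt hu₁ hs₁₁ hsep')
    -- The functional grows by at most `6/β |u₁ - u|` at `t₁`. By left continuity `w` still equals
    -- `u` at `t₁` and equals `u₁` afterwards, so the variation of the control on `[t, ∞[` is
    -- smaller than that on `[t₁, ∞[` by at least `|u₁ - u|`.
    (fun t ht => by
      have h1 := hE' t₁ ht₀₁
      have h2 := hw.variation_le ht₁0 ht.1.le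
      rw [hw.eq_rightLim (t' := s₁) ht₁0 (fun d hd hdm => hD' d hd ⟨hdm.1, hdm.2.le⟩) ht, hwt₁] at h2
      have h3 := mul_le_mul_of_nonneg_left h2 hβ
      rw [mul_add] at h3
      linarith) rfl
  exact FrontSolution.prepend hν hw hu ht₀ hsol (hρ₁.trans hrho) (hy₁.trans hy) huw hr
    ⟨hs, hs₁⟩ hDfree (fun τ hτ => (hfree τ hτ).1) hg fun t ht => hE' t ht.1

end LWRModel

/-! ### Representation of the initial density as a step function -/

/-- A right continuous piecewise constant function is a step function. -/
theorem exists_stepLe_of_piecewiseConst (D : Finset ℝ) : ∀ p : ℝ → ℝ,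
    (∀ x, ContinuousWithinAt p (Ici x) x) →
    (∀ a b, a ≤ b → (∀ d ∈ D, d ∉ Icc a b) → p a = p b) →
    ∃ (c : ℝ) (j : ℝ → ℝ), ∀ z, p z = c + stepLe D id j z := by
  classical
  induction D using Finset.induction_on_max with
  | empty =>
    intro p _ hp
    refine ⟨p 0, 0, fun z => ?_⟩
    rw [stepLe_empty, add_zero]
    rcases le_total 0 z with h | h
    · exact (hp 0 z h (by simp)).symm
    · exact hp z 0 h (by simp)
  | insert m D hm ih =>
    intro p hrc hp
    have hmD : m ∉ D := fun h => lt_irrefl _ (hm m h)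
    obtain ⟨m', hm', hDm'⟩ : ∃ m' < m, ∀ d ∈ D, d < m' := by
      rcases D.eq_empty_or_nonempty with he | hne
      · exact ⟨m - 1, by linarith, by simp [he]⟩
      · obtain ⟨m', h1, h2⟩ := exists_between (hm _ (D.max'_mem hne))
        exact ⟨m', h2, fun d hd => (D.le_max' d hd).trans_lt h1⟩
    have hmin : ContinuousOn (fun z => min z m') univ := by fun_prop
    have hqrc : ∀ x, ContinuousWithinAt (fun z => p (min z m')) (Ici x) x := by
      intro x
      exact ContinuousWithinAt.comp (g := p) (f := fun z => min z m') (t := Ici (min x m'))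
        (hrc (min x m')) ((hmin x (mem_univ _)).mono (subset_univ _))
        fun z hz => mem_Ici.2 (min_le_min_right _ hz)
    have hqc : ∀ a b, a ≤ b → (∀ d ∈ D, d ∉ Icc a b) → p (min a m') = p (min b m') := by
      intro a b hab h
      rcases le_total b m' with h1 | h1
      · rw [min_eq_left h1, min_eq_left (hab.trans h1)]
        refine hp a b hab fun d hd hdm => ?_
        rcases Finset.mem_insert.1 hd with rfl | hd
        · exact (hdm.2.trans h1).not_gt hm'
        · exact h d hd hdm
      · rw [min_eq_right h1]
        rcases le_total a m' with h2 | h2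
        · rw [min_eq_left h2]
          refine hp a m' h2 fun d hd hdm => ?_
          rcases Finset.mem_insert.1 hd with rfl | hd
          · exact hdm.2.not_gt hm'
          · exact h d hd ⟨hdm.1, hdm.2.trans h1⟩
        · rw [min_eq_right h2]
    obtain ⟨c, j, hq⟩ := ih (fun z => p (min z m')) hqrc hqc
    refine ⟨c, fun z => if z = m then p m - p m' else j z, fun z => ?_⟩
    have h1 := hq z
    have h2 : stepLe D id (fun z => if z = m then p m - p m' else j z) z = stepLe D id j z :=
      stepLe_congr (fun _ _ => Iff.rfl) fun d hd => if_neg (by rintro rfl; exact hmD hd)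
    rw [stepLe_insert hmD, h2, ← add_assoc, ← h1]
    simp only [id, if_true]
    rcases lt_or_ge z m with h | h
    · rw [if_neg h.not_ge, add_zero]
      rcases le_total z m' with h3 | h3
      · rw [min_eq_left h3]
      · rw [min_eq_right h3]
        refine (hp m' z h3 fun d hd hdm => ?_).symm
        rcases Finset.mem_insert.1 hd with rfl | hd
        · exact (hdm.2.trans_lt h).false
        · exact (hDm' d hd).not_ge hdm.1
    · rw [if_pos h, min_eq_right (hm'.le.trans h), add_sub_cancel]
      have hconst : ∀ a > m, ∀ b, a ≤ b → p a = p b := fun a ha b hab =>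
        hp a b hab fun d hd hdm => by
          rcases Finset.mem_insert.1 hd with rfl | hd
          · exact hdm.1.not_gt ha
          · exact ((hm d hd).trans ha).not_ge hdm.1
      rcases h.eq_or_lt with rfl | h
      · rfl
      · have h5 : Tendsto p (𝓝[>] m) (𝓝 (p m)) :=
          (hrc m).mono_left (nhdsWithin_mono _ Ioi_subset_Ici_self)
        refine tendsto_nhds_unique (tendsto_const_nhds.congr' ?_) h5
        filter_upwards [Ioo_mem_nhdsGT h] with a ha using (hconst a ha.1 z ha.2.le).symm

/-- The additive constant is the value to the left of all jumps, and integrability on a half-line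
forces it to vanish. -/
theorem exists_stepLe_of_integrable {p : ℝ → ℝ} (hp : Integrable p)
    (hpc : IsPiecewiseConstOn p univ) (hrc : ∀ x, ContinuousWithinAt p (Ici x) x) :
    ∃ (D : Finset ℝ) (j : ℝ → ℝ), p = stepLe D id j := by
  obtain ⟨D, hD⟩ := hpc
  obtain ⟨c, j, h⟩ := exists_stepLe_of_piecewiseConst D p hrc
    fun a b => hD a (mem_univ _) b (mem_univ _)
  refine ⟨D, j, ?_⟩
  suffices c = 0 by
    funext z; rw [h z, this, zero_add]
  obtain ⟨a, ha⟩ : ∃ a, ∀ d ∈ D, a < d := by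
    rcases D.eq_empty_or_nonempty with he | hne
    · exact ⟨0, by simp [he]⟩
    · exact ⟨D.min' hne - 1, fun d hd => by linarith [D.min'_le d hd]⟩
  have h1 : IntegrableOn (fun _ => c) (Iic a) := by
    refine hp.integrableOn.congr_fun (fun z hz => ?_) measurableSet_Iic
    rw [h z, stepLe_of_forall_gt (x := id) (fun d hd => lt_of_le_of_lt hz (ha d hd)), add_zero]
  rw [integrableOn_const_iff] at h1
  simpa using h1

/-! ### The global solution and its front-tracking properties -/

namespace LWRModel

open FrontConfig

variable {P : LWRModel} {ν : ℕ} {ρ₀ u : ℝ → ℝ} {p w : ℕ → ℝ → ℝ}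

theorem IsApproximation.exists_stepControl (h : P.IsApproximation ρ₀ u p w) (ν : ℕ) :
    ∃ D, StepControl (w ν) D := by
  obtain ⟨D, hD⟩ := h.w_piecewiseConst ν
  exact ⟨D, hD, h.w_left_continuous ν, h.w_right_continuous_zero ν,
    ne_top_of_le_ne_top h.control_variation (h.w_variation ν)⟩

/-- Wave-front tracking can be carried out for all times. -/
theorem IsApproximation.exists_frontSolution (h : P.IsApproximation ρ₀ u p w) (hν : 1 ≤ ν)
    (y₀ : ℝ) : ∃ ρ y, ρ 0 = p ν ∧ y 0 = y₀ ∧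
      P.FrontSolution ν (w ν) 0 (P.upsilon (w ν) ρ y 0) ρ y := by
  obtain ⟨D, hw⟩ := h.exists_stepControl ν
  obtain ⟨δ, hδ₀, hδ⟩ := P.exists_gap ν
  obtain ⟨D₀, j, hp⟩ := exists_stepLe_of_integrable (h.p_integrable ν) (h.p_piecewiseConst ν)
    (h.p_right_continuous ν)
  have hw0 := h.w_mem ν 0 le_rfl
  obtain ⟨C, hrho, hleft, hy, hres⟩ := exists_resolution hw0 D₀ id j 0 y₀
    fun z => by rw [← hp]; exact h.p_mem ν z
  obtain ⟨s₂, hs₂, hsep₂⟩ := C.eventually_separated 0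
  obtain ⟨s₃, hs₃, hD₃⟩ := exists_forall_notMem_Ioc D 0
  obtain ⟨s, hs, hs'⟩ := exists_between (lt_min hs₂ hs₃)
  have hsep : ∀ τ ∈ Ioc 0 s, C.Separated τ := fun τ hτ =>
    hsep₂ τ ⟨hτ.1, hτ.2.trans_lt (hs'.trans_le (min_le_left _ _))⟩
  have hβ : 0 ≤ 6 / P.β := div_nonneg (by norm_num) P.β_pos.le
  have hE2 := energy_resolve hν hw0 hw0 hres hs hsep
  rw [sub_self, abs_zero, mul_zero, add_zero] at hE2
  have hsol := LWRModel.exists_frontSolution hν hw (h.w_mem ν) hδ₀ hδ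
    (E := P.energy (w ν 0) C 0 + 2 * P.R + 6 / P.β * (eVariationOn (w ν) (Ici 0)).toReal) _
    0 s (w ν 0) C le_rfl hw.rightLim_zero.symm hres.resolved hs hsep
    (fun d hd hdm => hD₃ d hd ⟨hdm.1, hdm.2.trans (hs'.le.trans (min_le_right _ _))⟩)
    (hres.goodAt hw0 hs hsep)
    (fun t ht => by
      have h2 := hw.variation_le le_rfl ht.1.le
      have h3 := mul_le_mul_of_nonneg_left ((le_add_of_nonneg_left (abs_nonneg _)).trans h2) hβ
      linarith) rfl
  obtain ⟨ρ, y, h1, h2, h3⟩ := hsol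
  refine ⟨ρ, y, by rw [h1, hrho, hp], by rw [h2, hy], ?_⟩
  rwa [upsilon_eq h1 h2]

theorem tendsto_lintegral_rho (C : FrontConfig) (t : ℝ) :
    Tendsto (fun s => ∫⁻ x, ‖C.rho s x - C.rho t x‖ₑ) (𝓝 t) (𝓝 0) := by
  refine tendsto_of_tendsto_of_tendsto_of_le_of_le tendsto_const_nhds ?_ (fun _ => zero_le)
    fun s => lintegral_stepLe_sub_le C.L (fun i => pos i s) (fun i => pos i t) C.d
  have : Tendsto (fun s => ∑ i ∈ C.L, ‖C.d i‖ₑ * ENNReal.ofReal |pos i s - pos i t|) (𝓝 t)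
      (𝓝 (∑ i ∈ C.L, ‖C.d i‖ₑ * ENNReal.ofReal |pos i t - pos i t|)) := by
    refine tendsto_finsetSum _ fun i _ => ?_
    refine ENNReal.Tendsto.const_mul ?_ (Or.inr enorm_ne_top)
    refine ENNReal.tendsto_ofReal ?_
    exact (((continuous_pos i).sub continuous_const).abs).tendsto t
  simpa using this

theorem FrontSolution.isFrontTracking {w : ℝ → ℝ} {ρ : ℝ → ℝ → ℝ} {y : ℝ → ℝ} {E : ℝ}
    (h : P.FrontSolution ν w 0 E ρ y) : P.IsFrontTracking ν (ρ 0) (y 0) w (Ici 0) ρ y := by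
  have hright : ∀ t ≥ 0, ∃ C : FrontConfig, P.Resolved ν (Function.rightLim w t) C t ∧
      ρ t = C.rho t ∧ y t = C.y t ∧ ∀ᶠ s in 𝓝[≥] t, ρ s = C.rho s ∧ y s = C.y s := by
    intro t ht
    obtain ⟨C, hr, hC⟩ := h.right t ht
    have := hC.self_of_nhdsWithin self_mem_Ici
    exact ⟨C, hr, this.1, this.2, hC⟩
  have hnhds : ∀ t ≥ (0 : ℝ), ∀ {X : Type} {f : ℝ → X} {l : Filter X},
      Tendsto f (𝓝[≥] t) l → (0 < t → Tendsto f (𝓝[≤] t) l) → Tendsto f (𝓝[Ici 0] t) l := by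
    intro t ht X f l h1 h2
    rcases ht.eq_or_lt with rfl | hlt
    · exact h1
    · refine Tendsto.mono_left ?_ nhdsWithin_le_nhds
      rw [← nhdsLE_sup_nhdsGE]
      exact (h2 hlt).sup h1
  refine ⟨rfl, rfl, fun t ht x => ?_, fun t ht => ?_, fun t ht x => ?_, fun t ht => ?_,
    fun t ht => ?_, fun t ht => ?_⟩
  · obtain ⟨C, hr, e, -⟩ := hright t ht
    rw [e]; exact hr.mem_grid x
  · obtain ⟨C, hr, e, -⟩ := hright t ht
    rw [e]; exact stepLe_isPiecewiseConstOn _ _ _ _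
  · obtain ⟨C, hr, e, -⟩ := hright t ht
    rw [e]; exact stepLe_continuousWithinAt _ _ _ _
  · refine hnhds t ht ?_ fun hlt => ?_
    · obtain ⟨C, -, e, -, hC⟩ := hright t ht
      refine ((tendsto_lintegral_rho C t).mono_left nhdsWithin_le_nhds).congr' ?_
      filter_upwards [hC] with s hs
      rw [hs.1, e]
    · obtain ⟨C, hC⟩ := h.left t hlt
      have e := (hC.self_of_nhdsWithin self_mem_Iic).1
      refine ((tendsto_lintegral_rho C t).mono_left nhdsWithin_le_nhds).congr' ?_
      filter_upwards [hC] with s hs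
      rw [hs.1, e]
  · refine hnhds t ht ?_ fun hlt => ?_
    · obtain ⟨C, -, -, e, hC⟩ := hright t ht
      rw [e]
      refine (((continuous_pos C.c).tendsto t).mono_left nhdsWithin_le_nhds).congr' ?_
      filter_upwards [hC] with s hs using hs.2.symm
    · obtain ⟨C, hC⟩ := h.left t hlt
      have e := (hC.self_of_nhdsWithin self_mem_Iic).2
      rw [e]
      refine (((continuous_pos C.c).tendsto t).mono_left nhdsWithin_le_nhds).congr' ?_
      filter_upwards [hC] with s hs using hs.2.symm
  · obtain ⟨C, hr, e1, e2, hC⟩ := hright t ht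
    exact hr.followsRiemann (hC.filter_mono (nhdsWithin_mono _ Ioi_subset_Ici_self)) e1 e2

end LWRModel

/-! ### Uniqueness -/

theorem frequently_nhdsGT_of_ae {x b : ℝ} (hxb : x < b) {p : ℝ → Prop}
    (h : ∀ᵐ z ∂(volume.restrict (Ioo x b)), p z) : ∃ᶠ z in 𝓝[>] x, p z := by
  intro hc
  obtain ⟨c, hxc, hcs⟩ := mem_nhdsGT_iff_exists_Ioo_subset.1 hc
  have h1 : volume (Ioo x (min b c)) = 0 := by
    rw [ae_restrict_iff' measurableSet_Ioo] at h
    refine measure_mono_null (fun z hz => ?_) h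
    exact fun hz' => hcs ⟨hz.1, hz.2.trans_le (min_le_right _ _)⟩
      (hz' ⟨hz.1, hz.2.trans_le (min_le_left _ _)⟩)
  rw [Real.volume_Ioo, ENNReal.ofReal_eq_zero] at h1
  linarith [lt_min hxb hxc]

theorem eq_of_ae_restrict {f g : ℝ → ℝ} {x b : ℝ} (hxb : x < b)
    (hf : ContinuousWithinAt f (Ici x) x) (hg : ContinuousWithinAt g (Ici x) x)
    (h : ∀ᵐ z ∂(volume.restrict (Ioo x b)), f z = g z) : f x = g x :=
  tendsto_nhds_unique_of_frequently_eq
    (hf.mono_left (nhdsWithin_mono _ Ioi_subset_Ici_self))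
    (hg.mono_left (nhdsWithin_mono _ Ioi_subset_Ici_self)) (frequently_nhdsGT_of_ae hxb h)

/-- The value of a right continuous limit in `L¹` of functions which are constant on an interval. -/
theorem eq_of_tendsto_lintegral {ρ : ℝ → ℝ → ℝ} {q : ℝ → ℝ} {l : Filter ℝ} [l.NeBot]
    (hq : Measurable q) (hlim : Tendsto (fun s => ∫⁻ x, ‖ρ s x - q x‖ₑ) l (𝓝 0)) {x b c : ℝ}
    (hxb : x < b) (hrc : ContinuousWithinAt q (Ici x) x)
    (h : ∀ᶠ s in l, ∀ z ∈ Ioo x b, ρ s z = c) : q x = c := by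
  have h0 : ∫⁻ z in Ioo x b, ‖c - q z‖ₑ = 0 := by
    refine le_antisymm (ge_of_tendsto hlim ?_) zero_le
    filter_upwards [h] with s hs
    calc ∫⁻ z in Ioo x b, ‖c - q z‖ₑ = ∫⁻ z in Ioo x b, ‖ρ s z - q z‖ₑ :=
          setLIntegral_congr_fun measurableSet_Ioo fun z hz => by simp only [hs z hz]
      _ ≤ ∫⁻ z, ‖ρ s z - q z‖ₑ := setLIntegral_le_lintegral _ _
  rw [lintegral_eq_zero_iff (by fun_prop : Measurable fun z => ‖c - q z‖ₑ)] at h0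
  refine eq_of_ae_restrict (g := fun _ => c) hxb hrc continuousWithinAt_const ?_
  filter_upwards [h0] with z hz
  simpa [sub_eq_zero, eq_comm] using hz

/-- Near the time `τ`, the profile `ρ s` is given by the self-similar solutions `G z` of the Riemann
problems at the points `z ∈ X` of the profile `q`, at the distance `r` from `X`. -/
def SelfSimilarAt (X : Finset ℝ) (G : ℝ → ℝ → ℝ) (q : ℝ → ℝ) (τ : ℝ) (ρ : ℝ → ℝ → ℝ) (r : ℝ) :
    Prop :=
  ∀ᶠ s in 𝓝[>] τ, ∀ x, (∀ z ∈ X, |x - z| < r → ρ s x = G z ((x - z) / (s - τ))) ∧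
    ((∀ z ∈ X, r ≤ |x - z|) → ρ s x = q x)

theorem eventually_le_div {M c τ : ℝ} (hc : 0 < c) : ∀ᶠ s in 𝓝[>] τ, M ≤ c / (s - τ) := by
  have h1 : ∀ᶠ s in 𝓝 τ, |M| * (s - τ) < c := by
    have : Tendsto (fun s => |M| * (s - τ)) (𝓝 τ) (𝓝 (|M| * (τ - τ))) :=
      (by fun_prop : Continuous fun s => |M| * (s - τ)).tendsto τ
    rw [sub_self, mul_zero] at this
    exact this.eventually_lt_const hc
  filter_upwards [h1.filter_mono nhdsWithin_le_nhds, self_mem_nhdsWithin] with s hs hst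
  rw [le_div_iff₀ (sub_pos.2 hst)]
  exact (mul_le_mul_of_nonneg_right (le_abs_self M) (sub_nonneg.2 (le_of_lt hst))).trans hs.le

/-- At distance between `r'` and `r` from `z` the self-similar variable tends to infinity as `s`
decreases to `τ`, so the solver takes one of its two extreme values. The `L¹` limit identifies these
values with the nearby values of `q`. -/
theorem SelfSimilarAt.shrink {X : Finset ℝ} {G : ℝ → ℝ → ℝ} {q : ℝ → ℝ} {τ r r' : ℝ}
    {ρ : ℝ → ℝ → ℝ} (h : SelfSimilarAt X G q τ ρ r) (hr' : 0 < r') (hrr' : r' ≤ r)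
    (hq : Measurable q) (hrc : ∀ x, ContinuousWithinAt q (Ici x) x)
    (hlim : Tendsto (fun s => ∫⁻ x, ‖ρ s x - q x‖ₑ) (𝓝[>] τ) (𝓝 0))
    (hG : ∀ z ∈ X, ∃ a b M, (∀ ξ ≤ -M, G z ξ = a) ∧ ∀ ξ ≥ M, G z ξ = b) :
    SelfSimilarAt X G q τ ρ r' := by
  have hG' : ∀ z, ∃ a b M, z ∈ X → (∀ ξ ≤ -M, G z ξ = a) ∧ ∀ ξ ≥ M, G z ξ = b := fun z => by
    by_cases hz : z ∈ X
    · obtain ⟨a, b, M, h1⟩ := hG z hz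
      exact ⟨a, b, M, fun _ => h1⟩
    · exact ⟨0, 0, 0, fun h => absurd h hz⟩
  choose a b M hM using hG'
  have hright : ∀ z ∈ X, ∀ x, z < x → |x - z| < r → q x = b z := by
    intro z hz x hzx hxr
    rw [abs_of_pos (sub_pos.2 hzx)] at hxr
    refine eq_of_tendsto_lintegral (b := z + r) hq hlim (by linarith) (hrc x) ?_
    filter_upwards [h, eventually_le_div (M := M z) (sub_pos.2 hzx), self_mem_nhdsWithin]
      with s hs hMs hst x' hx'
    rw [((hs x').1 z hz) (by rw [abs_of_pos (by linarith [hx'.1])]; linarith [hx'.2])]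
    refine (hM z hz).2 _ (hMs.trans ?_)
    exact div_le_div_of_nonneg_right (by linarith [hx'.1]) (sub_nonneg.2 (le_of_lt hst))
  have hleft : ∀ z ∈ X, ∀ x, x < z → |x - z| < r → q x = a z := by
    intro z hz x hzx hxr
    rw [abs_of_neg (sub_neg.2 hzx)] at hxr
    refine eq_of_tendsto_lintegral (b := (x + z) / 2) hq hlim (by linarith) (hrc x) ?_
    filter_upwards [h, eventually_le_div (M := M z) (c := (z - x) / 2) (by linarith),
      self_mem_nhdsWithin] with s hs hMs hst x' hx'
    rw [((hs x').1 z hz) (by rw [abs_of_neg (by linarith [hx'.2])]; linarith [hx'.1])]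
    refine (hM z hz).1 _ ?_
    rw [le_neg, ← neg_div]
    refine hMs.trans ?_
    exact div_le_div_of_nonneg_right (by linarith [hx'.2]) (sub_nonneg.2 (le_of_lt hst))
  have hall : ∀ᶠ s in 𝓝[>] τ, ∀ z ∈ X, M z ≤ r' / (s - τ) :=
    (Filter.eventually_all_finset X).2 fun z _ => eventually_le_div hr'
  filter_upwards [h, hall, self_mem_nhdsWithin] with s hs hMs hst x
  have hst' : 0 ≤ s - τ := sub_nonneg.2 (le_of_lt hst)
  refine ⟨fun z hz hxz => (hs x).1 z hz (hxz.trans_le hrr'), fun hx => ?_⟩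
  by_cases hfar : ∀ z ∈ X, r ≤ |x - z|
  · exact (hs x).2 hfar
  push Not at hfar
  obtain ⟨z, hz, hxz⟩ := hfar
  have h1 := hx z hz
  rw [(hs x).1 z hz hxz]
  rcases lt_trichotomy x z with h2 | rfl | h2
  · rw [hleft z hz x h2 hxz]
    rw [abs_of_neg (sub_neg.2 h2)] at h1
    refine (hM z hz).1 _ ?_
    rw [le_neg, ← neg_div]
    exact (hMs z hz).trans (div_le_div_of_nonneg_right h1 hst')
  · rw [sub_self, abs_zero] at h1
    exact absurd h1 (not_le.2 hr')
  · rw [hright z hz x h2 hxz]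
    rw [abs_of_pos (sub_pos.2 h2)] at h1
    exact (hM z hz).2 _ ((hMs z hz).trans (div_le_div_of_nonneg_right h1 hst'))

/-- The radius in the definition is existential and may differ for the two solutions. After
shrinking to a common one both are given by the same formula. -/
theorem SelfSimilarAt.unique {X : Finset ℝ} {G : ℝ → ℝ → ℝ} {q : ℝ → ℝ} {τ r r' : ℝ}
    {ρ ρ' : ℝ → ℝ → ℝ} (h : SelfSimilarAt X G q τ ρ r) (h' : SelfSimilarAt X G q τ ρ' r')
    (hr : 0 < r) (hr' : 0 < r')
    (hq : Measurable q) (hrc : ∀ x, ContinuousWithinAt q (Ici x) x)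
    (hlim : Tendsto (fun s => ∫⁻ x, ‖ρ s x - q x‖ₑ) (𝓝[>] τ) (𝓝 0))
    (hlim' : Tendsto (fun s => ∫⁻ x, ‖ρ' s x - q x‖ₑ) (𝓝[>] τ) (𝓝 0))
    (hG : ∀ z ∈ X, ∃ a b M, (∀ ξ ≤ -M, G z ξ = a) ∧ ∀ ξ ≥ M, G z ξ = b) :
    ∀ᶠ s in 𝓝[>] τ, ρ s = ρ' s := by
  have h1 := h.shrink (lt_min hr hr') (min_le_left _ _) hq hrc hlim hG
  have h2 := h'.shrink (lt_min hr hr') (min_le_right _ _) hq hrc hlim' hG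
  filter_upwards [h1, h2] with s hs hs'
  funext x
  by_cases hfar : ∀ z ∈ X, min r r' ≤ |x - z|
  · rw [(hs x).2 hfar, (hs' x).2 hfar]
  · push Not at hfar
    obtain ⟨z, hz, hxz⟩ := hfar
    rw [(hs x).1 z hz hxz, (hs' x).1 z hz hxz]

theorem exists_bound_stepLe {g : ℝ → ℝ} {S : Finset ℝ} {D : ℝ → ℝ} {l : ℝ}
    (h : ∀ ξ, g ξ = l + stepLe S id D ξ) :
    ∃ a b M, (∀ ξ ≤ -M, g ξ = a) ∧ ∀ ξ ≥ M, g ξ = b := by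
  have hb : ∀ s ∈ S, |s| < ∑ s ∈ S, |s| + 1 := fun s hs => by
    have := Finset.single_le_sum (f := fun s : ℝ => |s|) (fun _ _ => abs_nonneg _) hs
    linarith
  refine ⟨l + 0, l + ∑ s ∈ S, D s, ∑ s ∈ S, |s| + 1, fun ξ hξ => ?_, fun ξ hξ => ?_⟩
  · rw [h, stepLe_of_forall_gt (x := id) fun s hs => ?_]
    have := neg_abs_le s
    have := hb s hs
    change ξ < s
    linarith
  · rw [h, stepLe_of_forall_le (x := id) fun s hs => ?_]
    have := le_abs_self s
    have := hb s hs
    change s ≤ ξ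
    linarith

namespace LWRModel

variable {P : LWRModel} {ν : ℕ} {p w : ℝ → ℝ} {y₀ : ℝ} {I : Set ℝ} {ρ ρ' : ℝ → ℝ → ℝ}
  {y y' : ℝ → ℝ}

theorem traces_mem_grid {q : ℝ → ℝ} (hq : ∀ x, q x ∈ P.densityGrid ν)
    (hpc : IsPiecewiseConstOn q univ) (hrc : ∀ x, ContinuousWithinAt q (Ici x) x) (z : ℝ) :
    Function.leftLim q z ∈ P.densityGrid ν ∧ Function.rightLim q z ∈ P.densityGrid ν := by
  constructor
  · obtain ⟨D, hD⟩ := hpc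
    obtain ⟨c, j, h⟩ := exists_stepLe_of_piecewiseConst D q hrc
      fun a b => hD a (mem_univ _) b (mem_univ _)
    obtain ⟨z', hz', he⟩ := exists_stepLe_eq_stepLt D id j z
    have : Function.leftLim q z = q z' := by
      refine leftLim_eq_of_tendsto (tendsto_const_nhds.congr' ?_)
      filter_upwards [Ioo_mem_nhdsLT hz'] with x hx
      rw [h x, h z', he x hx.1.le hx.2, he z' le_rfl hz']
    rw [this]; exact hq z'
  · rw [(hrc z).rightLim_eq]; exact hq z

open Classical in
/-- The Riemann solver used at the point `z` for the profile `q` and the vehicle at `y₀`. -/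
def solverAt (P : LWRModel) (ν : ℕ) (u : ℝ) (q : ℝ → ℝ) (y₀ z ξ : ℝ) : ℝ :=
  if z = y₀ then P.constrainedRiemann ν u (Function.leftLim q z) (Function.rightLim q z) ξ
  else P.riemann ν (Function.leftLim q z) (Function.rightLim q z) ξ

theorem solverAt_bound {u : ℝ} (hu : u ∈ P.speedGrid ν) {q : ℝ → ℝ}
    (hq : ∀ x, q x ∈ P.densityGrid ν)
    (hpc : IsPiecewiseConstOn q univ) (hrc : ∀ x, ContinuousWithinAt q (Ici x) x) (y₀ z : ℝ) :
    ∃ a b M, (∀ ξ ≤ -M, P.solverAt ν u q y₀ z ξ = a) ∧ ∀ ξ ≥ M, P.solverAt ν u q y₀ z ξ = b := by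
  obtain ⟨hl, hr⟩ := traces_mem_grid hq hpc hrc z
  obtain ⟨S, D, hf⟩ := exists_riemannFan hl hr
  unfold solverAt
  by_cases hz : z = y₀
  · simp only [if_pos hz]
    by_cases hv : P.Violates ν u (Function.leftLim q z) (Function.rightLim q z)
    · obtain ⟨S', D', hf'⟩ := exists_activeFan hu hl hr hv
      refine exists_bound_stepLe (S := S') (D := D') (l := Function.leftLim q z) fun ξ => ?_
      rw [constrainedRiemann, if_pos hv, hf'.eq]
    · refine exists_bound_stepLe (S := S) (D := D) (l := Function.leftLim q z) fun ξ => ?_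
      rw [constrainedRiemann, if_neg hv, hf.eq]
  · simp only [if_neg hz]
    exact exists_bound_stepLe hf.eq

theorem FollowsRiemann.selfSimilarAt {u τ : ℝ} (h : P.FollowsRiemann ν u ρ y τ) {X : Finset ℝ}
    (hX : ∀ z, z ∈ X ↔ z = y τ ∨ ¬ ContinuousAt (ρ τ) z) :
    ∃ r > 0, SelfSimilarAt X (P.solverAt ν u (ρ τ) (y τ)) (ρ τ) τ ρ r ∧
      ∀ᶠ s in 𝓝[>] τ, y s = y τ + P.vehicleSpeed ν u (Function.leftLim (ρ τ) (y τ))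
        (Function.rightLim (ρ τ) (y τ)) * (s - τ) := by
  obtain ⟨r, hr, h⟩ := h
  refine ⟨r, hr, ?_, h.mono fun s hs => hs.1⟩
  filter_upwards [h] with s hs x
  obtain ⟨h1, h2, h3⟩ := hs.2 x
  refine ⟨fun z hz hxz => ?_, fun hx => ?_⟩
  · unfold solverAt
    split_ifs with hzy
    · rw [hzy]; exact h1 (hzy ▸ hxz)
    · exact h2 z hzy (((hX z).1 hz).resolve_left hzy) hxz
  · exact h3 (hx _ ((hX _).2 (Or.inl rfl))) fun z hz => hx _ ((hX _).2 (Or.inr hz))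

theorem IsFrontTracking.mono (h : P.IsFrontTracking ν p y₀ w I ρ y) {J : Set ℝ} (hJ : J ⊆ I) :
    P.IsFrontTracking ν p y₀ w J ρ y :=
  ⟨h.initial_density, h.initial_position, fun t ht => h.mem_grid t (hJ ht),
    fun t ht => h.piecewiseConst t (hJ ht), fun t ht => h.right_continuous t (hJ ht),
    fun t ht => (h.density_continuous t (hJ ht)).mono_left (nhdsWithin_mono _ hJ),
    h.position_continuous.mono hJ, fun t ht => h.followsRiemann t (hJ ht)⟩

/-- The result of wave-front tracking is unique. -/
theorem IsFrontTracking.unique (h : P.IsFrontTracking ν p y₀ w I ρ y)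
    (h' : P.IsFrontTracking ν p y₀ w I ρ' y')
    (hw : ∀ t ∈ I, Function.rightLim w t ∈ P.speedGrid ν) {t : ℝ} (hI : Icc 0 t ⊆ I) (ht : 0 ≤ t) :
    ρ t = ρ' t ∧ y t = y' t := by
  classical
  set s : Set ℝ := {τ | ρ τ = ρ' τ ∧ y τ = y' τ} with hs
  suffices Icc 0 t ⊆ s from this ⟨ht, le_rfl⟩
  have hmeas : ∀ τ ∈ I, Measurable (ρ τ) := fun τ hτ => (h.piecewiseConst τ hτ).measurable
  have hmeas' : ∀ τ ∈ I, Measurable (ρ' τ) := fun τ hτ => (h'.piecewiseConst τ hτ).measurable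
  -- Continuous induction: the set of times of agreement is closed, contains `0`, and contains a
  -- right neighbourhood of each of its points before `t`.
  refine IsClosed.Icc_subset_of_forall_mem_nhdsWithin ?_ ?_ ?_
  · refine isClosed_of_closure_subset fun τ hτ => ?_
    have hτI : τ ∈ Icc 0 t := closure_minimal inter_subset_right isClosed_Icc hτ
    have hne : (𝓝[s ∩ Icc 0 t] τ).NeBot := mem_closure_iff_nhdsWithin_neBot.1 hτ
    have hle : 𝓝[s ∩ Icc 0 t] τ ≤ 𝓝[I] τ := nhdsWithin_mono _ (inter_subset_right.trans hI)
    have hτI' := hI hτI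
    refine ⟨⟨?_, ?_⟩, hτI⟩
    · have h1 := (h.density_continuous τ hτI').mono_left hle
      have h2 := (h'.density_continuous τ hτI').mono_left hle
      have h3 := h1.add h2
      rw [add_zero] at h3
      have h0 : ∫⁻ x, ‖ρ τ x - ρ' τ x‖ₑ = 0 := by
        refine le_antisymm (ge_of_tendsto h3 ?_) zero_le
        filter_upwards [self_mem_nhdsWithin] with σ hσ
        have hσI := hI hσ.2
        have hσm := hmeas σ hσI
        have hτm := hmeas τ hτI'
        rw [← lintegral_add_left (by fun_prop : Measurable fun x => ‖ρ σ x - ρ τ x‖ₑ)]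
        refine lintegral_mono fun x => ?_
        have e : ρ τ x - ρ' τ x = (ρ' σ x - ρ' τ x) - (ρ σ x - ρ τ x) := by
          rw [hσ.1.1]; ring
        rw [e, add_comm]
        exact enorm_sub_le
      have hτm := hmeas τ hτI'
      have hτm' := hmeas' τ hτI'
      rw [lintegral_eq_zero_iff (by fun_prop : Measurable fun x => ‖ρ τ x - ρ' τ x‖ₑ)] at h0
      funext x
      refine eq_of_ae_restrict (b := x + 1) (by linarith) (h.right_continuous τ hτI' x)
        (h'.right_continuous τ hτI' x) (ae_restrict_of_ae ?_)
      filter_upwards [h0] with z hz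
      simpa [sub_eq_zero] using hz
    · have h1 := (h.position_continuous τ hτI').mono_left hle
      have h2 := (h'.position_continuous τ hτI').mono_left hle
      refine tendsto_nhds_unique (h1.congr' ?_) h2
      filter_upwards [self_mem_nhdsWithin] with σ hσ using hσ.1.2
  · exact ⟨h.initial_density.trans h'.initial_density.symm,
      h.initial_position.trans h'.initial_position.symm⟩
  · rintro τ ⟨⟨hρ, hy⟩, hτ⟩
    have hτI := hI ⟨hτ.1, hτ.2.le⟩
    have hle : 𝓝[>] τ ≤ 𝓝[I] τ := by
      rw [← nhdsWithin_Ioo_eq_nhdsGT hτ.2]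
      exact nhdsWithin_mono _ fun σ hσ => hI ⟨hτ.1.trans hσ.1.le, hσ.2.le⟩
    have hpc := h.piecewiseConst τ hτI
    have hrc := h.right_continuous τ hτI
    obtain ⟨X, hX⟩ : ∃ X : Finset ℝ, ∀ z, z ∈ X ↔ z = y τ ∨ ¬ ContinuousAt (ρ τ) z := by
      obtain ⟨D, hD⟩ := hpc
      obtain ⟨c, j, hstep⟩ := exists_stepLe_of_piecewiseConst D (ρ τ) hrc
        fun a b => hD a (mem_univ _) b (mem_univ _)
      refine ⟨insert (y τ) (D.filter fun z => ¬ ContinuousAt (ρ τ) z), fun z => ?_⟩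
      rw [Finset.mem_insert, Finset.mem_filter]
      refine or_congr_right ⟨fun h => h.2, fun h => ⟨?_, h⟩⟩
      have : ¬ ContinuousAt (stepLe D id j) z := fun hc => h (by
        rw [show ρ τ = fun z => c + stepLe D id j z from funext hstep]
        exact continuousAt_const.add hc)
      obtain ⟨d, hd, rfl⟩ := exists_of_not_continuousAt_stepLe this
      exact hd
    obtain ⟨r, hr, h1, h2⟩ := (h.followsRiemann τ hτI).selfSimilarAt hX
    obtain ⟨r', hr', h1', h2'⟩ := (h'.followsRiemann τ hτI).selfSimilarAt (X := X)
      (by rw [← hρ, ← hy]; exact hX)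
    rw [← hρ, ← hy] at h1' h2'
    have hlim' := (h'.density_continuous τ hτI).mono_left hle
    rw [← hρ] at hlim'
    have := h1.unique h1' hr hr' (hmeas τ hτI) hrc ((h.density_continuous τ hτI).mono_left hle)
      hlim' fun z _ => solverAt_bound (hw τ hτI) (h.mem_grid τ hτI) hpc hrc _ z
    filter_upwards [this, h2, h2'] with σ hσ e1 e2
    exact ⟨hσ, e1.trans e2.symm⟩

end LWRModel

end

/-! ### Transfer from the constructed solution to every solution -/

theorem corollary3p4 (P : LWRModel) (ρ₀ u : ℝ → ℝ) (y₀ : ℝ) (p w : ℕ → ℝ → ℝ)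
    (h : P.IsApproximation ρ₀ u p w) (ν : ℕ) (hν : 1 ≤ ν) :
    (∃ ρ y, P.IsFrontTracking ν (p ν) y₀ (w ν) (Ici 0) ρ y) ∧
    (∀ T > 0, ∀ ρ y, P.IsFrontTracking ν (p ν) y₀ (w ν) (Ico 0 T) ρ y →
      ∃ ρ' y', P.IsFrontTracking ν (p ν) y₀ (w ν) (Ici 0) ρ' y' ∧
        ∀ t ∈ Ico 0 T, ρ' t = ρ t ∧ y' t = y t) ∧
    (∀ ρ y, P.IsFrontTracking ν (p ν) y₀ (w ν) (Ici 0) ρ y →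
      HasFinitelyManyFronts ρ y ∧
      ∀ t > 0,
        eVariationOn (ρ t) univ ≠ ⊤ ∧
        (eVariationOn (ρ t) univ).toReal ≤ P.upsilon (w ν) ρ y t ∧
        P.upsilon (w ν) ρ y t ≤ P.upsilon (w ν) ρ y 0 ∧
        P.upsilon (w ν) ρ y 0 ≤ (essVariation ρ₀ univ).toReal + 2 * P.R +
          6 / P.β * (essVariation u (Ici 0)).toReal) := by
  obtain ⟨D, hw⟩ := h.exists_stepControl ν
  have hgrid : ∀ t ∈ Ici (0 : ℝ), Function.rightLim (w ν) t ∈ P.speedGrid ν := fun t ht =>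
    hw.rightLim_mem ht (h.w_mem ν)
  have hβ : 0 ≤ 6 / P.β := div_nonneg (by norm_num) P.β_pos.le
  obtain ⟨ρ', y', hρ0, hy0, hsol⟩ := h.exists_frontSolution hν y₀
  have hft := hsol.isFrontTracking
  rw [hρ0, hy0] at hft
  refine ⟨⟨ρ', y', hft⟩, fun T hT ρ y hρ => ⟨ρ', y', hft, fun t ht => ?_⟩, fun ρ y hρ => ?_⟩
  · exact (hft.mono Ico_subset_Ici_self).unique hρ (fun t ht => hgrid t ht.1)
      (fun τ hτ => ⟨hτ.1, hτ.2.trans_lt ht.2⟩) ht.1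
  -- Uniqueness reduces an arbitrary solution to the one built from fronts.
  have heq : ∀ t ≥ 0, ρ t = ρ' t ∧ y t = y' t := fun t ht =>
    hρ.unique hft hgrid Icc_subset_Ici_self ht
  have hups : ∀ t ≥ 0, P.upsilon (w ν) ρ y t = P.upsilon (w ν) ρ' y' t := fun t ht =>
    LWRModel.upsilon_congr (heq t ht).1 (heq t ht).2
  obtain ⟨L, hL⟩ := hsol.lines
  refine ⟨⟨L, fun t ht => ?_⟩, fun t ht => ⟨?_, ?_, ?_, ?_⟩⟩
  · obtain ⟨C, hCL, e1, e2⟩ := hL t ht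
    rw [(heq t ht).1, (heq t ht).2, e1, e2]
    refine ⟨⟨C.c, hCL C.c_mem, rfl⟩, fun x hx => ?_⟩
    obtain ⟨i, hi, hix⟩ := exists_of_not_continuousAt_stepLe hx
    exact ⟨i, hCL (FrontConfig.mem_lines hi), hix.symm⟩
  · obtain ⟨C, -, e1, -⟩ := hL t ht.le
    rw [(heq t ht.le).1, e1, FrontConfig.rho, eVariationOn_stepLe]
    exact ENNReal.ofReal_ne_top
  · have h1 := P.neg_two_mul_le_gam (w ν t) (Function.leftLim (ρ t) (y t))
      (Function.rightLim (ρ t) (y t))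
    have h2 := mul_nonneg hβ (ENNReal.toReal_nonneg (a := eVariationOn (w ν) (Ici t)))
    rw [LWRModel.upsilon, LWRModel.gamma_eq]
    linarith
  · rw [hups t ht.le, hups 0 le_rfl]
    exact hsol.upsilon t ht
  · have h1 := P.gam_nonpos (w ν 0) (Function.leftLim (ρ 0) (y 0)) (Function.rightLim (ρ 0) (y 0))
    have h2 := ENNReal.toReal_mono h.density_variation (h.p_variation ν)
    have h3 := ENNReal.toReal_mono h.control_variation (h.w_variation ν)
    have h4 := mul_le_mul_of_nonneg_left h3 hβ
    rw [LWRModel.upsilon, LWRModel.gamma_eq]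
    rw [hρ.initial_density] at h1 ⊢
    linarith
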